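/- **Setting.** Let $X(t)$, $t\in\mathbb R$, be a measurable, mean-square continuous, stationary, zero-mean real Gaussian process with covariance function $B(t-t')=\int_{\mathbb R}e^{iu(t-t')}f(u)\,du$ and even spectral density $f\ge 0$, $f\in L^1(\mathbb R)$, where $$f(\lambda)=\frac{h(\lambda)}{|\lambda^2-s_0^2|^{2\alpha}},\qquad s_0>1,\quad \alpha\in(0,\tfrac12).$$ Here $h$ is even, non-negative, bounded, four times boundedly differentiable on $[-\frac12,\frac12]$ with $h(0)=1$ and $h^{(i)}(0)=0$ for $i=1,2,3,4$, positive in a neighbourhood of $\pm s_0$, and $\int_{\mathbb R}h(\lambda)(1+|\lambda|)^{-\varepsilon}d\lambda<\infty$ for all $\varepsilon>0$. Let $\psi\in L^2(\mathbb R)$ be real-valued and not almost everywhere zero, with Fourier transform $\widehat\psi(\lambda)=\int e^{-i\lambda t}\psi(t)\,dt$ (in the $L^2$ sense) supported in $[-A,A]$, $A>0$, continuous except at finitely many points and of bounded variation on $[-A,A]$. Assume that $\int_{\mathbb R^2}\psi(t)B(t-t')\psi(t')\,dt\,dt'$ exists as an improper Cauchy integral on the plane. Put $c_2=\int|\widehat\psi(\lambda)|^2d\lambda$,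 $c_3=2\int\lambda^2|\widehat\psi(\lambda)|^2d\lambda$. Let $(a_j)_{j\in\mathbb N}$ be a strictly increasing sequence of positive numbers with $a_j\to\infty$, let $b_{jk}\in\mathbb R$ ($j\in\mathbb N$, $k\in\mathbb Z$) and let $m_j$ be positive integers. Let $\delta_{jk}=a_j^{-1/2}\int_{\mathbb R}\psi\big(\frac{t-b_{jk}}{a_j}\big)X(t)\,dt$ (mean-square improper integral) and $$\bar\delta_j=\frac1{m_j}\sum_{k=1}^{m_j}\delta_{jk}^2,\qquad \Delta\bar\delta_j=\frac{\bar\delta_j-\bar\delta_{j+1}}{a_j^{-2}-a_{j+1}^{-2}}.$$ **Adjusted statistics.** With $y_1=\bar\delta_j/c_2$, $y_2=\Delta\bar\delta_j/c_3$, the adjusted statistics are $\bar\delta_j^{a}=c_2y_1^a$, $\Delta\bar\delta_j^{a}=c_3y_2^a$, where * if $0<y_1<1$ and $y_2\ge y_1^2/2$: $y_1^a=y_1$, $y_2^a=\max(y_1^2-y_2,\,y_1^2/4)$; * if $0<y_1<1$ and $y_2\le0$: $y_1^a=y_1$, $y_2^a=\min(-y_2,\,y_1^2/4)$; * if $y_1\ge1$: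 $y_2^a=y_2$ when $0<y_2<\frac12$, $y_2^a=\max(1-y_2,\frac14)$ when $y_2\ge\frac12$, $y_2^a=\min(-y_2,\frac14)$ when $y_2\le0$, and $y_1^a=\max\big(2-y_1,\,\frac12(1+\sqrt{2y_2^a})\big)$; * otherwise $(y_1^a,y_2^a)=(y_1,y_2)$. Let $\hat s_{0j},\hat\alpha_j$ be random variables such that, whenever the system $$\alpha' s^{-4\alpha'-2}=\Delta\bar\delta_j^{a}/c_3,\qquad s^{-4\alpha'}=\bar\delta_j^{a}/c_2$$ has a solution $(s,\alpha')$ with $s,\alpha'>0$, the pair $(\hat s_{0j},\hat\alpha_j)$ is such a solution. **Theorem.** (i) Whenever $(\hat s_{0j},\hat\alpha_j)$ is a solution of the system with positive components, $$\hat s_{0j}=\exp\Big(\tfrac12 W\Big(\frac{\ln(c_2/\bar\delta_j^{a})}{2q_j}\Big)\Big),\qquad \hat\alpha_j=q_j\exp\Big(W\Big(\frac{\ln(c_2/\bar\delta_j^{a})}{2q_j}\Big)\Big),\qquad q_j=\frac{c_2}{c_3}\,\frac{\Delta\bar\delta_j^{a}}{\bar\delta_j^{a}},$$ where $W$ is the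 principal branch of the Lambert function ($W(x)e^{W(x)}=x$, $W(x)\ge-1$, for $x\ge-1/e$). (ii) Suppose in addition that there are $\gamma_j>0$ with $|b_{jk_1}-b_{jk_2}|\ge|k_1-k_2|\gamma_j$ for all $j\in\mathbb N$ and $k_1,k_2\in\mathbb Z$, and a decreasing sequence $r_j>0$, $r_j\to0$, with $\sum_j\frac1{r_j^2m_j}<\infty$ and $\sum_j\frac{a_j^2}{r_j^2\gamma_j^2m_j}<\infty$, that there are $\varepsilon>0$ and $j_0$ with $a_{j+1}\ge(1+\varepsilon)a_j$ for all $j\ge j_0$, and that the sequence $a_j^2r_j$ is bounded. Then $\hat s_{0j}\to s_0$ and $\hat\alpha_j\to\alpha$ almost surely as $j\to\infty$, and there are almost surely finite random variables $c_{10}$ and $c_{11}$ such that, almost surely, for all $j\in\mathbb N$, $$|\hat s_{0j}-s_0|\le c_{10}\max(a_j^2r_j,\,a_j^{-1}),\qquad |\hat\alpha_j-\alpha|\le c_{11}\max(a_j^2r_j,\,a_j^{-1}).$$ -/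

import Mathlib

open MeasureTheory ProbabilityTheory Filter Set
open scoped Topology ENNReal

namespace SeasonalLongMemory

/-- `X` is a (jointly) measurable, real, zero-mean Gaussian process on the time line `ℝ` whose
covariance is `Cov(X(s), X(t)) = ∫ exp(i (s - t) u) f(u) du` with an even non-negative spectral
density `f ∈ L¹(ℝ)`. Such a process is stationary and mean-square continuous. -/
structure IsGaussianWithSpectralDensity {Ω : Type*} [MeasurableSpace Ω] (P : Measure Ω)
    (X : ℝ → Ω → ℝ) (f : ℝ → ℝ) : Prop where
  measurable : Measurable (Function.uncurry X)
  gaussian : IsGaussianProcess X P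
  mean_zero : ∀ t, ∫ ω, X t ω ∂P = 0
  density_nonneg : ∀ u, 0 ≤ f u
  density_even : ∀ u, f (-u) = f u
  density_integrable : Integrable f
  covariance_eq : ∀ s t : ℝ, ((cov[X s, X t; P] : ℝ) : ℂ)
    = ∫ u : ℝ, Complex.exp (Complex.I * (s - t : ℝ) * u) * (f u : ℂ)

/-- The spectral density is `f(u) = h(u) / |u² - s₀²|^{2α}` with `s₀ > 1`, `α ∈ (0, 1/2)` and an
even, non-negative, bounded `h` that is four times boundedly differentiable on `[-1/2, 1/2]`
(one-sided derivatives at the end points), with `h(0) = 1`, `h^{(i)}(0) = 0` for `i = 1, …, 4`,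
`h > 0` near `± s₀`, and `∫ h(u) / (1 + |u|)^ε du < ∞` for all `ε > 0`. -/
structure IsSeasonalSpectrum (f h : ℝ → ℝ) (s₀ α : ℝ) : Prop where
  one_lt_s₀ : 1 < s₀
  α_pos : 0 < α
  α_lt_half : α < 1 / 2
  density_eq : ∀ u, f u = h u / |u ^ 2 - s₀ ^ 2| ^ (2 * α)
  even : ∀ u, h (-u) = h u
  nonneg : ∀ u, 0 ≤ h u
  bounded : ∃ C, ∀ u, h u ≤ C
  differentiable : ∀ i < 4, DifferentiableOn ℝ
    (iteratedDerivWithin i h (Icc (-(1 / 2)) (1 / 2))) (Icc (-(1 / 2)) (1 / 2))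
  deriv_bounded : ∀ i ∈ Finset.Icc 1 4, ∃ C, ∀ u ∈ Icc (-(1 / 2) : ℝ) (1 / 2),
    |iteratedDerivWithin i h (Icc (-(1 / 2)) (1 / 2)) u| ≤ C
  deriv_zero : ∀ i ∈ Finset.Icc 1 4, iteratedDerivWithin i h (Icc (-(1 / 2)) (1 / 2)) 0 = 0
  value_zero : h 0 = 1
  pos_near : (∀ᶠ u in 𝓝 s₀, 0 < h u) ∧ (∀ᶠ u in 𝓝 (-s₀), 0 < h u)
  integrable : ∀ ε : ℝ, 0 < ε → Integrable (fun u => h u / (1 + |u|) ^ ε)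

/-- `ψhat` is (a representative of) the `L²` Fourier transform `u ↦ ∫ exp(-i u t) ψ(t) dt` of `ψ`:
the truncated integrals converge to it in `L²(ℝ)`. -/
def IsFourierTransformL2 (ψ : ℝ → ℝ) (ψhat : ℝ → ℂ) : Prop :=
  MemLp ψhat 2 ∧
  Tendsto (fun T : ℝ => eLpNorm (fun u : ℝ =>
      (∫ t in (-T)..T, Complex.exp (-(Complex.I * u * t)) * (ψ t : ℂ)) - ψhat u) 2 volume)
    atTop (𝓝 0)

/-- `ψ` is a real function in `L²(ℝ)` whose Fourier transform `ψhat` is supported in `[-A, A]`,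
continuous except at finitely many points, and of bounded variation on `[-A, A]`. -/
structure IsBandLimitedFilter (ψ : ℝ → ℝ) (ψhat : ℝ → ℂ) (A : ℝ) : Prop where
  memLp : MemLp ψ 2
  fourier : IsFourierTransformL2 ψ ψhat
  A_pos : 0 < A
  support_subset : Function.support ψhat ⊆ Icc (-A) A
  finite_discontinuities : {u | ¬ ContinuousAt ψhat u}.Finite
  boundedVariation : BoundedVariationOn ψhat (Icc (-A) A)

/-- `∫∫ ψ(t) B(t - t') ψ(t') dt dt'`, with `B` the covariance function of `X`, exists as an improper
integral over the plane: the integrals over bounded rectangles converge as all four sides of the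
rectangle go to infinity. -/
def ImproperCovarianceIntegralExists {Ω : Type*} [MeasurableSpace Ω] (P : Measure Ω)
    (X : ℝ → Ω → ℝ) (ψ : ℝ → ℝ) : Prop :=
  ∃ L : ℝ, Tendsto (fun p : (ℝ × ℝ) × (ℝ × ℝ) =>
      ∫ t in (-p.1.1)..p.1.2, ∫ t' in (-p.2.1)..p.2.2, ψ t * cov[X (t - t'), X 0; P] * ψ t')
    atTop (𝓝 L)

/-- `d` is a version of `a^{-1/2} ∫ ψ((t - b) / a) X(t) dt`, an improper integral in the
mean-square sense: `d` is the `L²(P)` limit of the integrals over `[-S, T]` as `S, T → ∞`. -/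
def IsFilterTransform {Ω : Type*} [MeasurableSpace Ω] (P : Measure Ω)
    (X : ℝ → Ω → ℝ) (ψ : ℝ → ℝ) (a b : ℝ) (d : Ω → ℝ) : Prop :=
  Measurable d ∧ MemLp d 2 P ∧
  Tendsto (fun p : ℝ × ℝ => eLpNorm (fun ω =>
      (1 / √a) * (∫ t in (-p.1)..p.2, ψ ((t - b) / a) * X t ω) - d ω) 2 P)
    atTop (𝓝 0)

open Classical in
/-- The filter transform `d_X(a, b) = a^{-1/2} ∫ ψ((t - b) / a) X(t) dt` (unique up to null
events). -/
noncomputable def filterTransform {Ω : Type*} [MeasurableSpace Ω] (P : Measure Ω)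
    (X : ℝ → Ω → ℝ) (ψ : ℝ → ℝ) (a b : ℝ) : Ω → ℝ :=
  if hd : ∃ d, IsFilterTransform P X ψ a b d then hd.choose else 0

/-- `c₂ = ∫ |ψhat(u)|² du`. -/
noncomputable def c₂ (ψhat : ℝ → ℂ) : ℝ := ∫ u, ‖ψhat u‖ ^ 2

/-- `c₃ = 2 ∫ u² |ψhat(u)|² du`. -/
noncomputable def c₃ (ψhat : ℝ → ℂ) : ℝ := 2 * ∫ u, u ^ 2 * ‖ψhat u‖ ^ 2

/-- First statistic: the average over `1 ≤ k ≤ m_j` of `δ_{jk}²`, `δ_{jk} = d_X(a_j, b_{jk})`. -/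
noncomputable def meanSquare {Ω : Type*} [MeasurableSpace Ω] (P : Measure Ω)
    (X : ℝ → Ω → ℝ) (ψ : ℝ → ℝ) (a : ℕ → ℝ) (b : ℕ → ℤ → ℝ) (m : ℕ → ℕ) (j : ℕ) (ω : Ω) : ℝ :=
  (1 / (m j : ℝ)) * ∑ k ∈ Finset.Icc (1 : ℤ) (m j), filterTransform P X ψ (a j) (b j k) ω ^ 2

/-- Second statistic: the normalised increment of the first statistic. -/
noncomputable def incrMeanSquare {Ω : Type*} [MeasurableSpace Ω] (P : Measure Ω)
    (X : ℝ → Ω → ℝ) (ψ : ℝ → ℝ) (a : ℕ → ℝ) (b : ℕ → ℤ → ℝ) (m : ℕ → ℕ) (j : ℕ) (ω : Ω) : ℝ :=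
  (meanSquare P X ψ a b m j ω - meanSquare P X ψ a b m (j + 1) ω)
    / ((a j) ^ (-2 : ℤ) - (a (j + 1)) ^ (-2 : ℤ))

/-- Adjustment of the normalised pair `(y₁, y₂)`: points outside the feasible region
`{0 < y₁ < 1, 0 < y₂ < y₁² / 2}` are reflected into it. -/
noncomputable def adjust (y₁ y₂ : ℝ) : ℝ × ℝ :=
  if 0 < y₁ ∧ y₁ < 1 ∧ y₁ ^ 2 / 2 ≤ y₂ then (y₁, max (y₁ ^ 2 - y₂) (y₁ ^ 2 / 4))
  else if 0 < y₁ ∧ y₁ < 1 ∧ y₂ ≤ 0 then (y₁, min (-y₂) (y₁ ^ 2 / 4))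
  else if 1 ≤ y₁ ∧ 0 < y₂ ∧ y₂ < 1 / 2 then (max (2 - y₁) ((1 + √(2 * y₂)) / 2), y₂)
  else if 1 ≤ y₁ ∧ 1 / 2 ≤ y₂ then
    (max (2 - y₁) ((1 + √(2 * max (1 - y₂) (1 / 4))) / 2), max (1 - y₂) (1 / 4))
  else if 1 ≤ y₁ ∧ y₂ ≤ 0 then
    (max (2 - y₁) ((1 + √(2 * min (-y₂) (1 / 4))) / 2), min (-y₂) (1 / 4))
  else (y₁, y₂)

/-- First adjusted statistic. -/
noncomputable def adjMeanSquare {Ω : Type*} [MeasurableSpace Ω] (P : Measure Ω)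
    (X : ℝ → Ω → ℝ) (ψ : ℝ → ℝ) (ψhat : ℝ → ℂ) (a : ℕ → ℝ) (b : ℕ → ℤ → ℝ) (m : ℕ → ℕ)
    (j : ℕ) (ω : Ω) : ℝ :=
  c₂ ψhat * (adjust (meanSquare P X ψ a b m j ω / c₂ ψhat)
    (incrMeanSquare P X ψ a b m j ω / c₃ ψhat)).1

/-- Second adjusted statistic. -/
noncomputable def adjIncrMeanSquare {Ω : Type*} [MeasurableSpace Ω] (P : Measure Ω)
    (X : ℝ → Ω → ℝ) (ψ : ℝ → ℝ) (ψhat : ℝ → ℂ) (a : ℕ → ℝ) (b : ℕ → ℤ → ℝ) (m : ℕ → ℕ)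
    (j : ℕ) (ω : Ω) : ℝ :=
  c₃ ψhat * (adjust (meanSquare P X ψ a b m j ω / c₂ ψhat)
    (incrMeanSquare P X ψ a b m j ω / c₃ ψhat)).2

/-- `(s, α)`, with `s, α > 0`, solves the estimating system built from the adjusted statistics
`d` and `Δ`. -/
def SolvesSystem (ψhat : ℝ → ℂ) (d Δ s α : ℝ) : Prop :=
  0 < s ∧ 0 < α ∧ α * s ^ (-4 * α - 2) = Δ / c₃ ψhat ∧ s ^ (-4 * α) = d / c₂ ψhat

/-- The principal branch of the Lambert function: for `x ≥ -1/e`, the unique `w ≥ -1` with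
`w e^w = x`. -/
noncomputable def lambertW (x : ℝ) : ℝ :=
  Function.invFunOn (fun w : ℝ => w * Real.exp w) (Ici (-1)) x

end SeasonalLongMemory

/-!
For part (i), put `q = α / s²` and `L = log (s²)`. The system says `log (c₂ / d) = 4 α log s` and
`(c₂ / c₃) (Δ / d) = q`, so `L e^L = log (c₂ / d) / (2 q)`. The adjustment keeps the first normalised
statistic at most `1` (`adjust_fst_le_one`), whence `s ≥ 1` and `L ≥ 0`, and `L` is the value of the
principal branch (`solution_eq_lambertW`).

For part (ii), the main point is the law of the filter transforms at a scale `a > 2 A`. The integrals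
of `X` over bounded intervals belong to the Gaussian Hilbert space of `X`, and the spectral isometry
sends them to truncated Fourier transforms of `ψ` in `L²(f(u) du)`. The truncated transforms converge
in `L²` and are uniformly bounded away from `[-A, A]`; after rescaling by `a`, the singularities
`± s₀` of `f` lie in the latter region while `f` is bounded near the origin, so that convergence holds
in `L²(f(u) du)` (`tendsto_eLpNorm_angularFourier_filterWeight`). Hence the filter transforms exist,
are jointly Gaussian, and have covariances `∫ cos (v (b - b') / a) |ψhat v|² f (v / a) dv`
(`IsFilterTransform.inner_toLp`).

Two consequences follow. Since `f u = s₀^{-4α} + 2 α s₀^{-4α-2} u² + O(u³)` at the origin, the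
variance of the transforms is `c₂ s₀^{-4α} + c₃ α s₀^{-4α-2} a^{-2} + O(a^{-3})`
(`exists_filterVariance_expansion`): the mean square and its normalised increment estimate the two
sides of the system at the true parameters. Since `|ψhat|² f (· / a)` has variation bounded
independently of `a`, the covariances are `O(a / |b - b'|)`, and Wick's formula bounds the variance of
the mean square by a multiple of `1 / m + a² / (γ² m)` (`exists_meanSquare_variance_le`). Divided by
`r²` these variances are summable, so almost surely the noise is `o(r_j)`; multiplied by `a_j²` by the
increment, it contributes `a_j² r_j` to the rate, and the expansion contributes `a_j⁻¹`
(`tendsto_and_isBigO_of_expansion`).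

The limit of the normalised statistics is an interior point of the feasible region because `2 α < 1`
and `s₀ > 1`, so eventually the adjustment is void and the system solvable. Elimination of `α` turns
the system into an equation for `2 s² log s`, an expanding function of `s ≥ 1`, so the rate of the
statistics is passed on to the solutions (`system_solutions_isBigO`).
-/

namespace SeasonalLongMemory

/-! ### The estimating system and the Lambert function -/

theorem strictMonoOn_mul_exp : StrictMonoOn (fun w : ℝ => w * Real.exp w) (Ici (-1)) := by
  refine strictMonoOn_of_deriv_pos (convex_Ici _) (by fun_prop) fun x hx => ?_
  rw [interior_Ici, mem_Ioi] at hx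
  have h : HasDerivAt (fun w : ℝ => w * Real.exp w) (1 * Real.exp x + x * Real.exp x) x :=
    (hasDerivAt_id x).mul (Real.hasDerivAt_exp x)
  rw [h.deriv]
  nlinarith [Real.exp_pos x]

theorem lambertW_mul_exp {x : ℝ} (hx : -1 ≤ x) : lambertW (x * Real.exp x) = x :=
  strictMonoOn_mul_exp.injOn.leftInvOn_invFunOn hx

/-- Adjusted first coordinates never exceed `1`, so solutions `(s, α)` of the estimating system
have `s ≥ 1`. This is what selects the principal branch of the Lambert function. -/
theorem adjust_fst_le_one (y₁ y₂ : ℝ) : (adjust y₁ y₂).1 ≤ 1 := by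
  have key : ∀ z : ℝ, z ≤ 1 / 2 → (1 + √(2 * z)) / 2 ≤ 1 := fun z hz => by
    have : √(2 * z) ≤ 1 := Real.sqrt_le_one.2 (by linarith)
    linarith
  unfold adjust
  split_ifs with h1 h2 h3 h4 h5
  · exact h1.2.1.le
  · exact h2.2.1.le
  · exact max_le (by linarith) (key _ h3.2.2.le)
  · exact max_le (by linarith) (key _ (max_le (by linarith) (by norm_num)))
  · exact max_le (by linarith) (key _ ((min_le_right _ _).trans (by norm_num)))
  · by_contra! h
    rcases le_or_gt y₂ 0 with h0 | h0
    · exact h5 ⟨h.le, h0⟩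
    · rcases lt_or_ge y₂ (1 / 2) with h6 | h6
      · exact h3 ⟨h.le, h0, h6⟩
      · exact h4 ⟨h.le, h6⟩

theorem adjust_of_mem {y₁ y₂ : ℝ} (h1 : y₁ < 1) (h2 : 0 < y₂) (h3 : y₂ < y₁ ^ 2 / 2) :
    adjust y₁ y₂ = (y₁, y₂) := by
  unfold adjust
  rw [if_neg (by rintro ⟨-, -, h⟩; linarith), if_neg (by rintro ⟨-, -, h⟩; linarith),
    if_neg (by rintro ⟨h, -⟩; linarith), if_neg (by rintro ⟨h, -⟩; linarith),
    if_neg (by rintro ⟨h, -⟩; linarith)]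

theorem one_le_of_rpow_le_one {s α : ℝ} (hs : 0 < s) (hα : 0 < α) (h : s ^ (-4 * α) ≤ 1) :
    1 ≤ s := by
  by_contra! h1
  exact absurd h (Real.one_lt_rpow_of_pos_of_lt_one_of_neg hs h1 (by linarith)).not_ge

/-- Along solutions of the system, `-log y₁ = 4 α log s` and `y₂ / y₁ = α s⁻²`. -/
theorem system_log_and_ratio {s α u w : ℝ} (hs : 0 < s) (hw : α * s ^ (-4 * α - 2) = w)
    (hu : s ^ (-4 * α) = u) : Real.log u = -4 * α * Real.log s ∧ w / u = α / s ^ 2 := by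
  subst hw hu
  refine ⟨Real.log_rpow hs _, ?_⟩
  rw [Real.rpow_sub hs, Real.rpow_two]
  have := (Real.rpow_pos_of_pos hs (-4 * α)).ne'
  field_simp

/-- With `q = y₂ / y₁ = α / s²` and `L = log s² ≥ 0` one has `-log y₁ / (2 q) = L e^L`, so that `L` is
the value of the Lambert function there. -/
theorem solution_eq_lambertW {ψhat : ℝ → ℂ} {d Δ s α : ℝ} (h : SolvesSystem ψhat d Δ s α)
    (hd : d / c₂ ψhat ≤ 1) :
    s = Real.exp (1 / 2 * lambertW (Real.log (c₂ ψhat / d)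
      / (2 * (c₂ ψhat / c₃ ψhat * (Δ / d))))) ∧
    α = (c₂ ψhat / c₃ ψhat * (Δ / d)) * Real.exp (lambertW (Real.log (c₂ ψhat / d)
      / (2 * (c₂ ψhat / c₃ ψhat * (Δ / d))))) := by
  obtain ⟨hs, hα, hw, hu⟩ := h
  have h1s : 1 ≤ s := one_le_of_rpow_le_one hs hα (hu ▸ hd)
  obtain ⟨hlog, hratio⟩ := system_log_and_ratio hs hw hu
  have hq : c₂ ψhat / c₃ ψhat * (Δ / d) = α / s ^ 2 := by
    rw [← hratio, div_mul_div_comm, div_div_div_eq, mul_comm (c₂ ψhat)]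
  have hl : Real.log (c₂ ψhat / d) = 4 * α * Real.log s := by
    rw [← inv_div, Real.log_inv, hlog]; ring
  have hls : 0 ≤ Real.log s := Real.log_nonneg h1s
  have hsq : Real.exp (2 * Real.log s) = s ^ 2 := by
    rw [two_mul, Real.exp_add, Real.exp_log hs, sq]
  have harg : Real.log (c₂ ψhat / d) / (2 * (α / s ^ 2))
      = (2 * Real.log s) * Real.exp (2 * Real.log s) := by
    rw [hl, hsq]; field_simp; ring
  rw [hq, harg, lambertW_mul_exp (by linarith), hsq]
  constructor
  · rw [show 1 / 2 * (2 * Real.log s) = Real.log s by ring, Real.exp_log hs]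
  · field_simp

/-- The function `s ↦ 2 s² log s`, through which the system determines `s`, is expanding on
`[1, ∞)`. -/
theorem two_mul_abs_sub_le {s t : ℝ} (hs : 1 ≤ s) (ht : 1 ≤ t) :
    2 * |s - t| ≤ |2 * s ^ 2 * Real.log s - 2 * t ^ 2 * Real.log t| := by
  wlog hst : t ≤ s generalizing s t
  · rw [abs_sub_comm, abs_sub_comm (2 * s ^ 2 * _)]
    exact this ht hs (le_of_not_ge hst)
  have hder : ∀ x ∈ Ici (1 : ℝ), HasDerivAt (fun x : ℝ => 2 * x ^ 2 * Real.log x - 2 * x)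
      (4 * x * Real.log x + 2 * x - 2) x := fun x hx => by
    have hx0 : x ≠ 0 := (zero_lt_one.trans_le hx).ne'
    have h := ((((hasDerivAt_id x).pow 2).const_mul 2).mul (Real.hasDerivAt_log hx0)).sub
      ((hasDerivAt_id x).const_mul 2)
    refine h.congr_deriv ?_
    simp only [id, Nat.cast_ofNat, Pi.pow_apply]
    field_simp
    ring
  have hmono : MonotoneOn (fun x : ℝ => 2 * x ^ 2 * Real.log x - 2 * x) (Ici 1) := by
    refine monotoneOn_of_deriv_nonneg (convex_Ici _)
      (fun x hx => (hder x hx).continuousAt.continuousWithinAt)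
      (fun x hx => (hder x (interior_subset hx)).differentiableAt.differentiableWithinAt)
      fun x hx => ?_
    have hx1 : (1 : ℝ) ≤ x := interior_subset hx
    rw [(hder x hx1).deriv]
    nlinarith [Real.log_nonneg hx1, mul_nonneg (zero_le_one.trans hx1) (Real.log_nonneg hx1)]
  have := hmono ht hs hst
  simp only at this
  rw [abs_of_nonneg (sub_nonneg.2 hst)]
  exact le_trans (by linarith) (le_abs_self _)

/-- Eliminating `α` from the system leaves an equation for `s` alone. -/
theorem system_s_equation {s α u w : ℝ} (hs : 0 < s) (hα : 0 < α)
    (hw : α * s ^ (-4 * α - 2) = w) (hu : s ^ (-4 * α) = u) :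
    2 * s ^ 2 * Real.log s = -(u * Real.log u) / (2 * w) := by
  obtain ⟨hl, hr⟩ := system_log_and_ratio hs hw hu
  have hu0 : u ≠ 0 := hu ▸ (Real.rpow_pos_of_pos hs _).ne'
  have hw' : w = u * α / s ^ 2 := by
    rw [mul_div_assoc, ← hr]; field_simp
  rw [hl, hw']
  field_simp
  ring

/-- The system is solvable whenever `0 < y₁ < 1` and `y₂ > 0`. -/
theorem exists_system_solution {u w : ℝ} (hu : 0 < u) (hu1 : u < 1) (hw : 0 < w) :
    ∃ s α : ℝ, 0 < s ∧ 0 < α ∧ α * s ^ (-4 * α - 2) = w ∧ s ^ (-4 * α) = u := by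
  set R := -(u * Real.log u) / (2 * w) with hR
  have hR0 : 0 < R := div_pos (by nlinarith [Real.log_neg hu hu1]) (by linarith)
  -- `s` is found in `[1, exp R]` by the intermediate value theorem
  have hb : R ≤ 2 * (Real.exp R) ^ 2 * Real.log (Real.exp R) := by
    rw [Real.log_exp]
    have : 1 ≤ Real.exp R := Real.one_le_exp hR0.le
    nlinarith [mul_le_mul this this zero_le_one (by linarith)]
  have hcont : ContinuousOn (fun x : ℝ => 2 * x ^ 2 * Real.log x) (Icc 1 (Real.exp R)) := by
    refine ContinuousOn.mul (by fun_prop) (Real.continuousOn_log.mono fun x hx => ?_)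
    exact (zero_lt_one.trans_le hx.1).ne'
  obtain ⟨s, hs, hsR⟩ := intermediate_value_Icc (Real.one_le_exp hR0.le) hcont
    (show R ∈ _ from ⟨by simpa using hR0.le, hb⟩)
  have hs0 : 0 < s := zero_lt_one.trans_le hs.1
  simp only at hsR
  have hpow : s ^ (-4 * (w / u * s ^ 2)) = u := by
    rw [Real.rpow_def_of_pos hs0,
      show Real.log s * (-4 * (w / u * s ^ 2)) = -(2 * w / u) * (2 * s ^ 2 * Real.log s) by ring,
      hsR, hR, show -(2 * w / u) * (-(u * Real.log u) / (2 * w)) = Real.log u by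
        field_simp, Real.exp_log hu]
  refine ⟨s, w / u * s ^ 2, hs0, by positivity, ?_, hpow⟩
  rw [Real.rpow_sub hs0, hpow, Real.rpow_two]
  field_simp

/-- Stability of the system: if the right hand sides converge to those of `(s₀, α)` at rate `ρ`,
so do the solutions. -/
theorem system_solutions_isBigO {s₀ α U V : ℝ} (hs₀ : 1 < s₀) (hα : 0 < α)
    (hV : α * s₀ ^ (-4 * α - 2) = V) (hU : s₀ ^ (-4 * α) = U) {u w s β : ℕ → ℝ}
    (hu : Tendsto u atTop (𝓝 U)) (hw : Tendsto w atTop (𝓝 V))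
    (hsol : ∀ᶠ j in atTop, 0 < s j ∧ 0 < β j ∧ β j * s j ^ (-4 * β j - 2) = w j ∧
      s j ^ (-4 * β j) = u j) :
    Tendsto s atTop (𝓝 s₀) ∧ Tendsto β atTop (𝓝 α) ∧
    ∀ ρ : ℕ → ℝ, (fun j => u j - U) =O[atTop] ρ → (fun j => w j - V) =O[atTop] ρ →
      (fun j => s j - s₀) =O[atTop] ρ ∧ (fun j => β j - α) =O[atTop] ρ := by
  have hs0 : 0 < s₀ := zero_lt_one.trans hs₀
  have hU0 : 0 < U := hU ▸ Real.rpow_pos_of_pos hs0 _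
  have hU1 : U < 1 := hU ▸ Real.rpow_lt_one_of_one_lt_of_neg hs₀ (by linarith)
  have hV0 : 0 < V := hV ▸ mul_pos hα (Real.rpow_pos_of_pos hs0 _)
  -- the right hand side of the equation for `s`
  let R : ℝ × ℝ → ℝ := fun p => -(p.1 * Real.log p.1) / (2 * p.2)
  have hRd : DifferentiableAt ℝ R (U, V) := by
    have h1 : U ≠ 0 := hU0.ne'
    have h2 : 2 * V ≠ 0 := by positivity
    simp only [R, div_eq_mul_inv]
    fun_prop (disch := assumption)
  have hp : Tendsto (fun j => (u j, w j)) atTop (𝓝 (U, V)) := hu.prodMk_nhds hw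
  have hest : ∀ᶠ j in atTop, ‖s j - s₀‖ ≤ 1 / 2 * ‖R (u j, w j) - R (U, V)‖ := by
    filter_upwards [hsol, hu.eventually (gt_mem_nhds hU1)] with j ⟨h1, h2, h3, h4⟩ h5
    have h6 : 1 ≤ s j := one_le_of_rpow_le_one h1 h2 (h4 ▸ h5.le)
    have := two_mul_abs_sub_le h6 hs₀.le
    rw [system_s_equation h1 h2 h3 h4, system_s_equation hs0 hα hV hU] at this
    simp only [Real.norm_eq_abs, R]
    linarith
  have hRs : (fun j => s j - s₀) =O[atTop] fun j => R (u j, w j) - R (U, V) :=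
    Asymptotics.IsBigO.of_bound _ hest
  have hst : Tendsto s atTop (𝓝 s₀) := by
    rw [← tendsto_sub_nhds_zero_iff]
    exact hRs.trans_tendsto (tendsto_sub_nhds_zero_iff.2 (hRd.continuousAt.tendsto.comp hp))
  -- the expression of `α` through the right hand sides and `s`
  let Q : ℝ × ℝ × ℝ → ℝ := fun p => p.2.1 / p.1 * p.2.2 ^ 2
  have hQd : DifferentiableAt ℝ Q (U, V, s₀) := by
    have h1 : U ≠ 0 := hU0.ne'
    simp only [Q, div_eq_mul_inv]
    fun_prop (disch := assumption)
  have hβ : ∀ᶠ j in atTop, β j = Q (u j, w j, s j) := by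
    filter_upwards [hsol] with j ⟨h1, h2, h3, h4⟩
    have := (system_log_and_ratio h1 h3 h4).2
    simp only [Q, this]
    field_simp
  have hα' : α = Q (U, V, s₀) := by
    have := (system_log_and_ratio hs0 hV hU).2
    simp only [Q, this]
    field_simp
  have hp3 : Tendsto (fun j => (u j, w j, s j)) atTop (𝓝 (U, V, s₀)) :=
    hu.prodMk_nhds (hw.prodMk_nhds hst)
  refine ⟨hst, ?_, fun ρ hρu hρw => ?_⟩
  · rw [hα']
    exact (hQd.continuousAt.tendsto.comp hp3).congr' (hβ.mono fun j hj => hj.symm)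
  · have hs : (fun j => s j - s₀) =O[atTop] ρ :=
      (hRs.trans (hRd.isBigO_sub.comp_tendsto hp)).trans (hρu.prod_left hρw)
    refine ⟨hs, ?_⟩
    refine Asymptotics.IsBigO.congr' ((hQd.isBigO_sub.comp_tendsto hp3).trans
      (hρu.prod_left (hρw.prod_left hs))) (hβ.mono fun j hj => ?_) EventuallyEq.rfl
    simp only [Function.comp, hj, ← hα']

/-! ### Parseval's identity for integrable square-integrable functions -/

open scoped FourierTransform in
/-- The extension of the Fourier transform to `L²` agrees with the Fourier integral on `L¹ ∩ L²`,
since both have the same integrals against test functions. -/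
theorem fourier_toLp_ae_eq {φ : ℝ → ℂ} (h1 : Integrable φ) (h2 : MemLp φ 2) :
    ⇑(𝓕 (h2.toLp φ) : Lp ℂ 2 (volume : Measure ℝ)) =ᵐ[volume] 𝓕 φ := by
  have hcont : Continuous (𝓕 φ) :=
    VectorFourier.fourierIntegral_continuous Real.continuous_fourierChar
      continuous_inner h1
  refine ae_eq_of_integral_contDiff_smul_eq
    ((Lp.memLp _).locallyIntegrable (by norm_num)) hcont.locallyIntegrable fun g hg hgc => ?_
  have hg₁ : HasCompactSupport (Complex.ofRealCLM ∘ g) := hgc.comp_left rfl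
  have hg₂ : ContDiff ℝ ((⊤ : ℕ∞) : WithTop ℕ∞) (Complex.ofRealCLM ∘ g) := by fun_prop
  let G := hg₁.toSchwartzMap hg₂
  have e1 := congrArg (fun T => T G) (Lp.fourier_toTemperedDistribution_eq (h2.toLp φ))
  simp only [TemperedDistribution.fourier_apply, Lp.toTemperedDistribution_apply] at e1
  have e2 : ∫ x, (𝓕 G) x • (h2.toLp φ) x = ∫ x, (𝓕 (G : ℝ → ℂ)) x • φ x := by
    refine integral_congr_ae ?_
    filter_upwards [h2.coeFn_toLp] with x hx
    rw [hx, SchwartzMap.fourier_coe]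
  have e3 : ∫ x, (𝓕 (G : ℝ → ℂ)) x • φ x = ∫ x, G x • 𝓕 φ x := by
    simpa using! VectorFourier.integral_fourierIntegral_smul_eq_flip (μ := volume) (ν := volume)
      (L := innerₗ ℝ) Real.continuous_fourierChar continuous_inner G.integrable h1
  rw [e2, e3] at e1
  simpa [G] using e1.symm

/-- Fourier transform `u ↦ ∫ exp(-i u t) φ(t) dt` in the angular frequency normalisation. -/
noncomputable def angularFourier (φ : ℝ → ℂ) (u : ℝ) : ℂ :=
  ∫ t : ℝ, Complex.exp (-(Complex.I * u * t)) * φ t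

open scoped FourierTransform in
theorem angularFourier_eq (φ : ℝ → ℂ) (u : ℝ) :
    angularFourier φ u = 𝓕 φ (u / (2 * Real.pi)) := by
  rw [Real.fourier_real_eq_integral_exp_smul, angularFourier]
  refine integral_congr_ae (ae_of_all _ fun t => ?_)
  simp only [smul_eq_mul]
  congr 2
  push_cast
  have : (Real.pi : ℂ) ≠ 0 := by exact_mod_cast Real.pi_ne_zero
  field_simp

open scoped FourierTransform in
theorem continuous_angularFourier {φ : ℝ → ℂ} (h1 : Integrable φ) :
    Continuous (angularFourier φ) := by
  have hcont : Continuous (𝓕 φ) :=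
    VectorFourier.fourierIntegral_continuous Real.continuous_fourierChar
      continuous_inner h1
  simp only [funext (angularFourier_eq φ)]
  fun_prop

open scoped FourierTransform in
theorem memLp_angularFourier {φ : ℝ → ℂ} (h1 : Integrable φ) (h2 : MemLp φ 2) :
    MemLp (angularFourier φ) 2 := by
  have h := (memLp_congr_ae (fourier_toLp_ae_eq h1 h2)).1 (Lp.memLp _)
  rw [memLp_two_iff_integrable_sq_norm (continuous_angularFourier h1).aestronglyMeasurable]
  rw [memLp_two_iff_integrable_sq_norm h.1] at h
  simpa only [angularFourier_eq] using h.comp_div (by positivity : 2 * Real.pi ≠ 0)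

open scoped FourierTransform ComplexConjugate in
/-- Parseval's identity on `L¹ ∩ L²`. -/
theorem integral_conj_angularFourier_mul {φ χ : ℝ → ℂ} (h1 : Integrable φ) (h2 : MemLp φ 2)
    (h1' : Integrable χ) (h2' : MemLp χ 2) :
    ∫ u, conj (angularFourier φ u) * angularFourier χ u
      = 2 * Real.pi * ∫ t, conj (φ t) * χ t := by
  have h := Lp.inner_fourier_eq (h2.toLp φ) (h2'.toLp χ)
  rw [L2.inner_def, L2.inner_def] at h
  have e1 : ∫ x, inner ℂ ((𝓕 (h2.toLp φ) : Lp ℂ 2 (volume : Measure ℝ)) x)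
      ((𝓕 (h2'.toLp χ) : Lp ℂ 2 (volume : Measure ℝ)) x) = ∫ x, conj (𝓕 φ x) * 𝓕 χ x := by
    refine integral_congr_ae ?_
    filter_upwards [fourier_toLp_ae_eq h1 h2, fourier_toLp_ae_eq h1' h2'] with x hx hx'
    rw [hx, hx', RCLike.inner_apply, mul_comm]
  have e2 : ∫ x, inner ℂ ((h2.toLp φ) x) ((h2'.toLp χ) x) = ∫ x, conj (φ x) * χ x := by
    refine integral_congr_ae ?_
    filter_upwards [h2.coeFn_toLp, h2'.coeFn_toLp] with x hx hx'
    rw [hx, hx', RCLike.inner_apply, mul_comm]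
  rw [e1, e2] at h
  simp only [angularFourier_eq]
  rw [Measure.integral_comp_div (fun x => conj (𝓕 φ x) * 𝓕 χ x) (2 * Real.pi), h,
    abs_of_pos (by positivity)]
  simp

/-- Plancherel's identity on `L¹ ∩ L²`. -/
theorem integral_norm_sq_angularFourier {φ : ℝ → ℂ} (h1 : Integrable φ) (h2 : MemLp φ 2) :
    ∫ u, ‖angularFourier φ u‖ ^ 2 = 2 * Real.pi * ∫ t, ‖φ t‖ ^ 2 := by
  have h := integral_conj_angularFourier_mul h1 h2 h1 h2
  simp only [Complex.conj_mul'] at h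
  have e : ∀ F : ℝ → ℂ, ∫ x, (‖F x‖ : ℂ) ^ 2 = ((∫ x, ‖F x‖ ^ 2 : ℝ) : ℂ) := fun F => by
    rw [← integral_complex_ofReal]; simp
  rw [e, e] at h
  exact_mod_cast h

theorem eLpNorm_angularFourier {φ : ℝ → ℂ} (h1 : Integrable φ) (h2 : MemLp φ 2) :
    eLpNorm (angularFourier φ) 2 volume
      = ENNReal.ofReal √(2 * Real.pi) * eLpNorm φ 2 volume := by
  rw [(memLp_angularFourier h1 h2).eLpNorm_eq_integral_rpow_norm two_ne_zero ENNReal.ofNat_ne_top,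
    h2.eLpNorm_eq_integral_rpow_norm two_ne_zero ENNReal.ofNat_ne_top,
    ← ENNReal.ofReal_mul (Real.sqrt_nonneg _)]
  simp only [ENNReal.toReal_ofNat, Real.rpow_two]
  rw [integral_norm_sq_angularFourier h1 h2, Real.mul_rpow (by positivity)
    (integral_nonneg fun t => by positivity), Real.sqrt_eq_rpow]
  norm_num

/-! ### Truncated Fourier transforms -/

/-- The integral `∫ exp(-i v t) ψ(t) dt` over `[-S, T]`. -/
noncomputable def truncFourier (ψ : ℝ → ℝ) (S T v : ℝ) : ℂ :=
  ∫ t in (-S)..T, Complex.exp (-(Complex.I * v * t)) * (ψ t : ℂ)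

/-- The restriction of `ψ` to `(-S, T]`, as a complex function. -/
noncomputable def truncation (ψ : ℝ → ℝ) (S T : ℝ) : ℝ → ℂ :=
  (Ioc (-S) T).indicator fun t => (ψ t : ℂ)

section
variable {ψ : ℝ → ℝ}

theorem memLp_truncation (hψ : MemLp ψ 2) (S T : ℝ) : MemLp (truncation ψ S T) 2 :=
  hψ.ofReal.indicator measurableSet_Ioc

theorem integrableOn_Ioc_of_memLp_two (hψ : MemLp ψ 2) (S T : ℝ) : IntegrableOn ψ (Ioc S T) :=
  (hψ.restrict _).integrable one_le_two

theorem integrable_truncation (hψ : MemLp ψ 2) (S T : ℝ) : Integrable (truncation ψ S T) :=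
  (integrable_indicator_iff measurableSet_Ioc).2 (integrableOn_Ioc_of_memLp_two hψ _ _).ofReal

theorem truncFourier_eq {S T : ℝ} (h : -S ≤ T) :
    truncFourier ψ S T = angularFourier (truncation ψ S T) := by
  ext v
  rw [truncFourier, angularFourier, intervalIntegral.integral_of_le h,
    ← integral_indicator measurableSet_Ioc]
  refine integral_congr_ae (ae_of_all _ fun t => ?_)
  by_cases ht : t ∈ Ioc (-S) T <;> simp [truncation, ht]

theorem angularFourier_sub {φ χ : ℝ → ℂ} (h : Integrable φ) (h' : Integrable χ) :
    angularFourier (φ - χ) = angularFourier φ - angularFourier χ := by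
  ext u
  have key : ∀ {φ : ℝ → ℂ}, Integrable φ →
      Integrable fun t : ℝ => Complex.exp (-(Complex.I * u * t)) * φ t := fun {φ} hφ => by
    refine hφ.bdd_mul (c := 1) (by fun_prop) (ae_of_all _ fun t => ?_)
    rw [show -(Complex.I * u * t) = ((-(u * t) : ℝ) : ℂ) * Complex.I by push_cast; ring,
      Complex.norm_exp_ofReal_mul_I]
  simp only [angularFourier, Pi.sub_apply, mul_sub]
  exact integral_sub (key h) (key h')

theorem tendsto_eLpNorm_tail (hψ : MemLp ψ 2) :
    Tendsto (fun R : ℝ => eLpNorm ((Ioc (-R) R)ᶜ.indicator ψ) 2 volume) atTop (𝓝 0) := by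
  have key : Tendsto (fun R : ℝ => ∫⁻ t, ‖(Ioc (-R) R)ᶜ.indicator ψ t‖ₑ ^ 2) atTop
      (𝓝 (∫⁻ _ : ℝ, 0)) := by
    refine tendsto_lintegral_filter_of_dominated_convergence' (fun t => ‖ψ t‖ₑ ^ 2) ?_ ?_ ?_ ?_
    · refine Eventually.of_forall fun R => ?_
      exact ((hψ.1.indicator measurableSet_Ioc.compl).enorm).pow_const 2
    · refine Eventually.of_forall fun R => ae_of_all _ fun t => ?_
      gcongr
      exact enorm_indicator_le_enorm_self _ _
    · have := hψ.eLpNorm_lt_top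
      rw [eLpNorm_lt_top_iff_lintegral_rpow_enorm_lt_top two_ne_zero ENNReal.ofNat_ne_top] at this
      simpa using this.ne
    · refine ae_of_all _ fun t => tendsto_const_nhds.congr' ?_
      filter_upwards [eventually_gt_atTop |t|] with R hR
      rw [indicator_of_notMem]
      · simp
      · rw [notMem_compl_iff]
        exact ⟨(abs_lt.1 hR).1, (abs_lt.1 hR).2.le⟩
  rw [lintegral_zero] at key
  have := (ENNReal.continuous_rpow_const (y := (1 / 2 : ℝ))).tendsto 0 |>.comp key
  rw [ENNReal.zero_rpow_of_pos (by norm_num)] at this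
  refine this.congr fun R => ?_
  rw [eLpNorm_eq_lintegral_rpow_enorm_toReal two_ne_zero ENNReal.ofNat_ne_top]
  simp

/-- The truncated transforms over `[-S, T]` converge in `L²` when `S, T → ∞` independently,
although the `L²` Fourier transform is defined through symmetric truncations. -/
theorem tendsto_truncFourier {ψhat : ℝ → ℂ} (hψ : MemLp ψ 2) (hF : IsFourierTransformL2 ψ ψhat) :
    Tendsto (fun p : ℝ × ℝ => eLpNorm (truncFourier ψ p.1 p.2 - ψhat) 2 volume) atTop (𝓝 0) := by
  have hmin : Tendsto (fun p : ℝ × ℝ => min p.1 p.2) atTop atTop := by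
    rw [← prod_atTop_atTop_eq]
    refine tendsto_atTop.2 fun b => ?_
    filter_upwards [tendsto_fst.eventually_ge_atTop b, tendsto_snd.eventually_ge_atTop b] with p h h'
    exact le_min h h'
  -- compare with the symmetric truncation at `min S T`; by Plancherel the difference is a tail of `ψ`
  have hlim := ((ENNReal.Tendsto.const_mul (a := ENNReal.ofReal √(2 * Real.pi))
    (tendsto_eLpNorm_tail hψ) (Or.inr ENNReal.ofReal_ne_top)).add hF.2).comp hmin
  rw [mul_zero, add_zero] at hlim
  refine tendsto_of_tendsto_of_tendsto_of_le_of_le' tendsto_const_nhds hlim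
    (Eventually.of_forall fun _ => zero_le) ?_
  filter_upwards [hmin.eventually_ge_atTop 0] with p hp
  set R := min p.1 p.2 with hR
  have h1 : R ≤ p.1 := min_le_left _ _
  have h2 : R ≤ p.2 := min_le_right _ _
  have hi := integrable_truncation hψ
  have hm := memLp_truncation hψ
  have e : truncFourier ψ p.1 p.2 - ψhat
      = angularFourier (truncation ψ p.1 p.2 - truncation ψ R R)
        + (truncFourier ψ R R - ψhat) := by
    rw [angularFourier_sub (hi _ _) (hi _ _), ← truncFourier_eq (by linarith),
      ← truncFourier_eq (by linarith)]
    abel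
  have hmeas : AEStronglyMeasurable (truncFourier ψ R R) volume := by
    rw [truncFourier_eq (by linarith)]
    exact (continuous_angularFourier (hi _ _)).aestronglyMeasurable
  rw [e]
  refine (eLpNorm_add_le (continuous_angularFourier ((hi _ _).sub (hi _ _))).aestronglyMeasurable
    (hmeas.sub hF.1.1) one_le_two).trans (add_le_add ?_ le_rfl)
  rw [eLpNorm_angularFourier ((hi _ _).sub (hi _ _)) ((hm _ _).sub (hm _ _))]
  refine mul_le_mul_right (eLpNorm_mono fun t => ?_) _
  by_cases ht : t ∈ Ioc (-R) R
  · have ht' : t ∈ Ioc (-p.1) p.2 := ⟨by linarith [ht.1], by linarith [ht.2]⟩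
    simp [truncation, ht, ht']
  · have ht2 : t ∈ (Ioc (-R) R)ᶜ := ht
    simp only [← hR, indicator_of_mem ht2]
    by_cases ht' : t ∈ Ioc (-p.1) p.2 <;> simp [truncation, ht, ht']

open scoped ComplexConjugate in
/-- Truncated transforms are recovered from the `L²` Fourier transform by integrating it against
the transform of a modulated indicator function (a Dirichlet kernel). -/
theorem truncFourier_eq_integral {ψhat : ℝ → ℂ} (hψ : MemLp ψ 2)
    (hF : IsFourierTransformL2 ψ ψhat) {S T : ℝ} (hS : 0 ≤ S) (hT : 0 ≤ T) (v : ℝ) :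
    2 * Real.pi * truncFourier ψ S T v = ∫ u, conj (angularFourier ((Ioc (-S) T).indicator
      fun t => Complex.exp (Complex.I * v * t)) u) * ψhat u := by
  set g : ℝ → ℂ := (Ioc (-S) T).indicator fun t => Complex.exp (Complex.I * v * t) with hg
  have hcont : Continuous fun t : ℝ => Complex.exp (Complex.I * v * t) := by fun_prop
  have hg1 : Integrable g := (integrable_indicator_iff measurableSet_Ioc).2
    ((hcont.integrableOn_Icc (a := -S) (b := T)).mono_set Ioc_subset_Icc_self)
  have hg2 : MemLp g 2 := by
    rw [memLp_indicator_iff_restrict measurableSet_Ioc]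
    refine MemLp.of_bound hcont.aestronglyMeasurable 1 (ae_of_all _ fun t => ?_)
    rw [show Complex.I * v * t = ((v * t : ℝ) : ℂ) * Complex.I by push_cast; ring,
      Complex.norm_exp_ofReal_mul_I]
  have hm := memLp_truncation hψ
  have hi := integrable_truncation hψ
  have hgm := memLp_angularFourier hg1 hg2
  have hmem : ∀ R : ℝ, 0 ≤ R → MemLp (truncFourier ψ R R) 2 := fun R hR => by
    rw [truncFourier_eq (by linarith)]
    exact memLp_angularFourier (hi _ _) (hm _ _)
  -- The identity holds with `ψhat` replaced by a symmetric truncated transform, by Parseval.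
  have key : ∀ R : ℝ, max S T ≤ R → 2 * Real.pi * truncFourier ψ S T v
      = ∫ u, conj (angularFourier g u) * truncFourier ψ R R u := fun R hR => by
    have hSR := (le_max_left _ _).trans hR
    have hTR := (le_max_right _ _).trans hR
    rw [truncFourier_eq (by linarith : -R ≤ R),
      integral_conj_angularFourier_mul hg1 hg2 (hi _ _) (hm _ _), truncFourier,
      intervalIntegral.integral_of_le (by linarith), ← integral_indicator measurableSet_Ioc]
    congr 1
    refine integral_congr_ae (ae_of_all _ fun t => ?_)
    by_cases ht : t ∈ Ioc (-S) T
    · have ht' : t ∈ Ioc (-R) R := ⟨by linarith [ht.1], by linarith [ht.2]⟩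
      simp only [hg, truncation, ht, ht', indicator_of_mem, ← Complex.exp_conj]
      simp
    · simp [hg, truncation, ht]
  have hlim : Tendsto (fun R : ℝ => ∫ u, conj (angularFourier g u) * truncFourier ψ R R u) atTop
      (𝓝 (∫ u, conj (angularFourier g u) * ψhat u)) := by
    rw [tendsto_iff_norm_sub_tendsto_zero]
    have hb : Tendsto (fun R : ℝ => (eLpNorm (angularFourier g) 2 volume
        * eLpNorm (truncFourier ψ R R - ψhat) 2 volume).toReal) atTop (𝓝 0) := by
      rw [← ENNReal.toReal_zero]
      refine (ENNReal.tendsto_toReal ENNReal.zero_ne_top).comp ?_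
      rw [← mul_zero (eLpNorm (angularFourier g) 2 volume)]
      exact ENNReal.Tendsto.const_mul hF.2 (Or.inr hgm.eLpNorm_ne_top)
    refine squeeze_zero' (Eventually.of_forall fun _ => norm_nonneg _) ?_ hb
    filter_upwards [eventually_ge_atTop 0] with R hR
    have hgc : MemLp (fun u => conj (angularFourier g u)) 2 := hgm.star
    have hd : MemLp (truncFourier ψ R R - ψhat) 2 := (hmem R hR).sub hF.1
    have hsub : (∫ u, conj (angularFourier g u) * truncFourier ψ R R u)
        - ∫ u, conj (angularFourier g u) * ψhat u
        = ∫ u, conj (angularFourier g u) * (truncFourier ψ R R u - ψhat u) := by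
      simp only [mul_sub]
      exact (integral_sub (hgc.integrable_mul (hmem R hR)) (hgc.integrable_mul hF.1)).symm
    rw [hsub]
    refine (norm_integral_le_lintegral_norm _).trans (ENNReal.toReal_mono
      (ENNReal.mul_ne_top hgm.eLpNorm_ne_top hd.eLpNorm_ne_top) ?_)
    have hold := eLpNorm_smul_le_mul_eLpNorm (p := 2) (q := 2) (r := 1) hd.1 hgc.1
    rw [eLpNorm_one_eq_lintegral_enorm] at hold
    refine le_trans (le_of_eq ?_) (hold.trans (le_of_eq ?_))
    · refine lintegral_congr fun u => ?_
      rw [ofReal_norm]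
      rfl
    · congr 1
      exact eLpNorm_congr_norm_ae (ae_of_all _ fun u => by simp)
  exact tendsto_nhds_unique (tendsto_const_nhds.congr' ((eventually_ge_atTop (max S T)).mono key))
    hlim

theorem norm_integral_exp_le {S T x : ℝ} (hx : x ≠ 0) :
    ‖∫ t in (-S)..T, Complex.exp (Complex.I * x * t)‖ ≤ 2 / |x| := by
  have hx' : Complex.I * x ≠ 0 := mul_ne_zero Complex.I_ne_zero (by exact_mod_cast hx)
  have hn : ∀ t : ℝ, ‖Complex.exp (Complex.I * x * t)‖ = 1 := fun t => by
    rw [show Complex.I * x * t = ((x * t : ℝ) : ℂ) * Complex.I by push_cast; ring,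
      Complex.norm_exp_ofReal_mul_I]
  rw [integral_exp_mul_complex hx', norm_div, norm_mul, Complex.norm_I, one_mul,
    Complex.norm_real, Real.norm_eq_abs]
  gcongr
  refine (norm_sub_le _ _).trans ?_
  rw [hn, hn]
  norm_num

/-- Away from the support of the `L²` Fourier transform, all truncated transforms are bounded by
the same constant, as the Dirichlet kernel at distance `x` from its centre is at most `2 / |x|`. -/
theorem exists_norm_truncFourier_le {ψhat : ℝ → ℂ} {A B : ℝ} (hψ : IsBandLimitedFilter ψ ψhat A)
    (hAB : A < B) : ∃ C : ℝ, ∀ S T : ℝ, 0 ≤ S → 0 ≤ T → ∀ v : ℝ, B ≤ |v| →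
      ‖truncFourier ψ S T v‖ ≤ C := by
  have hint : Integrable ψhat := by
    have := (hψ.fourier.1.restrict (Icc (-A) A)).integrable one_le_two
    exact (integrableOn_iff_integrable_of_support_subset hψ.support_subset).1 this
  refine ⟨(2 * Real.pi)⁻¹ * ∫ u, 2 / (B - A) * ‖ψhat u‖, fun S T hS hT v hv => ?_⟩
  have h := congrArg norm (truncFourier_eq_integral hψ.memLp hψ.fourier hS hT v)
  rw [norm_mul, show ‖(2 * Real.pi : ℂ)‖ = 2 * Real.pi by
    rw [norm_mul, Complex.norm_real, Real.norm_of_nonneg Real.pi_pos.le]; norm_num] at h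
  rw [eq_div_of_mul_eq (by positivity) ((mul_comm _ _).trans h), div_eq_inv_mul]
  gcongr
  refine norm_integral_le_of_norm_le (hint.norm.const_mul _) (ae_of_all _ fun u => ?_)
  rw [norm_mul, RCLike.norm_conj]
  by_cases hu : ψhat u = 0
  · simp [hu]
  have huA : |u| ≤ A := abs_le.2 (hψ.support_subset hu)
  have hd : B - A ≤ |v - u| := by linarith [abs_sub_abs_le_abs_sub v u]
  gcongr
  have e : angularFourier ((Ioc (-S) T).indicator fun t : ℝ => Complex.exp (Complex.I * v * t)) u
      = ∫ t in (-S)..T, Complex.exp (Complex.I * (v - u : ℝ) * t) := by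
    rw [angularFourier, intervalIntegral.integral_of_le (by linarith),
      ← integral_indicator measurableSet_Ioc]
    refine integral_congr_ae (ae_of_all _ fun t => ?_)
    by_cases ht : t ∈ Ioc (-S) T
    · simp only [ht, indicator_of_mem, ← Complex.exp_add]
      congr 1
      push_cast
      ring
    · simp [ht]
  have hne : v - u ≠ 0 := by
    intro h0
    rw [h0, abs_zero] at hd
    linarith
  rw [e]
  refine (norm_integral_exp_le hne).trans ?_
  have : 0 < B - A := by linarith
  gcongr

/-- The `L²` Fourier transform is injective: if it vanishes then so do all truncated transforms, hence
by Plancherel all truncations. -/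
theorem fourierTransformL2_ne_zero {ψhat : ℝ → ℂ} (hψ : MemLp ψ 2)
    (hF : IsFourierTransformL2 ψ ψhat) (hne : ¬ ψ =ᵐ[volume] 0) : ¬ ψhat =ᵐ[volume] 0 := by
  intro h0
  refine hne ?_
  have hz : ∀ n : ℕ, truncation ψ n n =ᵐ[volume] 0 := fun n => by
    have hn : (0 : ℝ) ≤ n := n.cast_nonneg
    have h1 : angularFourier (truncation ψ n n) = 0 := by
      rw [← truncFourier_eq (by linarith)]
      ext v
      have h := truncFourier_eq_integral hψ hF hn hn v
      rw [integral_congr_ae (g := fun _ => (0 : ℂ))] at h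
      · simpa using h
      · filter_upwards [h0] with u hu
        simp [hu]
    have h2 := integral_norm_sq_angularFourier (integrable_truncation hψ n n)
      (memLp_truncation hψ n n)
    simp only [h1, Pi.zero_apply, norm_zero, ne_eq, OfNat.ofNat_ne_zero, not_false_eq_true,
      zero_pow, integral_zero] at h2
    have h3 : ∫ t, ‖truncation ψ n n t‖ ^ 2 = 0 := by
      have : 2 * Real.pi ≠ 0 := by positivity
      exact (mul_eq_zero.1 h2.symm).resolve_left this
    rw [integral_eq_zero_iff_of_nonneg (fun t => by positivity)
      ((memLp_two_iff_integrable_sq_norm (memLp_truncation hψ n n).1).1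
        (memLp_truncation hψ n n))] at h3
    filter_upwards [h3] with t ht
    simpa using ht
  filter_upwards [ae_all_iff.2 hz] with t ht
  obtain ⟨n, hn⟩ := exists_nat_gt |t|
  have := ht n
  have hmem : t ∈ Ioc (-(n : ℝ)) n := ⟨(abs_lt.1 hn).1, (abs_lt.1 hn).2.le⟩
  rw [truncation, indicator_of_mem hmem] at this
  simpa using this

end

/-! ### Convergence in weighted `L²` spaces -/

theorem tendsto_lintegral_ofReal_sub {w : ℝ → ℝ} (hw : Integrable w) :
    Tendsto (fun N : ℝ => ∫⁻ v, ENNReal.ofReal (w v - N)) atTop (𝓝 0) := by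
  rw [show (0 : ℝ≥0∞) = ∫⁻ _ : ℝ, 0 by simp]
  refine tendsto_lintegral_filter_of_dominated_convergence' (fun v => ENNReal.ofReal (w v)) ?_ ?_
    ?_ ?_
  · exact Eventually.of_forall fun N => (hw.1.aemeasurable.sub_const N).ennreal_ofReal
  · filter_upwards [eventually_ge_atTop 0] with N hN
    exact ae_of_all _ fun v => ENNReal.ofReal_le_ofReal (by linarith)
  · exact hw.lintegral_lt_top.ne
  · refine ae_of_all _ fun v => tendsto_const_nhds.congr' ?_
    filter_upwards [eventually_ge_atTop (w v)] with N hN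
    exact (ENNReal.ofReal_of_nonpos (by linarith)).symm

/-- If `G p → 0` in `L²` and the `G p` are uniformly bounded where the integrable weight `w` is
large, then `G p → 0` in the weighted space `L²(w)`. -/
theorem tendsto_lintegral_sq_mul_weight {ι : Type*} {l : Filter ι} {G : ι → ℝ → ℂ} {w : ℝ → ℝ}
    {M C : ℝ} (hw : Integrable w) (hG : Tendsto (fun p => ∫⁻ v, ‖G p v‖ₑ ^ 2) l (𝓝 0))
    (hGm : ∀ᶠ p in l, AEStronglyMeasurable (G p) volume)
    (hb : ∀ᶠ p in l, ∀ v, M < w v → ‖G p v‖ ≤ C) :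
    Tendsto (fun p => ∫⁻ v, ‖G p v‖ₑ ^ 2 * ENNReal.ofReal (w v)) l (𝓝 0) := by
  rw [ENNReal.tendsto_nhds_zero]
  intro ε hε
  have hε2 : (0 : ℝ≥0∞) < ε / 2 := ENNReal.half_pos hε.ne'
  have h1 := ENNReal.Tendsto.const_mul (a := ENNReal.ofReal (C ^ 2))
    (tendsto_lintegral_ofReal_sub hw) (Or.inr ENNReal.ofReal_ne_top)
  rw [mul_zero, ENNReal.tendsto_nhds_zero] at h1
  obtain ⟨N, hN1, hNM⟩ := ((h1 _ hε2).and (eventually_ge_atTop (max M 0))).exists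
  have h2 := ENNReal.Tendsto.const_mul (a := ENNReal.ofReal N) hG (Or.inr ENNReal.ofReal_ne_top)
  rw [mul_zero, ENNReal.tendsto_nhds_zero] at h2
  filter_upwards [h2 _ hε2, hb, hGm] with p hp hbp hGp
  -- `w ≤ N + (w - N)⁺`, where the first part is a bounded weight and the second one has small mass
  calc ∫⁻ v, ‖G p v‖ₑ ^ 2 * ENNReal.ofReal (w v)
      ≤ ∫⁻ v, (ENNReal.ofReal N * ‖G p v‖ₑ ^ 2
          + ENNReal.ofReal (C ^ 2) * ENNReal.ofReal (w v - N)) := by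
        refine lintegral_mono fun v => ?_
        rcases le_or_gt (w v) N with h | h
        · rw [mul_comm]
          exact le_add_right (mul_le_mul_left (ENNReal.ofReal_le_ofReal h) _)
        · have hC := hbp v (((le_max_left _ _).trans hNM).trans_lt h)
          have hsq : ‖G p v‖ₑ ^ 2 ≤ ENNReal.ofReal (C ^ 2) := by
            rw [← ofReal_norm, ← ENNReal.ofReal_pow (norm_nonneg _)]
            exact ENNReal.ofReal_le_ofReal (pow_le_pow_left₀ (norm_nonneg _) hC 2)
          have hsplit : ENNReal.ofReal (w v) = ENNReal.ofReal N + ENNReal.ofReal (w v - N) := by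
            rw [← ENNReal.ofReal_add ((le_max_right _ _).trans hNM) (by linarith)]
            congr 1
            ring
          rw [hsplit, mul_add, mul_comm (ENNReal.ofReal N)]
          gcongr
    _ = (ENNReal.ofReal N * ∫⁻ v, ‖G p v‖ₑ ^ 2)
          + ENNReal.ofReal (C ^ 2) * ∫⁻ v, ENNReal.ofReal (w v - N) := by
        rw [lintegral_add_left' ((hGp.enorm.pow_const 2).const_mul _),
          lintegral_const_mul' _ _ ENNReal.ofReal_ne_top,
          lintegral_const_mul' _ _ ENNReal.ofReal_ne_top]
    _ ≤ ε / 2 + ε / 2 := add_le_add hp hN1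
    _ = ε := ENNReal.add_halves ε

/-! ### Decay of cosine transforms of functions of bounded variation -/

/-- A shift by `π / x` changes the sign of `cos (v x)`. -/
theorem abs_integral_cos_mul_le_shift {G : ℝ → ℝ} (hG : Integrable G) {x : ℝ} (hx : 0 < x) :
    |∫ v, Real.cos (v * x) * G v| ≤ 1 / 2 * ∫ v, |G v - G (v + Real.pi / x)| := by
  have hc : ∀ {F : ℝ → ℝ}, Integrable F → Integrable fun v => Real.cos (v * x) * F v :=
    fun hF => hF.bdd_mul (c := 1) (by fun_prop)
      (ae_of_all _ fun v => by simpa using Real.abs_cos_le_one _)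
  have hG' : Integrable fun v => G (v + Real.pi / x) := hG.comp_add_right _
  have h1 : ∫ v, Real.cos (v * x) * G v = -∫ v, Real.cos (v * x) * G (v + Real.pi / x) := by
    rw [← integral_add_right_eq_self (fun v => Real.cos (v * x) * G v) (Real.pi / x),
      ← integral_neg]
    refine integral_congr_ae (ae_of_all _ fun v => ?_)
    simp only
    rw [add_mul, div_mul_cancel₀ _ hx.ne', Real.cos_add_pi, neg_mul]
  have h2 : ∫ v, Real.cos (v * x) * G v
      = 1 / 2 * ∫ v, Real.cos (v * x) * (G v - G (v + Real.pi / x)) := by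
    simp only [mul_sub]
    rw [integral_sub (hc hG) (hc hG')]
    linarith
  rw [h2, abs_mul, abs_of_pos (by norm_num : (0 : ℝ) < 1 / 2)]
  gcongr
  rw [← Real.norm_eq_abs]
  refine norm_integral_le_of_norm_le (hG.sub hG').abs (ae_of_all _ fun v => ?_)
  rw [norm_mul]
  exact mul_le_of_le_one_left (norm_nonneg _) (Real.abs_cos_le_one _)

/-- A function vanishing outside `[-A, A]`, bounded by `M`, whose increments inside `[-A, A]` are
dominated by those of a monotone function `N` with `|N| ≤ K`, has small translation differences
in `L¹`. -/
theorem integral_abs_sub_shift_le {G N : ℝ → ℝ} {A M K h : ℝ} (hA : 0 ≤ A) (hh : 0 < h)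
    (hsupp : ∀ v, v ∉ Icc (-A) A → G v = 0) (hM : ∀ v, |G v| ≤ M) (hN : Monotone N)
    (hK : ∀ v, |N v| ≤ K)
    (hGN : ∀ v ∈ Icc (-A) A, ∀ w ∈ Icc (-A) A, v ≤ w → |G v - G w| ≤ N w - N v) :
    ∫ v, |G v - G (v + h)| ≤ h * (2 * K + 2 * M) := by
  have hM0 : 0 ≤ M := (abs_nonneg _).trans (hM 0)
  have hNi : ∀ a b, IntervalIntegrable N volume a b := fun a b => hN.intervalIntegrable
  -- `D` controls the shifts inside the interval, `I₁` and `I₂` those crossing an end point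
  set D : ℝ → ℝ := (Icc (-A - h) A).indicator fun v => N (v + h) - N v with hD
  set I₁ : ℝ → ℝ := (Icc (-A - h) (-A)).indicator fun _ => M with hI₁
  set I₂ : ℝ → ℝ := (Icc (A - h) A).indicator fun _ => M with hI₂
  have hle : ∀ v, |G v - G (v + h)| ≤ D v + I₁ v + I₂ v := fun v => by
    have d0 : 0 ≤ D v := indicator_nonneg (fun v _ => sub_nonneg.2 (hN (by linarith))) v
    have i1 : 0 ≤ I₁ v := indicator_nonneg (fun _ _ => hM0) v
    have i2 : 0 ≤ I₂ v := indicator_nonneg (fun _ _ => hM0) v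
    by_cases hv : v ∈ Icc (-A) A <;> by_cases hw : v + h ∈ Icc (-A) A
    · have := hGN v hv _ hw (by linarith)
      have e : D v = N (v + h) - N v := indicator_of_mem (show v ∈ Icc (-A - h) A from ⟨by linarith [hv.1], hv.2⟩) _
      linarith
    · have e : I₂ v = M := by
        have hm : v ∈ Icc (A - h) A := by
          refine ⟨?_, hv.2⟩
          by_contra! hc
          exact hw ⟨by linarith [hv.1], by linarith⟩
        exact indicator_of_mem hm _
      rw [hsupp _ hw, sub_zero]
      linarith [hM v]
    · have e : I₁ v = M := by
        have hm : v ∈ Icc (-A - h) (-A) := by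
          refine ⟨by linarith [hw.1], ?_⟩
          by_contra! hc
          exact hv ⟨hc.le, by linarith [hw.2]⟩
        exact indicator_of_mem hm _
      rw [hsupp _ hv, zero_sub, abs_neg]
      linarith [hM (v + h)]
    · rw [hsupp _ hv, hsupp _ hw, sub_zero, abs_zero]
      linarith
  have hNh : ∀ a b, IntervalIntegrable (fun v => N (v + h)) volume a b := fun a b =>
    Monotone.intervalIntegrable fun v w hvw => hN (by linarith)
  have hDint : IntervalIntegrable (fun v => N (v + h) - N v) volume (-A - h) A :=
    (hNh _ _).sub (hNi _ _)
  have hDi : Integrable D := (integrable_indicator_iff measurableSet_Icc).2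
    ((intervalIntegrable_iff_integrableOn_Icc_of_le (by linarith)).1 hDint)
  have hI : ∀ a b : ℝ, Integrable ((Icc a b).indicator fun _ => M) := fun a b =>
    (integrable_indicator_iff measurableSet_Icc).2 (integrableOn_const (by simp))
  have hDval : ∫ v, D v ≤ h * (2 * K) := by
    rw [integral_indicator measurableSet_Icc, integral_Icc_eq_integral_Ioc,
      ← intervalIntegral.integral_of_le (by linarith),
      intervalIntegral.integral_sub (hNh _ _) (hNi _ _),
      intervalIntegral.integral_comp_add_right N h,
      intervalIntegral.integral_interval_sub_interval_comm (hNi _ _) (hNi _ _) (hNi _ _)]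
    have b1 : ‖∫ x in (-A - h + h)..(-A - h), N x‖ ≤ K * |(-A - h) - (-A - h + h)| :=
      intervalIntegral.norm_integral_le_of_norm_le_const fun x _ => hK x
    have b2 : ‖∫ x in (A + h)..A, N x‖ ≤ K * |A - (A + h)| :=
      intervalIntegral.norm_integral_le_of_norm_le_const fun x _ => hK x
    rw [show (-A - h) - (-A - h + h) = -h by ring, abs_neg, abs_of_pos hh] at b1
    rw [show A - (A + h) = -h by ring, abs_neg, abs_of_pos hh] at b2
    have := (abs_le.1 b1).2
    have := (abs_le.1 b2).1
    linarith
  have hIval : ∀ a : ℝ, ∫ v, (Icc (a - h) a).indicator (fun _ => M) v = h * M := fun a => by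
    rw [integral_indicator measurableSet_Icc, setIntegral_const]
    simp [hh.le]
  calc ∫ v, |G v - G (v + h)| ≤ ∫ v, (D v + I₁ v + I₂ v) :=
        integral_mono_of_nonneg (ae_of_all _ fun v => abs_nonneg _)
          ((hDi.add (hI _ _)).add (hI _ _)) (ae_of_all _ hle)
    _ = (∫ v, D v) + (∫ v, I₁ v) + ∫ v, I₂ v := by
        have e : ∀ v, D v + I₁ v + I₂ v = (D + I₁) v + I₂ v := fun _ => rfl
        simp only [e]
        rw [integral_add (hDi.add (hI _ _)) (hI _ _)]
        congr 1
        exact integral_add hDi (hI _ _)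
    _ ≤ h * (2 * K + 2 * M) := by
        rw [hI₁, hI₂, hIval, hIval]
        linarith

/-- Band-limited filters are bounded in the frequency domain. -/
theorem exists_norm_le_of_boundedVariation {ψhat : ℝ → ℂ} {A : ℝ} (hA : 0 ≤ A)
    (hBV : BoundedVariationOn ψhat (Icc (-A) A)) (hsupp : Function.support ψhat ⊆ Icc (-A) A) :
    ∃ M : ℝ, 0 ≤ M ∧ ∀ v, ‖ψhat v‖ ≤ M := by
  refine ⟨‖ψhat 0‖ + (eVariationOn ψhat (Icc (-A) A)).toReal, by positivity, fun v => ?_⟩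
  by_cases hv : v ∈ Icc (-A) A
  · have h := hBV.dist_le hv (show (0 : ℝ) ∈ Icc (-A) A from ⟨by linarith, hA⟩)
    rw [dist_eq_norm] at h
    calc ‖ψhat v‖ = ‖ψhat 0 + (ψhat v - ψhat 0)‖ := by congr 1; ring
      _ ≤ _ := (norm_add_le _ _).trans (by linarith)
  · have : ψhat v = 0 := by_contra fun h => hv (hsupp h)
    rw [this, norm_zero]
    positivity

/-- The cosine transform of `|ψhat|² g` decays like `1 / x`, with a constant depending on `g` only
through bounds for `g` and its Lipschitz constant. -/
theorem exists_abs_integral_cos_le {ψhat : ℝ → ℂ} {A : ℝ} (hA : 0 ≤ A)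
    (hm : AEStronglyMeasurable ψhat volume)
    (hBV : BoundedVariationOn ψhat (Icc (-A) A)) (hsupp : Function.support ψhat ⊆ Icc (-A) A)
    {B L : ℝ} (hB : 0 ≤ B) (hL : 0 ≤ L) : ∃ C : ℝ, 0 ≤ C ∧ ∀ g : ℝ → ℝ,
      AEStronglyMeasurable g volume → (∀ v ∈ Icc (-A) A, |g v| ≤ B) →
      (∀ v ∈ Icc (-A) A, ∀ w ∈ Icc (-A) A, |g v - g w| ≤ L * |v - w|) →
      ∀ x : ℝ, x ≠ 0 → |∫ v, Real.cos (v * x) * (‖ψhat v‖ ^ 2 * g v)| ≤ C / |x| := by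
  obtain ⟨M, hM0, hM⟩ := exists_norm_le_of_boundedVariation hA hBV hsupp
  set V := (eVariationOn ψhat (Icc (-A) A)).toReal with hV
  have hV0 : 0 ≤ V := ENNReal.toReal_nonneg
  -- a bound for the function that majorises the increments of `|ψhat|² g` below
  set K := 2 * M * B * V + M ^ 2 * L * A with hK
  have hK0 : 0 ≤ K := by positivity
  refine ⟨Real.pi * (K + M ^ 2 * B), by positivity, fun g hgm hgB hgL x hx => ?_⟩
  wlog hx0 : 0 < x generalizing x
  · have h := this (-x) (neg_ne_zero.2 hx) (by
      rcases lt_or_gt_of_ne hx with h | h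
      · linarith
      · exact absurd h hx0)
    simpa [Real.cos_neg] using h
  set G : ℝ → ℝ := fun v => ‖ψhat v‖ ^ 2 * g v with hG
  have hG0 : ∀ v, v ∉ Icc (-A) A → G v = 0 := fun v hv => by
    have : ψhat v = 0 := by_contra fun h => hv (hsupp h)
    simp [hG, this]
  have hGb : ∀ v, |G v| ≤ M ^ 2 * B := fun v => by
    by_cases hv : v ∈ Icc (-A) A
    · rw [hG, abs_mul, abs_of_nonneg (by positivity)]
      exact mul_le_mul (pow_le_pow_left₀ (norm_nonneg _) (hM v) 2) (hgB v hv) (abs_nonneg _)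
        (by positivity)
    · rw [hG0 v hv, abs_zero]
      positivity
  have hGi : Integrable G := by
    have hon : IntegrableOn G (Icc (-A) A) := by
      refine Measure.integrableOn_of_bounded (by simp) ((hm.norm.pow 2).mul hgm)
        (ae_of_all _ fun v => hGb v)
    refine (integrableOn_iff_integrable_of_support_subset fun v hv => ?_).1 hon
    exact by_contra fun h => hv (hG0 v h)
  -- The variation of `ψhat` up to `v`.
  set W : ℝ → ℝ := fun v => (eVariationOn ψhat (Icc (-A) A ∩ Iic v)).toReal with hW
  have hWfin : ∀ v, eVariationOn ψhat (Icc (-A) A ∩ Iic v) ≠ ⊤ := fun v =>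
    hBV.mono inter_subset_left
  have hWmono : Monotone W := fun v w hvw => ENNReal.toReal_mono (hWfin w)
    (eVariationOn.mono _ (inter_subset_inter_right _ (Iic_subset_Iic.2 hvw)))
  have hWV : ∀ v, W v ≤ V := fun v => ENNReal.toReal_mono hBV (eVariationOn.mono _ inter_subset_left)
  have hWd : ∀ v ∈ Icc (-A) A, ∀ w ∈ Icc (-A) A, v ≤ w → ‖ψhat v - ψhat w‖ ≤ W w - W v := by
    intro v hv w hw hvw
    have h1 := eVariationOn.add_le_union ψhat (s := Icc (-A) A ∩ Iic v) (t := {v, w})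
      (by rintro a ⟨-, ha⟩ b (rfl | rfl); exacts [ha, le_trans ha hvw])
    have h2 : Icc (-A) A ∩ Iic v ∪ {v, w} ⊆ Icc (-A) A ∩ Iic w := by
      rintro a (⟨ha, hav⟩ | rfl | rfl)
      exacts [⟨ha, le_trans hav hvw⟩, ⟨hv, hvw⟩, ⟨hw, le_refl a⟩]
    have h3 := h1.trans (eVariationOn.mono _ h2)
    rw [eVariationOn.pair] at h3
    have h4 := ENNReal.toReal_mono (hWfin w) h3
    rw [ENNReal.toReal_add (hWfin v) (edist_ne_top _ _), edist_dist,
      ENNReal.toReal_ofReal dist_nonneg, dist_eq_norm] at h4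
    simp only [hW]
    linarith
  -- the clamped identity, majorising the increments of Lipschitz functions on `[-A, A]`
  set cl : ℝ → ℝ := fun v => max (-A) (min v A) with hcl
  have hclmono : Monotone cl := fun v w h => max_le_max le_rfl (min_le_min h le_rfl)
  have hclb : ∀ v, |cl v| ≤ A := fun v =>
    abs_le.2 ⟨le_max_left _ _, max_le (by linarith) (min_le_right _ _)⟩
  have hclv : ∀ v ∈ Icc (-A) A, cl v = v := fun v hv => by
    simp only [hcl]
    rw [min_eq_left hv.2, max_eq_right hv.1]
  have hshift := integral_abs_sub_shift_le (G := G)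
    (N := fun v => 2 * M * B * W v + M ^ 2 * L * cl v) (M := M ^ 2 * B) (K := K)
    (h := Real.pi / x) hA (by positivity) hG0 hGb
    ((hWmono.const_mul (by positivity)).add (hclmono.const_mul (by positivity)))
    (fun v => by
      refine (abs_add_le _ _).trans (add_le_add ?_ ?_)
      · rw [abs_of_nonneg (mul_nonneg (by positivity) ENNReal.toReal_nonneg)]
        exact mul_le_mul_of_nonneg_left (hWV v) (by positivity)
      · rw [abs_mul, abs_of_nonneg (by positivity)]
        exact mul_le_mul_of_nonneg_left (hclb v) (by positivity))
    (fun v hv w hw hvw => by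
      have e : G v - G w = (‖ψhat v‖ - ‖ψhat w‖) * (‖ψhat v‖ + ‖ψhat w‖) * g v
          + ‖ψhat w‖ ^ 2 * (g v - g w) := by simp only [hG]; ring
      have h1 : |‖ψhat v‖ - ‖ψhat w‖| ≤ W w - W v :=
        (abs_norm_sub_norm_le _ _).trans (hWd v hv w hw hvw)
      have h2 : |g v - g w| ≤ L * (w - v) := by
        have := hgL v hv w hw
        rwa [abs_sub_comm v w, abs_of_nonneg (sub_nonneg.2 hvw)] at this
      have h3 : |‖ψhat v‖ + ‖ψhat w‖| ≤ 2 * M := by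
        rw [abs_of_nonneg (by positivity)]
        linarith [hM v, hM w]
      have h5 : ‖ψhat w‖ ^ 2 ≤ M ^ 2 := pow_le_pow_left₀ (norm_nonneg _) (hM w) 2
      have h6 : 0 ≤ W w - W v := sub_nonneg.2 (hWmono hvw)
      simp only [hclv v hv, hclv w hw]
      rw [e]
      refine (abs_add_le _ _).trans ?_
      rw [abs_mul, abs_mul, abs_mul, abs_of_nonneg (by positivity : 0 ≤ ‖ψhat w‖ ^ 2)]
      have i1 : |‖ψhat v‖ - ‖ψhat w‖| * |‖ψhat v‖ + ‖ψhat w‖| * |g v|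
          ≤ (W w - W v) * (2 * M) * B := by
        gcongr
        exact hgB v hv
      have i2 : ‖ψhat w‖ ^ 2 * |g v - g w| ≤ M ^ 2 * (L * (w - v)) := by gcongr
      linarith)
  refine (abs_integral_cos_mul_le_shift hGi hx0).trans ?_
  rw [abs_of_pos hx0]
  calc 1 / 2 * ∫ v, |G v - G (v + Real.pi / x)|
      ≤ 1 / 2 * (Real.pi / x * (2 * K + 2 * (M ^ 2 * B))) := by gcongr
    _ = Real.pi * (K + M ^ 2 * B) / x := by ring

/-! ### The Gaussian Hilbert space of a process -/

section GaussianSpace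

variable {Ω : Type*} [MeasurableSpace Ω] {P : Measure Ω} {X : ℝ → Ω → ℝ}

/-- The closed linear span of the variables `X t` in `L²(P)`. -/
noncomputable def gaussianSpace (hX2 : ∀ t, MemLp (X t) 2 P) : Submodule ℝ (Lp ℝ 2 P) :=
  (Submodule.span ℝ (range fun t => (hX2 t).toLp (X t))).topologicalClosure

theorem norm_sq_eq_integral_sq (Z : Lp ℝ 2 P) : ‖Z‖ ^ 2 = ∫ ω, Z ω ^ 2 ∂P := by
  rw [← real_inner_self_eq_norm_sq, L2.inner_def]
  simp [sq]

theorem inner_eq_integral_mul (Y Z : Lp ℝ 2 P) : inner ℝ Y Z = ∫ ω, Y ω * Z ω ∂P := by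
  rw [L2.inner_def]
  simp [mul_comm]

theorem integrable_exp_I_mul [IsFiniteMeasure P] {Z : Ω → ℝ} (hZ : AEStronglyMeasurable Z P)
    (t : ℝ) : Integrable (fun ω => Complex.exp (Complex.I * (t * Z ω : ℝ))) P := by
  refine Integrable.of_bound (C := 1) ?_ (ae_of_all _ fun ω => ?_)
  · exact Complex.continuous_exp.comp_aestronglyMeasurable
      ((Complex.continuous_ofReal.comp_aestronglyMeasurable (hZ.const_mul t)).const_mul _)
  · rw [mul_comm, Complex.norm_exp_ofReal_mul_I]

theorem continuous_integral_exp [IsProbabilityMeasure P] (t : ℝ) :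
    Continuous fun Z : Lp ℝ 2 P => ∫ ω, Complex.exp (Complex.I * (t * Z ω : ℝ)) ∂P := by
  refine (LipschitzWith.of_dist_le_mul (K := ‖t‖₊) fun Y Z => ?_).continuous
  rw [dist_eq_norm, dist_eq_norm, ← integral_sub (integrable_exp_I_mul (Lp.aestronglyMeasurable Y) t)
    (integrable_exp_I_mul (Lp.aestronglyMeasurable Z) t)]
  have hint : Integrable (⇑(Y - Z)) P := (Lp.memLp (Y - Z)).integrable one_le_two
  calc ‖∫ ω, (Complex.exp (Complex.I * (t * Y ω : ℝ)) - Complex.exp (Complex.I * (t * Z ω : ℝ))) ∂P‖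
      ≤ ∫ ω, |t| * ‖(Y - Z) ω‖ ∂P := by
        refine norm_integral_le_of_norm_le (hint.norm.const_mul _) ?_
        filter_upwards [Lp.coeFn_sub Y Z] with ω hω
        have e : Complex.exp (Complex.I * (t * Y ω : ℝ)) - Complex.exp (Complex.I * (t * Z ω : ℝ))
            = Complex.exp (Complex.I * (t * Z ω : ℝ))
              * (Complex.exp (Complex.I * (t * (Y ω - Z ω) : ℝ)) - 1) := by
          rw [mul_sub, ← Complex.exp_add, mul_one]
          congr 2
          push_cast
          ring
        rw [e, norm_mul, mul_comm Complex.I, Complex.norm_exp_ofReal_mul_I, one_mul, hω,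
          Pi.sub_apply]
        refine Real.norm_exp_I_mul_ofReal_sub_one_le.trans ?_
        rw [norm_mul, Real.norm_eq_abs]
    _ = |t| * ∫ ω, ‖(Y - Z) ω‖ ∂P := integral_const_mul _ _
    _ ≤ |t| * ‖Y - Z‖ := by
        gcongr
        have h1 : eLpNorm (⇑(Y - Z)) 1 P ≤ eLpNorm (⇑(Y - Z)) 2 P :=
          eLpNorm_le_eLpNorm_of_exponent_le one_le_two (Lp.aestronglyMeasurable _)
        rw [Lp.norm_def, integral_norm_eq_lintegral_enorm (Lp.aestronglyMeasurable _),
          ← eLpNorm_one_eq_lintegral_enorm]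
        exact ENNReal.toReal_mono (Lp.memLp (Y - Z)).eLpNorm_ne_top h1

/-- Elements of the Gaussian space are centred Gaussian: this holds for finite linear combinations
and passes to `L²` limits, characteristic functions being continuous there. -/
theorem map_eq_gaussianReal_of_mem [IsProbabilityMeasure P] (hG : IsGaussianProcess X P)
    (h0 : ∀ t, ∫ ω, X t ω ∂P = 0) (hX2 : ∀ t, MemLp (X t) 2 P) {Z : Lp ℝ 2 P}
    (hZ : Z ∈ gaussianSpace hX2) : P.map Z = gaussianReal 0 (‖Z‖₊ ^ 2) := by
  -- the characteristic function on the span, extended to its closure by continuity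
  have key : ∀ t : ℝ, ∀ Z ∈ gaussianSpace hX2, ∫ ω, Complex.exp (Complex.I * (t * Z ω : ℝ)) ∂P
      = Complex.exp (-((‖Z‖ ^ 2 * t ^ 2 / 2 : ℝ) : ℂ)) := by
    intro t
    have hclosed : IsClosed {Z : Lp ℝ 2 P | ∫ ω, Complex.exp (Complex.I * (t * Z ω : ℝ)) ∂P
        = Complex.exp (-((‖Z‖ ^ 2 * t ^ 2 / 2 : ℝ) : ℂ))} :=
      isClosed_eq (continuous_integral_exp t) (by fun_prop)
    suffices h : ((Submodule.span ℝ (range fun t => (hX2 t).toLp (X t)) :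
        Submodule ℝ (Lp ℝ 2 P)) : Set (Lp ℝ 2 P)) ⊆
        {Z : Lp ℝ 2 P | ∫ ω, Complex.exp (Complex.I * (t * Z ω : ℝ)) ∂P
        = Complex.exp (-((‖Z‖ ^ 2 * t ^ 2 / 2 : ℝ) : ℂ))} by
      intro Z hZ
      have hZ' : Z ∈ closure ((Submodule.span ℝ (range fun t => (hX2 t).toLp (X t)) :
        Submodule ℝ (Lp ℝ 2 P)) : Set (Lp ℝ 2 P)) := hZ
      exact closure_minimal h hclosed hZ'
    intro Z hZ
    obtain ⟨c, rfl⟩ := Finsupp.mem_span_range_iff_exists_finsupp.1 hZ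
    set Z : Lp ℝ 2 P := c.sum fun s a => a • (hX2 s).toLp (X s) with hZdef
    have hae : Z =ᵐ[P] fun ω => ∑ s ∈ c.support, c s • X s ω := by
      have h1 := Lp.coeFn_finsetSum c.support fun s => c s • (hX2 s).toLp (X s)
      have h2 : ∀ s ∈ c.support, ∀ᵐ ω ∂P, (c s • (hX2 s).toLp (X s)) ω = c s • X s ω :=
        fun s _ => by
          filter_upwards [Lp.coeFn_smul (c s) ((hX2 s).toLp (X s)), (hX2 s).coeFn_toLp]
            with ω h h'
          rw [h, Pi.smul_apply, h']
      filter_upwards [h1, (ae_ball_iff c.support.countable_toSet).2 h2] with ω h h'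
      rw [hZdef, Finsupp.sum, h, Finset.sum_apply]
      exact Finset.sum_congr rfl fun s hs => h' s hs
    have hlaw : HasGaussianLaw Z P :=
      ((hG.smul c).hasGaussianLaw_fun_sum (I := c.support)).congr hae.symm
    have hmean : ∫ ω, Z ω ∂P = 0 := by
      have hi : ∀ s ∈ c.support, Integrable (fun ω => c s • X s ω) P := fun s _ =>
        ((hX2 s).integrable one_le_two).smul (c s)
      rw [integral_congr_ae hae, integral_finsetSum _ hi]
      exact Finset.sum_eq_zero fun s _ => by rw [integral_smul, h0, smul_zero]
    have hvar : Var[Z; P] = ‖Z‖ ^ 2 := by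
      rw [variance_of_integral_eq_zero hlaw.aemeasurable hmean, norm_sq_eq_integral_sq]
    have hmap := hlaw.map_eq_gaussianReal
    rw [hmean, hvar] at hmap
    have hchar := charFun_gaussianReal (μ := 0) (v := (‖Z‖ ^ 2).toNNReal) t
    rw [← hmap, charFun_apply_real, integral_map hlaw.aemeasurable
      (by fun_prop), Real.coe_toNNReal _ (sq_nonneg _)] at hchar
    rw [mem_ofPred_eq]
    refine Eq.trans ?_ (hchar.trans ?_)
    · refine integral_congr_ae (ae_of_all _ fun ω => ?_)
      simp only
      congr 1
      push_cast
      ring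
    · congr 1
      push_cast
      ring
  have hZm : AEMeasurable Z P := (Lp.aestronglyMeasurable Z).aemeasurable
  have : IsProbabilityMeasure (P.map Z) := Measure.isProbabilityMeasure_map hZm
  refine Measure.ext_of_charFun (funext fun t => ?_)
  rw [charFun_gaussianReal, charFun_apply_real, integral_map hZm (by fun_prop)]
  refine Eq.trans ?_ ((key t Z hZ).trans ?_)
  · refine integral_congr_ae (ae_of_all _ fun ω => ?_)
    simp only
    congr 1
    push_cast
    ring
  · congr 1
    push_cast
    ring

/-- The fourth moment of a centred Gaussian law, read off from its moment generating function. -/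
theorem integral_pow_four_gaussianReal (v : NNReal) : ∫ x, x ^ 4 ∂gaussianReal 0 v = 3 * v ^ 2 := by
  have h := iteratedDeriv_mgf_zero (X := id) (μ := gaussianReal 0 v) (by simp) 4
  rw [mgf_id_gaussianReal] at h
  have hd : ∀ p p' : ℝ → ℝ, (∀ t, HasDerivAt p (p' t) t) →
      deriv (fun t => p t * Real.exp (0 * t + v * t ^ 2 / 2))
        = fun t => (p' t + p t * (v * t)) * Real.exp (0 * t + v * t ^ 2 / 2) := by
    intro p p' hp
    ext t
    have h1 : HasDerivAt (fun t : ℝ => 0 * t + (v : ℝ) * t ^ 2 / 2) (v * t) t := by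
      have := ((hasDerivAt_id t).const_mul 0).add
        ((((hasDerivAt_id t).pow 2).const_mul (v : ℝ)).div_const 2)
      refine this.congr_deriv ?_
      simp
      ring
    exact (((hp t).fun_mul h1.exp).congr_deriv (by ring)).deriv
  have hexp : (fun t : ℝ => Real.exp (0 * t + v * t ^ 2 / 2))
      = fun t => (fun _ => (1 : ℝ)) t * Real.exp (0 * t + v * t ^ 2 / 2) := by simp
  rw [iteratedDeriv_succ', iteratedDeriv_succ', iteratedDeriv_succ', iteratedDeriv_succ',
    iteratedDeriv_zero, hexp,
    hd _ (fun _ => 0) (fun t => hasDerivAt_const t _),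
    hd (fun t => 0 + 1 * (v * t)) (fun _ => v) (fun t => by
      simpa using (hasDerivAt_id t).const_mul (v : ℝ)),
    hd (fun t => v + (0 + 1 * (v * t)) * (v * t)) (fun t => 2 * v ^ 2 * t) (fun t => by
      have h1 : HasDerivAt (fun t : ℝ => (v : ℝ) * t) v t := by
        simpa using (hasDerivAt_id t).const_mul (v : ℝ)
      exact ((((h1.const_mul 1).const_add 0).fun_mul h1).const_add (v : ℝ)).congr_deriv (by ring)),
    hd _ (fun t => 3 * v ^ 2 + 3 * v ^ 3 * t ^ 2) (fun t => by
      have h1 : HasDerivAt (fun t : ℝ => (v : ℝ) * t) v t := by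
        simpa using (hasDerivAt_id t).const_mul (v : ℝ)
      have h2 : HasDerivAt (fun t : ℝ => 2 * (v : ℝ) ^ 2 * t) (2 * (v : ℝ) ^ 2) t := by
        simpa using (hasDerivAt_id t).const_mul (2 * (v : ℝ) ^ 2)
      exact (h2.fun_add (((((h1.const_mul 1).const_add 0).fun_mul h1).const_add
        (v : ℝ)).fun_mul h1)).congr_deriv (by ring))] at h
  simp only [Pi.pow_apply, id] at h
  rw [← h]
  simp

theorem integrable_pow_four_of_mem [IsProbabilityMeasure P] (hG : IsGaussianProcess X P)
    (h0 : ∀ t, ∫ ω, X t ω ∂P = 0) (hX2 : ∀ t, MemLp (X t) 2 P) {Z : Lp ℝ 2 P}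
    (hZ : Z ∈ gaussianSpace hX2) :
    Integrable (fun ω => Z ω ^ 4) P := by
  have hZm : AEMeasurable Z P := (Lp.aestronglyMeasurable Z).aemeasurable
  have h := memLp_id_gaussianReal (μ := 0) (v := ‖Z‖₊ ^ 2) 4
  rw [← map_eq_gaussianReal_of_mem hG h0 hX2 hZ] at h
  have h' := (h.comp_of_map hZm).integrable_norm_pow (p := 4) (by norm_num)
  refine h'.congr (ae_of_all _ fun ω => ?_)
  simp [Even.pow_abs (by decide : Even 4)]

theorem integral_pow_four_of_mem [IsProbabilityMeasure P] (hG : IsGaussianProcess X P)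
    (h0 : ∀ t, ∫ ω, X t ω ∂P = 0) (hX2 : ∀ t, MemLp (X t) 2 P) {Z : Lp ℝ 2 P}
    (hZ : Z ∈ gaussianSpace hX2) :
    ∫ ω, Z ω ^ 4 ∂P = 3 * ‖Z‖ ^ 4 := by
  have hZm : AEMeasurable Z P := (Lp.aestronglyMeasurable Z).aemeasurable
  have h := integral_pow_four_gaussianReal (‖Z‖₊ ^ 2)
  rw [← map_eq_gaussianReal_of_mem hG h0 hX2 hZ, integral_map hZm (by fun_prop)] at h
  rw [h]
  push_cast
  ring

/-- Wick's formula `E[Y² Z²] = E[Y²] E[Z²] + 2 E[YZ]²`, obtained by polarising the fourth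
moment. -/
theorem integral_sq_mul_sq_of_mem [IsProbabilityMeasure P] (hG : IsGaussianProcess X P)
    (h0 : ∀ t, ∫ ω, X t ω ∂P = 0) (hX2 : ∀ t, MemLp (X t) 2 P) {Y Z : Lp ℝ 2 P}
    (hY : Y ∈ gaussianSpace hX2) (hZ : Z ∈ gaussianSpace hX2) : Integrable (fun ω => Y ω ^ 2 * Z ω ^ 2) P ∧
    ∫ ω, Y ω ^ 2 * Z ω ^ 2 ∂P = ‖Y‖ ^ 2 * ‖Z‖ ^ 2 + 2 * inner ℝ Y Z ^ 2 := by
  have i1 := integrable_pow_four_of_mem hG h0 hX2 (Submodule.add_mem _ hY hZ)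
  have i2 := integrable_pow_four_of_mem hG h0 hX2 (Submodule.sub_mem _ hY hZ)
  have i3 := integrable_pow_four_of_mem hG h0 hX2 hY
  have i4 := integrable_pow_four_of_mem hG h0 hX2 hZ
  have e : (fun ω => Y ω ^ 2 * Z ω ^ 2) =ᵐ[P] fun ω =>
      1 / 12 * ((Y + Z : Lp ℝ 2 P) ω ^ 4 + (Y - Z : Lp ℝ 2 P) ω ^ 4
        - 2 * Y ω ^ 4 - 2 * Z ω ^ 4) := by
    filter_upwards [Lp.coeFn_add Y Z, Lp.coeFn_sub Y Z] with ω h1 h2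
    rw [h1, h2, Pi.add_apply, Pi.sub_apply]
    ring
  have i12 := i1.fun_add i2
  have i123 : Integrable (fun ω => (Y + Z : Lp ℝ 2 P) ω ^ 4 + (Y - Z : Lp ℝ 2 P) ω ^ 4
      - 2 * Y ω ^ 4) P := i12.sub (i3.const_mul 2)
  refine ⟨((i123.sub (i4.const_mul 2)).const_mul (1 / 12)).congr e.symm, ?_⟩
  rw [integral_congr_ae e, integral_const_mul, integral_sub i123 (i4.const_mul 2),
    integral_sub i12 (i3.const_mul 2), integral_add i1 i2, integral_const_mul, integral_const_mul,
    integral_pow_four_of_mem hG h0 hX2 hY,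
    integral_pow_four_of_mem hG h0 hX2 hZ,
    integral_pow_four_of_mem hG h0 hX2 (Submodule.add_mem _ hY hZ),
    integral_pow_four_of_mem hG h0 hX2 (Submodule.sub_mem _ hY hZ),
    show ‖Y + Z‖ ^ 4 = (‖Y + Z‖ ^ 2) ^ 2 by ring, show ‖Y - Z‖ ^ 4 = (‖Y - Z‖ ^ 2) ^ 2 by ring,
    norm_add_sq_real, norm_sub_sq_real]
  ring

/-- The variance of a sum of squares of elements of the Gaussian space. -/
theorem integral_sum_sq_sub_sq_of_mem [IsProbabilityMeasure P] (hG : IsGaussianProcess X P)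
    (h0 : ∀ t, ∫ ω, X t ω ∂P = 0) (hX2 : ∀ t, MemLp (X t) 2 P) {ι : Type*}
    (s : Finset ι) {Z : ι → Lp ℝ 2 P}
    (hZ : ∀ k ∈ s, Z k ∈ gaussianSpace hX2) :
    Integrable (fun ω => (∑ k ∈ s, (Z k ω ^ 2 - ‖Z k‖ ^ 2)) ^ 2) P ∧
    ∫ ω, (∑ k ∈ s, (Z k ω ^ 2 - ‖Z k‖ ^ 2)) ^ 2 ∂P
      = ∑ k ∈ s, ∑ l ∈ s, 2 * inner ℝ (Z k) (Z l) ^ 2 := by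
  have hsq : ∀ k, Integrable (fun ω => Z k ω ^ 2) P := fun k => (Lp.memLp (Z k)).integrable_sq
  have hterm : ∀ k ∈ s, ∀ l ∈ s,
      Integrable (fun ω => (Z k ω ^ 2 - ‖Z k‖ ^ 2) * (Z l ω ^ 2 - ‖Z l‖ ^ 2)) P ∧
      ∫ ω, (Z k ω ^ 2 - ‖Z k‖ ^ 2) * (Z l ω ^ 2 - ‖Z l‖ ^ 2) ∂P
        = 2 * inner ℝ (Z k) (Z l) ^ 2 := by
    intro k hk l hl
    obtain ⟨hi, he⟩ := integral_sq_mul_sq_of_mem hG h0 hX2 (hZ k hk) (hZ l hl)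
    have e : (fun ω => (Z k ω ^ 2 - ‖Z k‖ ^ 2) * (Z l ω ^ 2 - ‖Z l‖ ^ 2)) = fun ω =>
        Z k ω ^ 2 * Z l ω ^ 2 - ‖Z l‖ ^ 2 * Z k ω ^ 2 - ‖Z k‖ ^ 2 * Z l ω ^ 2
          + ‖Z k‖ ^ 2 * ‖Z l‖ ^ 2 := by ext ω; ring
    have j1 := (hsq k).const_mul (‖Z l‖ ^ 2)
    have j2 := (hsq l).const_mul (‖Z k‖ ^ 2)
    have j3 : Integrable (fun _ : Ω => ‖Z k‖ ^ 2 * ‖Z l‖ ^ 2) P := integrable_const _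
    rw [e]
    have k1 : Integrable (fun ω => Z k ω ^ 2 * Z l ω ^ 2 - ‖Z l‖ ^ 2 * Z k ω ^ 2) P := hi.sub j1
    have k2 : Integrable (fun ω => Z k ω ^ 2 * Z l ω ^ 2 - ‖Z l‖ ^ 2 * Z k ω ^ 2
      - ‖Z k‖ ^ 2 * Z l ω ^ 2) P := k1.sub j2
    refine ⟨k2.fun_add j3, ?_⟩
    rw [integral_add k2 j3, integral_sub k1 j2, integral_sub hi j1,
      integral_const_mul, integral_const_mul, he, ← norm_sq_eq_integral_sq,
      ← norm_sq_eq_integral_sq]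
    simp
    ring
  have e : (fun ω => (∑ k ∈ s, (Z k ω ^ 2 - ‖Z k‖ ^ 2)) ^ 2) = fun ω =>
      ∑ k ∈ s, ∑ l ∈ s, (Z k ω ^ 2 - ‖Z k‖ ^ 2) * (Z l ω ^ 2 - ‖Z l‖ ^ 2) := by
    ext ω
    rw [sq, Finset.sum_mul_sum]
  rw [e]
  refine ⟨integrable_finsetSum _ fun k hk => integrable_finsetSum _ fun l hl =>
    (hterm k hk l hl).1, ?_⟩
  rw [integral_finsetSum _ fun k hk => integrable_finsetSum _ fun l hl => (hterm k hk l hl).1]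
  refine Finset.sum_congr rfl fun k hk => ?_
  rw [integral_finsetSum _ fun l hl => (hterm k hk l hl).1]
  exact Finset.sum_congr rfl fun l hl => (hterm k hk l hl).2

end GaussianSpace

/-! ### Pathwise integrals of the process and the spectral isometry -/

section PathIntegral

variable {Ω : Type*} [MeasurableSpace Ω] {P : Measure Ω} {X : ℝ → Ω → ℝ} {f : ℝ → ℝ}

theorem IsGaussianWithSpectralDensity.memLp_two (hX : IsGaussianWithSpectralDensity P X f) (t : ℝ) :
    MemLp (X t) 2 P :=
  (hX.gaussian.hasGaussianLaw_eval t).memLp_two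

theorem IsGaussianWithSpectralDensity.integral_mul_eq (hX : IsGaussianWithSpectralDensity P X f)
    (s t : ℝ) : ((∫ ω, X s ω * X t ω ∂P : ℝ) : ℂ)
      = ∫ u : ℝ, Complex.exp (Complex.I * (s - t : ℝ) * u) * (f u : ℂ) := by
  have := hX.gaussian.isProbabilityMeasure
  rw [← hX.covariance_eq s t, covariance_eq_sub (hX.memLp_two s) (hX.memLp_two t), hX.mean_zero,
    hX.mean_zero, mul_zero, sub_zero]
  rfl

theorem IsGaussianWithSpectralDensity.integral_sq (hX : IsGaussianWithSpectralDensity P X f)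
    (t : ℝ) : ∫ ω, X t ω ^ 2 ∂P = ∫ u, f u := by
  have h := hX.integral_mul_eq t t
  simp only [sub_self, Complex.ofReal_zero, mul_zero, zero_mul, Complex.exp_zero, one_mul,
    integral_complex_ofReal] at h
  simpa [sq] using Complex.ofReal_injective h

/-- The pathwise integral `∫ φ(t) X(t) dt`. -/
noncomputable def pathIntegral (X : ℝ → Ω → ℝ) (φ : ℝ → ℝ) (ω : Ω) : ℝ := ∫ t, φ t * X t ω

theorem aestronglyMeasurable_uncurry_mul [SFinite P] (hX : Measurable (Function.uncurry X))
    {φ : ℝ → ℝ} (hφ : AEStronglyMeasurable φ volume) :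
    AEStronglyMeasurable (fun z : Ω × ℝ => φ z.2 * X z.2 z.1) (P.prod volume) :=
  hφ.comp_snd.mul (hX.comp measurable_swap).aestronglyMeasurable

theorem IsGaussianWithSpectralDensity.memLp_pathIntegral [IsProbabilityMeasure P]
    (hX : IsGaussianWithSpectralDensity P X f) {φ : ℝ → ℝ} (hφ : Integrable φ) :
    MemLp (pathIntegral X φ) 2 P := by
  have hm := aestronglyMeasurable_uncurry_mul (P := P) hX.measurable hφ.1
  refine ⟨hm.integral_prod_right', ?_⟩
  rw [eLpNorm_lt_top_iff_lintegral_rpow_enorm_lt_top two_ne_zero ENNReal.ofNat_ne_top]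
  -- Cauchy–Schwarz with respect to the measure `|φ(t)| dt`.
  have hcs : ∀ ω, ‖pathIntegral X φ ω‖ₑ ^ (2 : ℝ≥0∞).toReal
      ≤ (∫⁻ t, ‖φ t‖ₑ) * ∫⁻ t, ‖φ t‖ₑ * ‖X t ω‖ₑ ^ 2 := fun ω => by
    have hXω : Measurable fun t => X t ω := hX.measurable.comp measurable_prodMk_right
    have h1 : ‖pathIntegral X φ ω‖ₑ ≤ ∫⁻ t, ‖φ t‖ₑ * ‖X t ω‖ₑ := by
      refine (enorm_integral_le_lintegral_enorm _).trans (le_of_eq ?_)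
      simp only [enorm_mul]
    have h2 := ENNReal.lintegral_mul_norm_pow_le (μ := volume) (f := fun t => ‖φ t‖ₑ)
      (g := fun t => ‖φ t‖ₑ * ‖X t ω‖ₑ ^ 2) hφ.1.enorm
      (hφ.1.enorm.mul (hXω.enorm.pow_const 2).aemeasurable)
      (p := 1 / 2) (q := 1 / 2) (by norm_num) (by norm_num) (by norm_num)
    have h3 : ∀ t, ‖φ t‖ₑ ^ (1 / 2 : ℝ) * (‖φ t‖ₑ * ‖X t ω‖ₑ ^ 2) ^ (1 / 2 : ℝ)
        = ‖φ t‖ₑ * ‖X t ω‖ₑ := fun t => by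
      rw [← ENNReal.mul_rpow_of_nonneg _ _ (by norm_num), ← mul_assoc, ← sq, ← mul_pow,
        ← ENNReal.rpow_two, ← ENNReal.rpow_mul]
      norm_num
    simp only [h3] at h2
    rw [← ENNReal.mul_rpow_of_nonneg _ _ (by norm_num)] at h2
    refine (ENNReal.rpow_le_rpow (h1.trans h2) (by norm_num)).trans (le_of_eq ?_)
    rw [← ENNReal.rpow_mul]
    norm_num
  refine (lintegral_mono hcs).trans_lt ?_
  have hφfin : ∫⁻ t, ‖φ t‖ₑ ≠ ⊤ := hφ.2.ne
  rw [lintegral_const_mul' _ _ hφfin, lintegral_lintegral_swap]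
  · have hin : ∀ t, ∫⁻ ω, ‖φ t‖ₑ * ‖X t ω‖ₑ ^ 2 ∂P = ‖φ t‖ₑ * ENNReal.ofReal (∫ u, f u) := fun t => by
      rw [lintegral_const_mul' _ _ (by simp), ← hX.integral_sq t,
        ofReal_integral_eq_lintegral_ofReal (hX.memLp_two t).integrable_sq
          (ae_of_all _ fun ω => sq_nonneg _)]
      congr 1
      refine lintegral_congr fun ω => ?_
      rw [← ofReal_norm, ← ENNReal.ofReal_pow (norm_nonneg _), Real.norm_eq_abs, sq_abs]
    simp only [hin]
    rw [lintegral_mul_const' _ _ ENNReal.ofReal_ne_top]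
    exact ENNReal.mul_lt_top hφfin.lt_top (ENNReal.mul_lt_top hφfin.lt_top ENNReal.ofReal_lt_top)
  · exact hφ.1.comp_snd.enorm.mul
      ((hX.measurable.comp measurable_swap).enorm.pow_const 2).aemeasurable

/-- Fubini's theorem for the product of a pathwise integral with a square-integrable variable. -/
theorem IsGaussianWithSpectralDensity.integral_pathIntegral_mul [IsProbabilityMeasure P]
    (hX : IsGaussianWithSpectralDensity P X f) {φ : ℝ → ℝ} (hφ : Integrable φ) {Y : Ω → ℝ}
    (hY : MemLp Y 2 P) :
    ∫ ω, pathIntegral X φ ω * Y ω ∂P = ∫ t, φ t * ∫ ω, X t ω * Y ω ∂P := by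
  have hm : AEStronglyMeasurable (fun z : Ω × ℝ => φ z.2 * X z.2 z.1 * Y z.1) (P.prod volume) :=
    (aestronglyMeasurable_uncurry_mul hX.measurable hφ.1).mul hY.1.comp_fst
  have hXY : ∀ t, Integrable (fun ω => X t ω * Y ω) P := fun t => (hX.memLp_two t).integrable_mul hY
  have hint : Integrable (fun z : Ω × ℝ => φ z.2 * X z.2 z.1 * Y z.1) (P.prod volume) := by
    rw [integrable_prod_iff' hm]
    refine ⟨ae_of_all _ fun t => ?_, ?_⟩
    · simpa only [mul_assoc] using (hXY t).const_mul (φ t)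
    · refine Integrable.mono' (hφ.norm.mul_const ((∫ u, f u) + ∫ ω, Y ω ^ 2 ∂P))
        hm.norm.prod_swap.integral_prod_right' (ae_of_all _ fun t => ?_)
      have hi := (hX.memLp_two t).integrable_sq.fun_add hY.integrable_sq
      rw [Real.norm_of_nonneg (integral_nonneg fun ω => norm_nonneg _), ← hX.integral_sq t,
        ← integral_add (hX.memLp_two t).integrable_sq hY.integrable_sq, ← integral_const_mul]
      refine integral_mono_of_nonneg (ae_of_all _ fun ω => norm_nonneg _) (hi.const_mul _)
        (ae_of_all _ fun ω => ?_)
      simp only [mul_assoc, norm_mul]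
      refine mul_le_mul_of_nonneg_left ?_ (norm_nonneg _)
      rw [Real.norm_eq_abs, Real.norm_eq_abs, ← sq_abs (X t ω), ← sq_abs (Y ω)]
      nlinarith [sq_nonneg (|X t ω| - |Y ω|), sq_nonneg |X t ω|, sq_nonneg |Y ω|]
  have hswap := integral_integral_swap (f := fun ω t => φ t * X t ω * Y ω) hint
  simp only [integral_mul_const] at hswap
  rw [show (∫ ω, pathIntegral X φ ω * Y ω ∂P) = ∫ ω, (∫ t, φ t * X t ω) * Y ω ∂P from rfl, hswap]
  simp only [mul_assoc, integral_const_mul]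

/-- The pathwise integral belongs to the Gaussian space, being orthogonal to everything that is
orthogonal to all `X t`. -/
theorem IsGaussianWithSpectralDensity.toLp_pathIntegral_mem [IsProbabilityMeasure P]
    (hX : IsGaussianWithSpectralDensity P X f) {φ : ℝ → ℝ} (hφ : Integrable φ) :
    (hX.memLp_pathIntegral hφ).toLp _ ∈ gaussianSpace hX.memLp_two := by
  rw [gaussianSpace, ← Submodule.orthogonal_orthogonal_eq_closure, Submodule.mem_orthogonal']
  intro Y hY
  rw [Submodule.mem_orthogonal] at hY
  have hXY : ∀ t, ∫ ω, X t ω * Y ω ∂P = 0 := fun t => by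
    have := hY _ (Submodule.subset_span ⟨t, rfl⟩)
    rw [inner_eq_integral_mul] at this
    rw [← this]
    refine integral_congr_ae ?_
    filter_upwards [(hX.memLp_two t).coeFn_toLp] with ω h
    rw [h]
  rw [inner_eq_integral_mul]
  have e : ∫ ω, (hX.memLp_pathIntegral hφ).toLp _ ω * Y ω ∂P = ∫ ω, pathIntegral X φ ω * Y ω ∂P := by
    refine integral_congr_ae ?_
    filter_upwards [(hX.memLp_pathIntegral hφ).coeFn_toLp] with ω h
    rw [h]
  rw [e, hX.integral_pathIntegral_mul hφ (Lp.memLp Y)]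
  simp [hXY]

theorem integral_mul_integral_kernel {K : ℝ → ℝ → ℂ} (hK : Continuous (Function.uncurry K))
    (hK1 : ∀ t u, ‖K t u‖ ≤ 1) {φ g : ℝ → ℂ} (hφ : Integrable φ) (hg : Integrable g) :
    ∫ t, φ t * ∫ u, K t u * g u = ∫ u, (∫ t, K t u * φ t) * g u := by
  have hint : Integrable (fun z : ℝ × ℝ => K z.1 z.2 * (φ z.1 * g z.2)) (volume.prod volume) :=
    (hφ.mul_prod hg).bdd_mul (c := 1) hK.aestronglyMeasurable (ae_of_all _ fun z => hK1 _ _)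
  have h := integral_integral_swap (f := fun t u => K t u * (φ t * g u)) hint
  refine Eq.trans ?_ (h.trans ?_)
  · refine integral_congr_ae (ae_of_all _ fun t => ?_)
    simp only
    rw [← integral_const_mul]
    exact integral_congr_ae (ae_of_all _ fun u => by simp only; ring)
  · refine integral_congr_ae (ae_of_all _ fun u => ?_)
    simp only
    rw [← integral_mul_const]
    exact integral_congr_ae (ae_of_all _ fun t => by simp only; ring)

theorem norm_angularFourier_le (φ : ℝ → ℂ) (u : ℝ) : ‖angularFourier φ u‖ ≤ ∫ t, ‖φ t‖ := by
  refine (norm_integral_le_integral_norm _).trans (le_of_eq ?_)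
  refine integral_congr_ae (ae_of_all _ fun t => ?_)
  simp only [norm_mul]
  rw [show -(Complex.I * u * t) = ((-(u * t) : ℝ) : ℂ) * Complex.I by push_cast; ring,
    Complex.norm_exp_ofReal_mul_I, one_mul]

open scoped ComplexConjugate in
/-- The spectral isometry: covariances of pathwise integrals are inner products of Fourier
transforms with respect to the spectral measure. -/
theorem IsGaussianWithSpectralDensity.integral_pathIntegral_mul_pathIntegral
    [IsProbabilityMeasure P] (hX : IsGaussianWithSpectralDensity P X f) {φ χ : ℝ → ℝ}
    (hφ : Integrable φ) (hχ : Integrable χ) :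
    ((∫ ω, pathIntegral X φ ω * pathIntegral X χ ω ∂P : ℝ) : ℂ)
      = ∫ u, conj (angularFourier (fun t => (φ t : ℂ)) u) *
          angularFourier (fun t => (χ t : ℂ)) u * (f u : ℂ) := by
  have hfi : Integrable fun u => (f u : ℂ) := hX.density_integrable.ofReal
  have hexp : ∀ (x : ℝ), ‖Complex.exp (Complex.I * x)‖ = 1 := fun x => by
    rw [mul_comm, Complex.norm_exp_ofReal_mul_I]
  have hinner : ∀ t, ((∫ ω, X t ω * pathIntegral X χ ω ∂P : ℝ) : ℂ)
      = ∫ u : ℝ, Complex.exp (Complex.I * (t * u : ℝ)) *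
          (angularFourier (fun t => (χ t : ℂ)) u * (f u : ℂ)) := fun t => by
    have h1 : ∫ ω, X t ω * pathIntegral X χ ω ∂P = ∫ s, χ s * ∫ ω, X s ω * X t ω ∂P := by
      rw [← hX.integral_pathIntegral_mul hχ (hX.memLp_two t)]
      simp only [mul_comm]
    rw [h1, ← integral_complex_ofReal]
    have h2 := integral_mul_integral_kernel (K := fun s u => Complex.exp (Complex.I * (-(u * s) : ℝ)))
      (φ := fun s => (χ s : ℂ)) (g := fun u => Complex.exp (Complex.I * (t * u : ℝ)) * f u)
      (by fun_prop) (fun s u => (hexp _).le) hχ.ofReal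
      (hfi.bdd_mul (c := 1) (by fun_prop) (ae_of_all _ fun u => (hexp _).le))
    refine Eq.trans ?_ (h2.trans ?_)
    · refine integral_congr_ae (ae_of_all _ fun s => ?_)
      simp only [Complex.ofReal_mul]
      congr 1
      rw [← Complex.ofReal_inj.2 (integral_congr_ae (ae_of_all _ fun ω => mul_comm (X t ω) (X s ω))),
        hX.integral_mul_eq]
      refine integral_congr_ae (ae_of_all _ fun u => ?_)
      simp only
      rw [← mul_assoc, ← Complex.exp_add]
      congr 2
      push_cast
      ring
    · refine integral_congr_ae (ae_of_all _ fun u => ?_)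
      simp only [angularFourier]
      rw [mul_left_comm]
      congr 3
      ext s
      congr 2
      push_cast
      ring
  rw [hX.integral_pathIntegral_mul hφ (hX.memLp_pathIntegral hχ), ← integral_complex_ofReal]
  have hg : Integrable fun u => angularFourier (fun t => (χ t : ℂ)) u * (f u : ℂ) :=
    hfi.bdd_mul (continuous_angularFourier hχ.ofReal).aestronglyMeasurable
      (ae_of_all _ fun u => norm_angularFourier_le _ u)
  have h3 := integral_mul_integral_kernel (K := fun t u => Complex.exp (Complex.I * (t * u : ℝ)))
    (φ := fun s => (φ s : ℂ)) (by fun_prop) (fun s u => (hexp _).le) hφ.ofReal hg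
  refine Eq.trans ?_ (h3.trans ?_)
  · refine integral_congr_ae (ae_of_all _ fun t => ?_)
    simp only [Complex.ofReal_mul]
    rw [hinner]
    simp only [Complex.ofReal_mul]
  · refine integral_congr_ae (ae_of_all _ fun u => ?_)
    simp only [angularFourier]
    rw [← integral_conj, mul_assoc]
    congr 2
    ext t
    rw [map_mul, Complex.conj_ofReal, ← Complex.exp_conj]
    congr 2
    simp only [map_neg, map_mul, Complex.conj_I, Complex.conj_ofReal]
    push_cast
    ring

end PathIntegral

/-! ### Existence and covariances of the filter transforms -/

section FilterTransform

/-- The weight `a^{-1/2} ψ((t - b) / a)` restricted to `(-S, T]`. -/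
noncomputable def filterWeight (ψ : ℝ → ℝ) (a b : ℝ) (p : ℝ × ℝ) (t : ℝ) : ℝ :=
  1 / √a * (Ioc (-p.1) p.2).indicator (fun t => ψ ((t - b) / a)) t

/-- The spectral representative of the filter transform, to be regarded as an element of
`L²(f(u) du)`. -/
noncomputable def filterSpectrum (ψhat : ℝ → ℂ) (a b u : ℝ) : ℂ :=
  √a * Complex.exp (-(Complex.I * u * b)) * ψhat (a * u)

variable {ψ : ℝ → ℝ} {ψhat : ℝ → ℂ} {A a : ℝ}

theorem memLp_comp_sub_div (hψ : MemLp ψ 2) (ha : 0 < a) (b : ℝ) :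
    MemLp (fun t => ψ ((t - b) / a)) 2 := by
  have h1 : AEStronglyMeasurable (fun t => ψ ((t - b) / a)) volume := by
    have hq : Measure.QuasiMeasurePreserving (fun t : ℝ => (t - b) / a) volume volume := by
      have hq1 := (measurePreserving_sub_right (volume : Measure ℝ) b).quasiMeasurePreserving
      have hq2 : Measure.QuasiMeasurePreserving (fun t : ℝ => t / a) volume volume := by
        simp only [div_eq_mul_inv]
        refine ⟨by fun_prop, ?_⟩
        rw [Real.map_volume_mul_right (inv_ne_zero ha.ne')]
        exact Measure.smul_absolutelyContinuous
      exact hq2.comp hq1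
    exact hψ.1.comp_quasiMeasurePreserving hq
  rw [memLp_two_iff_integrable_sq h1]
  exact (hψ.integrable_sq.comp_div ha.ne').comp_sub_right b

theorem integrable_filterWeight (hψ : MemLp ψ 2) (ha : 0 < a) (b : ℝ) (p : ℝ × ℝ) :
    Integrable (filterWeight ψ a b p) :=
  ((integrable_indicator_iff measurableSet_Ioc).2
    (integrableOn_Ioc_of_memLp_two (memLp_comp_sub_div hψ ha b) _ _)).const_mul _

theorem pathIntegral_filterWeight {Ω : Type*} (X : ℝ → Ω → ℝ) (b : ℝ) {p : ℝ × ℝ}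
    (hp : -p.1 ≤ p.2) (ω : Ω) : pathIntegral X (filterWeight ψ a b p) ω
      = (1 / √a) * ∫ t in (-p.1)..p.2, ψ ((t - b) / a) * X t ω := by
  rw [pathIntegral, intervalIntegral.integral_of_le hp, ← integral_indicator measurableSet_Ioc,
    ← integral_const_mul]
  refine integral_congr_ae (ae_of_all _ fun t => ?_)
  by_cases ht : t ∈ Ioc (-p.1) p.2 <;> simp [filterWeight, ht, mul_assoc]

/-- The transform of the truncated weight is a rescaled truncated transform of `ψ`. -/
theorem angularFourier_filterWeight (ha : 0 < a) (b : ℝ) {p : ℝ × ℝ} (hp : -p.1 ≤ p.2) (u : ℝ) :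
    angularFourier (fun t => (filterWeight ψ a b p t : ℂ)) u
      = √a * Complex.exp (-(Complex.I * u * b))
        * truncFourier ψ ((p.1 + b) / a) ((p.2 - b) / a) (a * u) := by
  have e1 : angularFourier (fun t => (filterWeight ψ a b p t : ℂ)) u
      = (1 / √a : ℝ) * ∫ t in (-p.1)..p.2, (fun s : ℝ => Complex.exp (-(Complex.I * u * b))
          * (Complex.exp (-(Complex.I * (a * u : ℝ) * s)) * (ψ s : ℂ))) (t / a - b / a) := by
    rw [angularFourier, intervalIntegral.integral_of_le hp, ← integral_indicator measurableSet_Ioc,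
      ← integral_const_mul]
    refine integral_congr_ae (ae_of_all _ fun t => ?_)
    by_cases ht : t ∈ Ioc (-p.1) p.2
    · simp only [filterWeight, ht, indicator_of_mem, ← sub_div]
      rw [← mul_assoc (Complex.exp (-(Complex.I * u * b))), ← Complex.exp_add]
      have hac : (a : ℂ) ≠ 0 := by exact_mod_cast ha.ne'
      have : -(Complex.I * u * b) + -(Complex.I * ((a * u : ℝ) : ℂ) * (((t - b) / a : ℝ) : ℂ))
          = -(Complex.I * u * t) := by
        push_cast
        field_simp
        ring
      rw [this]
      push_cast
      ring
    · simp [filterWeight, ht]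
  have e2 := intervalIntegral.integral_comp_div_sub (a := -p.1) (b := p.2)
    (fun s : ℝ => Complex.exp (-(Complex.I * u * b))
          * (Complex.exp (-(Complex.I * (a * u : ℝ) * s)) * (ψ s : ℂ))) ha.ne' (b / a)
  rw [e1, e2, intervalIntegral.integral_const_mul,
    truncFourier, show -p.1 / a - b / a = -((p.1 + b) / a) by ring, ← sub_div,
    Complex.real_smul, ← mul_assoc, ← mul_assoc, ← Complex.ofReal_mul]
  congr 3
  rw [one_div, inv_mul_eq_div, Real.div_sqrt]

theorem lintegral_comp_mul_left_mul {F : ℝ → ℝ≥0∞} (ha : 0 < a) :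
    ∫⁻ u, ENNReal.ofReal a * F (a * u) = ∫⁻ v, F v := by
  conv_rhs => rw [← Real.smul_map_volume_mul_left ha.ne', abs_of_pos ha]
  rw [lintegral_smul_measure, lintegral_const_mul' _ _ ENNReal.ofReal_ne_top]
  congr 1
  exact ((Homeomorph.mulLeft₀ a ha.ne').toMeasurableEquiv.measurableEmbedding.lintegral_map F).symm

/-- The measure `f(u) du`. -/
noncomputable def spectralMeasure (f : ℝ → ℝ) : Measure ℝ :=
  volume.withDensity fun u => ENNReal.ofReal (f u)

theorem isFiniteMeasure_spectralMeasure {f : ℝ → ℝ} (hf : Integrable f) :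
    IsFiniteMeasure (spectralMeasure f) :=
  isFiniteMeasure_withDensity_ofReal hf.2

theorem integral_spectralMeasure {f : ℝ → ℝ} (hf : Integrable f) (hf0 : ∀ u, 0 ≤ f u)
    (g : ℝ → ℂ) : ∫ u, g u ∂spectralMeasure f = ∫ u, g u * (f u : ℂ) := by
  rw [spectralMeasure, integral_withDensity_eq_integral_toReal_smul₀
    hf.1.aemeasurable.ennreal_ofReal (ae_of_all _ fun u => ENNReal.ofReal_lt_top)]
  refine integral_congr_ae (ae_of_all _ fun u => ?_)
  simp only
  rw [ENNReal.toReal_ofReal (hf0 u), Complex.real_smul, mul_comm]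

theorem aestronglyMeasurable_filterSpectrum (hm : AEStronglyMeasurable ψhat volume) (ha : 0 < a)
    (b : ℝ) : AEStronglyMeasurable (filterSpectrum ψhat a b) volume := by
  have hq : Measure.QuasiMeasurePreserving (fun u : ℝ => a * u) volume volume := by
    refine ⟨by fun_prop, ?_⟩
    rw [Real.map_volume_mul_left ha.ne']
    exact Measure.smul_absolutelyContinuous
  refine AEStronglyMeasurable.mul ?_ (hm.comp_quasiMeasurePreserving hq)
  exact Continuous.aestronglyMeasurable (by fun_prop)

theorem norm_filterSpectrum_prefactor (a b u : ℝ) :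
    ‖(√a : ℂ) * Complex.exp (-(Complex.I * u * b))‖ = √a := by
  rw [norm_mul, show -(Complex.I * u * b) = ((-(u * b) : ℝ) : ℂ) * Complex.I by push_cast; ring,
    Complex.norm_exp_ofReal_mul_I, mul_one, Complex.norm_real, Real.norm_of_nonneg (Real.sqrt_nonneg a)]

theorem memLp_filterSpectrum {f : ℝ → ℝ} (hf : Integrable f) (hψ : IsBandLimitedFilter ψ ψhat A)
    (ha : 0 < a) (b : ℝ) : MemLp (filterSpectrum ψhat a b) 2 (spectralMeasure f) := by
  have := isFiniteMeasure_spectralMeasure hf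
  obtain ⟨M, hM0, hM⟩ := exists_norm_le_of_boundedVariation hψ.A_pos.le hψ.boundedVariation
    hψ.support_subset
  refine MemLp.of_bound ((aestronglyMeasurable_filterSpectrum hψ.fourier.1.1 ha b).mono_ac
    (withDensity_absolutelyContinuous _ _)) (√a * M) (ae_of_all _ fun u => ?_)
  rw [filterSpectrum, norm_mul, norm_filterSpectrum_prefactor]
  exact mul_le_mul_of_nonneg_left (hM _) (Real.sqrt_nonneg a)

theorem memLp_angularFourier_spectralMeasure {f : ℝ → ℝ} (hf : Integrable f) {φ : ℝ → ℝ}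
    (hφ : Integrable φ) :
    MemLp (angularFourier fun t => (φ t : ℂ)) 2 (spectralMeasure f) := by
  have := isFiniteMeasure_spectralMeasure hf
  exact MemLp.of_bound (continuous_angularFourier hφ.ofReal).aestronglyMeasurable _
    (ae_of_all _ fun u => norm_angularFourier_le _ u)

/-- For `a > 2 A` the truncated transforms converge in the spectral space: near the singularities
`± s₀` of `f` the rescaled truncated transforms stay bounded, elsewhere `f` is bounded. -/
theorem tendsto_eLpNorm_angularFourier_filterWeight {f : ℝ → ℝ} {M : ℝ} (hf : Integrable f)
    (hfM : ∀ u, |u| ≤ 1 / 2 → f u ≤ M) (hψ : IsBandLimitedFilter ψ ψhat A) (ha : 2 * A < a)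
    (b : ℝ) : Tendsto (fun p : ℝ × ℝ => eLpNorm ((angularFourier fun t =>
      (filterWeight ψ a b p t : ℂ)) - filterSpectrum ψhat a b) 2 (spectralMeasure f))
      atTop (𝓝 0) := by
  have ha0 : 0 < a := by linarith [hψ.A_pos]
  have hp : Tendsto (fun p : ℝ × ℝ => ((p.1 + b) / a, (p.2 - b) / a)) atTop atTop := by
    rw [← prod_atTop_atTop_eq]
    exact ((tendsto_atTop_add_const_right _ b tendsto_fst).atTop_div_const ha0).prodMk
      ((tendsto_atTop_add_const_right _ (-b) tendsto_snd).atTop_div_const ha0)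
  have hpos : ∀ᶠ p : ℝ × ℝ in atTop, 0 ≤ p.1 ∧ 0 ≤ p.2 := by
    filter_upwards [eventually_ge_atTop (0 : ℝ × ℝ)] with p h using ⟨h.1, h.2⟩
  obtain ⟨C, hC⟩ := exists_norm_truncFourier_le hψ (show A < a / 2 by linarith)
  set G : ℝ × ℝ → ℝ → ℂ := fun p => (angularFourier fun t =>
      (filterWeight ψ a b p t : ℂ)) - filterSpectrum ψhat a b with hG
  have hGm : ∀ p, AEStronglyMeasurable (G p) volume := fun p =>
    (continuous_angularFourier (integrable_filterWeight hψ.memLp ha0 b p).ofReal).aestronglyMeasurable.sub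
      (aestronglyMeasurable_filterSpectrum hψ.fourier.1.1 ha0 b)
  have hGe : ∀ᶠ p in atTop, ∀ u, G p u = √a * Complex.exp (-(Complex.I * u * b))
      * (truncFourier ψ ((p.1 + b) / a) ((p.2 - b) / a) - ψhat) (a * u) := by
    filter_upwards [hpos] with p ⟨h1, h2⟩ u
    change angularFourier _ u - filterSpectrum ψhat a b u = _
    rw [angularFourier_filterWeight ha0 b (by linarith), filterSpectrum,
      Pi.sub_apply]
    ring
  have hG2 : Tendsto (fun p => ∫⁻ u, ‖G p u‖ₑ ^ 2) atTop (𝓝 0) := by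
    have h1 := (ENNReal.continuous_rpow_const (y := (2 : ℝ))).tendsto 0 |>.comp
      ((tendsto_truncFourier hψ.memLp hψ.fourier).comp hp)
    rw [ENNReal.zero_rpow_of_pos (by norm_num)] at h1
    refine h1.congr' ?_
    filter_upwards [hGe] with p hpe
    simp only [Function.comp_apply]
    rw [eLpNorm_eq_lintegral_rpow_enorm_toReal two_ne_zero ENNReal.ofNat_ne_top, ← ENNReal.rpow_mul]
    simp only [ENNReal.toReal_ofNat, ENNReal.rpow_two, one_div, isUnit_iff_ne_zero, ne_eq,
      OfNat.ofNat_ne_zero, not_false_eq_true, IsUnit.inv_mul_cancel, ENNReal.rpow_one]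
    rw [← lintegral_comp_mul_left_mul (a := a) ha0]
    refine lintegral_congr fun u => ?_
    rw [hpe u, enorm_mul, mul_pow]
    congr 1
    rw [← ofReal_norm, norm_filterSpectrum_prefactor, ← ENNReal.ofReal_pow (Real.sqrt_nonneg _),
      Real.sq_sqrt ha0.le]
  have hGb : ∀ᶠ p in atTop, ∀ u, M < f u → ‖G p u‖ ≤ √a * C := by
    filter_upwards [hGe, hp.eventually_ge_atTop 0] with p hpe hp0 u hu
    have hu2 : 1 / 2 < |u| := by
      by_contra! h
      exact absurd (hfM u h) hu.not_ge
    have hau : a / 2 ≤ |a * u| := by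
      rw [abs_mul, abs_of_pos ha0]
      nlinarith
    have hz : ψhat (a * u) = 0 := by
      by_contra h
      have := abs_le.2 (hψ.support_subset h)
      linarith
    rw [hpe u, norm_mul, norm_filterSpectrum_prefactor, Pi.sub_apply, hz, sub_zero]
    exact mul_le_mul_of_nonneg_left (hC _ _ hp0.1 hp0.2 _ hau) (Real.sqrt_nonneg a)
  have key := tendsto_lintegral_sq_mul_weight hf hG2 (Eventually.of_forall hGm) hGb
  have h2 := (ENNReal.continuous_rpow_const (y := (1 / 2 : ℝ))).tendsto 0 |>.comp key
  rw [ENNReal.zero_rpow_of_pos (by norm_num)] at h2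
  refine h2.congr fun p => ?_
  rw [eLpNorm_eq_lintegral_rpow_enorm_toReal two_ne_zero ENNReal.ofNat_ne_top, spectralMeasure,
    lintegral_withDensity_eq_lintegral_mul₀ hf.1.aemeasurable.ennreal_ofReal
      ((hGm p).enorm.pow_const _)]
  simp only [Function.comp_apply, ENNReal.toReal_ofNat, ENNReal.rpow_two, Pi.mul_apply, mul_comm]

variable {Ω : Type*} [MeasurableSpace Ω] {P : Measure Ω} [IsProbabilityMeasure P] {X : ℝ → Ω → ℝ}
  {f : ℝ → ℝ}

open scoped ComplexConjugate in
theorem inner_toLp_pathIntegral (hX : IsGaussianWithSpectralDensity P X f) {φ χ : ℝ → ℝ}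
    (hφ : Integrable φ) (hχ : Integrable χ) :
    ((inner ℝ ((hX.memLp_pathIntegral hφ).toLp _) ((hX.memLp_pathIntegral hχ).toLp _) : ℝ) : ℂ)
      = inner ℂ ((memLp_angularFourier_spectralMeasure hX.density_integrable hφ).toLp _)
          ((memLp_angularFourier_spectralMeasure hX.density_integrable hχ).toLp _) := by
  have e1 : (inner ℝ ((hX.memLp_pathIntegral hφ).toLp _) ((hX.memLp_pathIntegral hχ).toLp _) : ℝ)
      = ∫ ω, pathIntegral X φ ω * pathIntegral X χ ω ∂P := by
    rw [inner_eq_integral_mul]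
    refine integral_congr_ae ?_
    filter_upwards [(hX.memLp_pathIntegral hφ).coeFn_toLp, (hX.memLp_pathIntegral hχ).coeFn_toLp]
      with ω h h'
    rw [h, h']
  rw [e1, hX.integral_pathIntegral_mul_pathIntegral hφ hχ, L2.inner_def,
    ← integral_spectralMeasure hX.density_integrable hX.density_nonneg
      (fun u => conj (angularFourier (fun t => (φ t : ℂ)) u) *
        angularFourier (fun t => (χ t : ℂ)) u)]
  refine integral_congr_ae ?_
  filter_upwards [(memLp_angularFourier_spectralMeasure hX.density_integrable hφ).coeFn_toLp,
    (memLp_angularFourier_spectralMeasure hX.density_integrable hχ).coeFn_toLp] with u h h'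
  rw [h, h', RCLike.inner_apply, mul_comm]

/-- Distances in a real and a complex inner product space agree when the Gram matrices of the two
pairs of points have the same real part. -/
theorem dist_eq_of_inner_eq {E F : Type*} [NormedAddCommGroup E] [InnerProductSpace ℝ E]
    [NormedAddCommGroup F] [InnerProductSpace ℂ F] {y₁ y₂ : E} {z₁ z₂ : F}
    (h₁ : inner ℝ y₁ y₁ = RCLike.re (inner ℂ z₁ z₁))
    (h₁₂ : inner ℝ y₁ y₂ = RCLike.re (inner ℂ z₁ z₂))
    (h₂ : inner ℝ y₂ y₂ = RCLike.re (inner ℂ z₂ z₂)) : dist y₁ y₂ = dist z₁ z₂ := by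
  rw [dist_eq_norm, dist_eq_norm, ← sq_eq_sq₀ (norm_nonneg _) (norm_nonneg _), norm_sub_sq_real,
    @norm_sub_sq ℂ, ← real_inner_self_eq_norm_sq, ← real_inner_self_eq_norm_sq, h₁, h₁₂, h₂,
    inner_self_eq_norm_sq, inner_self_eq_norm_sq]

theorem inner_toLp_pathIntegral_eq_re (hX : IsGaussianWithSpectralDensity P X f) {φ χ : ℝ → ℝ}
    (hφ : Integrable φ) (hχ : Integrable χ) :
    inner ℝ ((hX.memLp_pathIntegral hφ).toLp _) ((hX.memLp_pathIntegral hχ).toLp _)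
      = RCLike.re (inner ℂ ((memLp_angularFourier_spectralMeasure hX.density_integrable hφ).toLp _)
          ((memLp_angularFourier_spectralMeasure hX.density_integrable hχ).toLp _)) := by
  rw [← inner_toLp_pathIntegral hX hφ hχ]
  exact (Complex.ofReal_re _).symm

theorem dist_toLp_pathIntegral (hX : IsGaussianWithSpectralDensity P X f) {φ χ : ℝ → ℝ}
    (hφ : Integrable φ) (hχ : Integrable χ) :
    dist ((hX.memLp_pathIntegral hφ).toLp _) ((hX.memLp_pathIntegral hχ).toLp _)
      = dist ((memLp_angularFourier_spectralMeasure hX.density_integrable hφ).toLp _)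
          ((memLp_angularFourier_spectralMeasure hX.density_integrable hχ).toLp _) :=
  dist_eq_of_inner_eq (inner_toLp_pathIntegral_eq_re hX hφ hφ)
    (inner_toLp_pathIntegral_eq_re hX hφ hχ) (inner_toLp_pathIntegral_eq_re hX hχ hχ)

theorem tendsto_toLp_angularFourier {P : Measure Ω} (hX : IsGaussianWithSpectralDensity P X f)
    (hψ : IsBandLimitedFilter ψ ψhat A) {M : ℝ} (hfM : ∀ u, |u| ≤ 1 / 2 → f u ≤ M)
    (ha0 : 0 < a) (ha : 2 * A < a) (b : ℝ) :
    Tendsto (fun p => (memLp_angularFourier_spectralMeasure hX.density_integrable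
      (integrable_filterWeight hψ.memLp ha0 b p)).toLp _) atTop
      (𝓝 ((memLp_filterSpectrum hX.density_integrable hψ ha0 b).toLp _)) := by
  rw [Lp.tendsto_Lp_iff_tendsto_eLpNorm'']
  exact tendsto_eLpNorm_angularFourier_filterWeight hX.density_integrable hfM hψ ha b

/-- The truncated filter integrals are Cauchy in `L²(P)`, being isometric to their Fourier transforms,
which converge in `L²(f(u) du)`. -/
theorem exists_isFilterTransform (hX : IsGaussianWithSpectralDensity P X f)
    (hψ : IsBandLimitedFilter ψ ψhat A) {M : ℝ} (hfM : ∀ u, |u| ≤ 1 / 2 → f u ≤ M)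
    (ha : 2 * A < a) (b : ℝ) : ∃ d, IsFilterTransform P X ψ a b d := by
  have ha0 : 0 < a := by linarith [hψ.A_pos]
  have hI := integrable_filterWeight hψ.memLp ha0 b
  have hc : Cauchy (map (fun p => (hX.memLp_pathIntegral (hI p)).toLp _) atTop) := by
    rw [cauchy_map_iff']
    have h := (cauchy_map_iff'.1 (tendsto_toLp_angularFourier hX hψ hfM ha0 ha b).cauchy_map)
    rw [tendsto_uniformity_iff_dist_tendsto_zero] at h ⊢
    exact h.congr fun p => (dist_toLp_pathIntegral hX (hI p.1) (hI p.2)).symm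
  obtain ⟨D, hD⟩ := cauchy_map_iff_exists_tendsto.1 hc
  refine ⟨D, (Lp.stronglyMeasurable D).measurable, Lp.memLp D, ?_⟩
  rw [Lp.tendsto_Lp_iff_tendsto_eLpNorm'] at hD
  refine hD.congr' ?_
  filter_upwards [eventually_ge_atTop (0 : ℝ × ℝ)] with p hp
  refine eLpNorm_congr_ae ?_
  filter_upwards [(hX.memLp_pathIntegral (hI p)).coeFn_toLp] with ω hω
  have h1 : (0 : ℝ) ≤ p.1 := hp.1
  have h2 : (0 : ℝ) ≤ p.2 := hp.2
  rw [Pi.sub_apply, hω, pathIntegral_filterWeight X b (by linarith)]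

theorem IsFilterTransform.tendsto_toLp (hX : IsGaussianWithSpectralDensity P X f)
    (hψ : IsBandLimitedFilter ψ ψhat A) (ha0 : 0 < a) {b : ℝ} {d : Ω → ℝ}
    (hd : IsFilterTransform P X ψ a b d) :
    Tendsto (fun p => (hX.memLp_pathIntegral (integrable_filterWeight hψ.memLp ha0 b p)).toLp _)
      atTop (𝓝 (hd.2.1.toLp d)) := by
  rw [Lp.tendsto_Lp_iff_tendsto_eLpNorm'']
  refine hd.2.2.congr' ?_
  filter_upwards [eventually_ge_atTop (0 : ℝ × ℝ)] with p hp
  have h1 : (0 : ℝ) ≤ p.1 := hp.1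
  have h2 : (0 : ℝ) ≤ p.2 := hp.2
  congr 1
  ext ω
  rw [Pi.sub_apply, pathIntegral_filterWeight X b (by linarith)]

theorem IsFilterTransform.toLp_mem (hX : IsGaussianWithSpectralDensity P X f)
    (hψ : IsBandLimitedFilter ψ ψhat A) (ha0 : 0 < a) {b : ℝ} {d : Ω → ℝ}
    (hd : IsFilterTransform P X ψ a b d) : hd.2.1.toLp d ∈ gaussianSpace hX.memLp_two :=
  (Submodule.isClosed_topologicalClosure _).mem_of_tendsto (hd.tendsto_toLp hX hψ ha0)
    (Eventually.of_forall fun p => hX.toLp_pathIntegral_mem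
      (integrable_filterWeight hψ.memLp ha0 b p))

/-- The covariance of two filter transforms at the same scale. The substitution `v = a u` absorbs the
factor `a` from the normalisation. -/
theorem IsFilterTransform.inner_toLp (hX : IsGaussianWithSpectralDensity P X f)
    (hψ : IsBandLimitedFilter ψ ψhat A) {M : ℝ} (hfM : ∀ u, |u| ≤ 1 / 2 → f u ≤ M)
    (ha : 2 * A < a) {b b' : ℝ} {d d' : Ω → ℝ}
    (hd : IsFilterTransform P X ψ a b d) (hd' : IsFilterTransform P X ψ a b' d') :
    inner ℝ (hd.2.1.toLp d) (hd'.2.1.toLp d')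
      = ∫ v, Real.cos (v * ((b - b') / a)) * (‖ψhat v‖ ^ 2 * f (v / a)) := by
  have ha0 : 0 < a := by linarith [hψ.A_pos]
  have h1 := (Complex.continuous_ofReal.tendsto _).comp
    ((hd.tendsto_toLp hX hψ ha0).inner (𝕜 := ℝ) (hd'.tendsto_toLp hX hψ ha0))
  have h2 := (tendsto_toLp_angularFourier hX hψ hfM ha0 ha b).inner (𝕜 := ℂ)
    (tendsto_toLp_angularFourier hX hψ hfM ha0 ha b')
  have h3 := tendsto_nhds_unique (h1.congr fun p => inner_toLp_pathIntegral hX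
    (integrable_filterWeight hψ.memLp ha0 b p) (integrable_filterWeight hψ.memLp ha0 b' p)) h2
  have hm := memLp_filterSpectrum hX.density_integrable hψ ha0 b
  have hm' := memLp_filterSpectrum hX.density_integrable hψ ha0 b'
  have h4 := congrArg (RCLike.re : ℂ → ℝ) h3
  rw [L2.inner_def (𝕜 := ℂ), ← integral_re (L2.integrable_inner _ _)] at h4
  have e1 : ∫ u, RCLike.re (inner ℂ (hm.toLp _ u) (hm'.toLp _ u)) ∂spectralMeasure f
      = ∫ u, a * (Real.cos (u * (b - b')) * ‖ψhat (a * u)‖ ^ 2) ∂spectralMeasure f := by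
    refine integral_congr_ae ?_
    filter_upwards [hm.coeFn_toLp, hm'.coeFn_toLp] with u hu hu'
    rw [hu, hu', RCLike.inner_apply, filterSpectrum, filterSpectrum]
    have e : (√a * Complex.exp (-(Complex.I * u * b')) * ψhat (a * u))
        * starRingEnd ℂ (√a * Complex.exp (-(Complex.I * u * b)) * ψhat (a * u))
        = ((a * ‖ψhat (a * u)‖ ^ 2 : ℝ) : ℂ) * Complex.exp ((u * (b - b') : ℝ) * Complex.I) := by
      rw [map_mul, map_mul, Complex.conj_ofReal, ← Complex.exp_conj]
      have e2 : (√a : ℂ) * √a = a := by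
        rw [← Complex.ofReal_mul, Real.mul_self_sqrt ha0.le]
      have e3 := Complex.mul_conj' (ψhat (a * u))
      have e4 : Complex.exp ((u * (b - b') : ℝ) * Complex.I) = Complex.exp (-(Complex.I * u * b'))
          * Complex.exp (starRingEnd ℂ (-(Complex.I * u * b))) := by
        rw [← Complex.exp_add]
        congr 1
        simp only [map_neg, map_mul, Complex.conj_I, Complex.conj_ofReal]
        push_cast
        ring
      rw [e4]
      push_cast
      rw [← e2, ← e3]
      ring
    rw [e]
    change (_ * _ : ℂ).re = _
    rw [Complex.re_ofReal_mul, Complex.exp_ofReal_mul_I_re]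
    ring
  rw [e1, spectralMeasure, integral_withDensity_eq_integral_toReal_smul₀
      hX.density_integrable.1.aemeasurable.ennreal_ofReal
      (ae_of_all _ fun u => ENNReal.ofReal_lt_top)] at h4
  have e5 := Measure.integral_comp_mul_left
    (fun v => Real.cos (v * ((b - b') / a)) * (‖ψhat v‖ ^ 2 * f (v / a))) a
  rw [abs_of_pos (inv_pos.2 ha0), smul_eq_mul, eq_inv_mul_iff_mul_eq₀ ha0.ne',
    ← integral_const_mul] at e5
  rw [← e5]
  refine Eq.trans ?_ (h4.trans ?_)
  · simp
  · refine integral_congr_ae (ae_of_all _ fun u => ?_)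
    simp only [smul_eq_mul]
    rw [ENNReal.toReal_ofReal (hX.density_nonneg u), mul_div_cancel_left₀ _ ha0.ne',
      show a * u * ((b - b') / a) = u * (b - b') by field_simp]
    ring

end FilterTransform

/-! ### The spectral density near the origin -/

/-- A bound `C |x| ^ k` for a derivative integrates to `C |x| ^ (k + 1)`; iterated, this gives Taylor
estimates with one-sided derivatives. -/
theorem abs_sub_le_mul_pow_succ {g g' : ℝ → ℝ} {r C : ℝ} {k : ℕ}
    (hg : ∀ x ∈ Icc (-r) r, HasDerivWithinAt g (g' x) (Icc (-r) r) x)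
    (hC : ∀ x ∈ Icc (-r) r, |g' x| ≤ C * |x| ^ k) :
    ∀ x ∈ Icc (-r) r, |g x - g 0| ≤ C * |x| ^ (k + 1) := by
  intro x hx
  have hxr : |x| ≤ r := abs_le.2 hx
  have hsub : Icc (-|x|) |x| ⊆ Icc (-r) r := Icc_subset_Icc (by linarith) hxr
  rcases eq_or_ne x 0 with rfl | hx0
  · simp
  have hC0 : 0 ≤ C := by
    have := (abs_nonneg _).trans (hC x hx)
    exact nonneg_of_mul_nonneg_left this (by positivity)
  have h := (convex_Icc (-|x|) |x|).norm_image_sub_le_of_norm_hasDerivWithin_le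
    (f := g) (f' := g') (C := C * |x| ^ k) (x := 0) (y := x)
    (fun y hy => (hg y (hsub hy)).mono hsub)
    (fun y hy => (hC y (hsub hy)).trans
      (mul_le_mul_of_nonneg_left (pow_le_pow_left₀ (abs_nonneg _) (abs_le.2 hy) k) hC0))
    ⟨by simp, abs_nonneg _⟩ ⟨neg_abs_le x, le_abs_self x⟩
  simpa [pow_succ, mul_assoc] using h

variable {f h : ℝ → ℝ} {s₀ α : ℝ}

theorem IsSeasonalSpectrum.hasDerivWithinAt (hf : IsSeasonalSpectrum f h s₀ α) {i : ℕ} (hi : i < 4)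
    {u : ℝ} (hu : u ∈ Icc (-(1 / 2) : ℝ) (1 / 2)) :
    HasDerivWithinAt (iteratedDerivWithin i h (Icc (-(1 / 2)) (1 / 2)))
      (iteratedDerivWithin (i + 1) h (Icc (-(1 / 2)) (1 / 2)) u) (Icc (-(1 / 2)) (1 / 2)) u := by
  rw [iteratedDerivWithin_succ]
  exact (hf.differentiable i hi u hu).hasDerivWithinAt

theorem IsSeasonalSpectrum.exists_abs_sub_one_le (hf : IsSeasonalSpectrum f h s₀ α) :
    ∃ C, 0 ≤ C ∧ ∀ u ∈ Icc (-(1 / 2) : ℝ) (1 / 2), |h u - 1| ≤ C * |u| ^ 3 := by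
  obtain ⟨C, hC⟩ := hf.deriv_bounded 3 (by simp)
  have h3 : ∀ u ∈ Icc (-(1 / 2) : ℝ) (1 / 2),
      |iteratedDerivWithin 3 h (Icc (-(1 / 2)) (1 / 2)) u| ≤ C * |u| ^ 0 := by simpa using hC
  have h2 := abs_sub_le_mul_pow_succ (fun x hx => hf.hasDerivWithinAt (i := 2) (by norm_num) hx) h3
  simp only [hf.deriv_zero 2 (by simp), sub_zero] at h2
  have h1 := abs_sub_le_mul_pow_succ (fun x hx => hf.hasDerivWithinAt (i := 1) (by norm_num) hx) h2
  simp only [hf.deriv_zero 1 (by simp), sub_zero] at h1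
  have h0 := abs_sub_le_mul_pow_succ (fun x hx => hf.hasDerivWithinAt (i := 0) (by norm_num) hx) h1
  simp only [iteratedDerivWithin_zero, hf.value_zero] at h0
  exact ⟨C, (abs_nonneg _).trans (hC 0 (by norm_num)), h0⟩

theorem IsSeasonalSpectrum.exists_lipschitz (hf : IsSeasonalSpectrum f h s₀ α) :
    ∃ C, 0 ≤ C ∧ ∀ u ∈ Icc (-(1 / 2) : ℝ) (1 / 2), ∀ w ∈ Icc (-(1 / 2) : ℝ) (1 / 2),
      |h u - h w| ≤ C * |u - w| := by
  obtain ⟨C, hC⟩ := hf.deriv_bounded 1 (by simp)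
  refine ⟨C, (abs_nonneg _).trans (hC 0 (by norm_num)), fun u hu w hw => ?_⟩
  refine (convex_Icc (-(1 / 2) : ℝ) (1 / 2)).norm_image_sub_le_of_norm_hasDerivWithin_le
    (f := h) (fun x hx => ?_) (fun x hx => hC x hx) hw hu
  simpa using hf.hasDerivWithinAt (i := 0) (by norm_num) hx

/-- The singular factor of the spectral density, as a function of `x = u²`. -/
noncomputable def singularFactor (s₀ α x : ℝ) : ℝ := (s₀ ^ 2 - x) ^ (-(2 * α))

theorem IsSeasonalSpectrum.eq_mul_singularFactor (hf : IsSeasonalSpectrum f h s₀ α) {u : ℝ}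
    (hu : u ∈ Icc (-(1 / 2) : ℝ) (1 / 2)) : f u = h u * singularFactor s₀ α (u ^ 2) := by
  have h1 : u ^ 2 ≤ s₀ ^ 2 := by
    have := hf.one_lt_s₀
    nlinarith [hu.1, hu.2]
  rw [hf.density_eq, abs_sub_comm, abs_of_nonneg (by linarith), singularFactor,
    Real.rpow_neg (by linarith), div_eq_mul_inv]

theorem hasDerivAt_rpow_sub {c x p : ℝ} (hx : x < c) :
    HasDerivAt (fun x => (c - x) ^ p) (-p * (c - x) ^ (p - 1)) x := by
  have := ((hasDerivAt_id x).const_sub c).rpow_const (p := p) (Or.inl (sub_pos.2 hx).ne')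
  exact this.congr_deriv (by simp)

/-- Expansion of the singular factor at the origin. -/
theorem exists_singularFactor_bounds (hs : 1 < s₀) (α : ℝ) : ∃ K, 0 ≤ K ∧
    (∀ x ∈ Icc (-(1 / 4) : ℝ) (1 / 4), |singularFactor s₀ α x| ≤ K) ∧
    (∀ x ∈ Icc (-(1 / 4) : ℝ) (1 / 4), ∀ y ∈ Icc (-(1 / 4) : ℝ) (1 / 4),
      |singularFactor s₀ α x - singularFactor s₀ α y| ≤ K * |x - y|) ∧
    ∀ x ∈ Icc (-(1 / 4) : ℝ) (1 / 4), |singularFactor s₀ α x - s₀ ^ (-4 * α)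
      - 2 * (α * s₀ ^ (-4 * α - 2)) * x| ≤ K * |x| ^ 2 := by
  have hs0 : 0 < s₀ := by linarith
  have hlt : ∀ x ∈ Icc (-(1 / 4) : ℝ) (1 / 4), x < s₀ ^ 2 := fun x hx => by nlinarith [hx.2]
  have hcont : ∀ p : ℝ, ContinuousOn (fun x => (s₀ ^ 2 - x) ^ p) (Icc (-(1 / 4) : ℝ) (1 / 4)) :=
    fun p x hx => (hasDerivAt_rpow_sub (hlt x hx)).continuousAt.continuousWithinAt
  obtain ⟨K₀, hK₀⟩ := isCompact_Icc.exists_bound_of_continuousOn (hcont (-(2 * α)))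
  obtain ⟨K₁, hK₁⟩ := isCompact_Icc.exists_bound_of_continuousOn
    ((hcont (-(2 * α) - 1)).const_mul (-(-(2 * α))))
  obtain ⟨K₂, hK₂⟩ := isCompact_Icc.exists_bound_of_continuousOn
    (((hcont (-(2 * α) - 1 - 1)).const_mul (-(-(2 * α) - 1))).const_mul (-(-(2 * α))))
  have h0mem : (0 : ℝ) ∈ Icc (-(1 / 4) : ℝ) (1 / 4) := by norm_num
  have hK₀' := (norm_nonneg _).trans (hK₀ 0 h0mem)
  have hK₁' := (norm_nonneg _).trans (hK₁ 0 h0mem)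
  have hK₂' := (norm_nonneg _).trans (hK₂ 0 h0mem)
  have hv0 : singularFactor s₀ α 0 = s₀ ^ (-4 * α) := by
    rw [singularFactor, sub_zero, ← Real.rpow_natCast s₀ 2, ← Real.rpow_mul hs0.le]
    congr 1
    push_cast
    ring
  have hv1 : -(-(2 * α)) * (s₀ ^ 2 - 0) ^ (-(2 * α) - 1) = 2 * (α * s₀ ^ (-4 * α - 2)) := by
    rw [sub_zero, ← Real.rpow_natCast s₀ 2, ← Real.rpow_mul hs0.le,
      show ((2 : ℕ) : ℝ) * (-(2 * α) - 1) = -4 * α - 2 by push_cast; ring]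
    ring
  refine ⟨K₀ + K₁ + K₂, by linarith, fun x hx => (hK₀ x hx).trans (by linarith),
    fun x hx y hy => ?_, fun x hx => ?_⟩
  · refine ((convex_Icc _ _).norm_image_sub_le_of_norm_hasDerivWithin_le
      (f := singularFactor s₀ α)
      (fun z hz => (hasDerivAt_rpow_sub (hlt z hz)).hasDerivWithinAt) hK₁ hy hx).trans ?_
    rw [Real.norm_eq_abs]
    gcongr
    linarith
  · have hd1 := abs_sub_le_mul_pow_succ (k := 0) (r := 1 / 4)
      (g := fun x => -(-(2 * α)) * (s₀ ^ 2 - x) ^ (-(2 * α) - 1))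
      (fun z hz => ((hasDerivAt_rpow_sub (hlt z hz)).const_mul _).hasDerivWithinAt)
      (by simpa using hK₂)
    have hd0 := abs_sub_le_mul_pow_succ (k := 1) (r := 1 / 4)
      (g := fun x => singularFactor s₀ α x - 2 * (α * s₀ ^ (-4 * α - 2)) * x)
      (fun z hz => ((hasDerivAt_rpow_sub (hlt z hz)).sub
        ((hasDerivAt_id z).const_mul (2 * (α * s₀ ^ (-4 * α - 2))))).hasDerivWithinAt)
      (fun z hz => by simpa only [hv1, mul_one, zero_add] using hd1 z hz) x hx
    rw [hv0, mul_zero, sub_zero] at hd0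
    rw [sub_right_comm]
    refine hd0.trans ?_
    gcongr
    linarith

theorem sq_mem_Icc_quarter {u : ℝ} (hu : u ∈ Icc (-(1 / 2) : ℝ) (1 / 2)) :
    u ^ 2 ∈ Icc (-(1 / 4) : ℝ) (1 / 4) :=
  ⟨by nlinarith [sq_nonneg u], by nlinarith [hu.1, hu.2]⟩

/-- Boundedness, Lipschitz continuity and second order expansion of the spectral density on
`[-1/2, 1/2]`. -/
theorem IsSeasonalSpectrum.exists_bounds (hf : IsSeasonalSpectrum f h s₀ α) : ∃ K, 0 ≤ K ∧
    (∀ u ∈ Icc (-(1 / 2) : ℝ) (1 / 2), |f u| ≤ K) ∧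
    (∀ u ∈ Icc (-(1 / 2) : ℝ) (1 / 2), ∀ w ∈ Icc (-(1 / 2) : ℝ) (1 / 2),
      |f u - f w| ≤ K * |u - w|) ∧
    ∀ u ∈ Icc (-(1 / 2) : ℝ) (1 / 2), |f u - s₀ ^ (-4 * α)
      - 2 * (α * s₀ ^ (-4 * α - 2)) * u ^ 2| ≤ K * |u| ^ 3 := by
  obtain ⟨K, hK0, hKb, hKl, hKe⟩ := exists_singularFactor_bounds hf.one_lt_s₀ α
  obtain ⟨C, hC0, hC⟩ := hf.exists_abs_sub_one_le
  obtain ⟨L, hL0, hL⟩ := hf.exists_lipschitz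
  obtain ⟨H, hH⟩ := hf.bounded
  have hH0 : 0 ≤ H := (hf.nonneg 0).trans (hH 0)
  have hha : ∀ u, |h u| ≤ H := fun u => by rw [abs_of_nonneg (hf.nonneg u)]; exact hH u
  refine ⟨H * K + L * K + C * K + K, by positivity, fun u hu => ?_, fun u hu w hw => ?_,
    fun u hu => ?_⟩
  · rw [hf.eq_mul_singularFactor hu, abs_mul]
    have := mul_le_mul (hha u) (hKb _ (sq_mem_Icc_quarter hu)) (abs_nonneg _) hH0
    have : 0 ≤ L * K + C * K + K := by positivity
    linarith
  · have hu2 := sq_mem_Icc_quarter hu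
    have hw2 := sq_mem_Icc_quarter hw
    have hsq : |u ^ 2 - w ^ 2| ≤ |u - w| := by
      rw [sq_sub_sq, abs_mul]
      exact mul_le_of_le_one_left (abs_nonneg _)
        (abs_le.2 ⟨by linarith [hu.1, hw.1], by linarith [hu.2, hw.2]⟩)
    rw [hf.eq_mul_singularFactor hu, hf.eq_mul_singularFactor hw,
      show h u * singularFactor s₀ α (u ^ 2) - h w * singularFactor s₀ α (w ^ 2)
        = h u * (singularFactor s₀ α (u ^ 2) - singularFactor s₀ α (w ^ 2))
          + (h u - h w) * singularFactor s₀ α (w ^ 2) by ring]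
    have i1 : |h u| * |singularFactor s₀ α (u ^ 2) - singularFactor s₀ α (w ^ 2)|
        ≤ H * (K * |u - w|) :=
      mul_le_mul (hha u) ((hKl _ hu2 _ hw2).trans (by gcongr)) (abs_nonneg _) hH0
    have i2 : |h u - h w| * |singularFactor s₀ α (w ^ 2)| ≤ L * |u - w| * K :=
      mul_le_mul (hL u hu w hw) (hKb _ hw2) (abs_nonneg _) (by positivity)
    have i3 : 0 ≤ (C * K + K) * |u - w| := by positivity
    refine (abs_add_le _ _).trans ?_
    rw [abs_mul, abs_mul]
    linarith
  · have hu2 := sq_mem_Icc_quarter hu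
    have hu1 : |u| ≤ 1 := (abs_le.2 hu).trans (by norm_num)
    rw [hf.eq_mul_singularFactor hu,
      show h u * singularFactor s₀ α (u ^ 2) - s₀ ^ (-4 * α)
          - 2 * (α * s₀ ^ (-4 * α - 2)) * u ^ 2
        = (h u - 1) * singularFactor s₀ α (u ^ 2) + (singularFactor s₀ α (u ^ 2) - s₀ ^ (-4 * α)
          - 2 * (α * s₀ ^ (-4 * α - 2)) * u ^ 2) by ring]
    have i1 : |h u - 1| * |singularFactor s₀ α (u ^ 2)| ≤ C * |u| ^ 3 * K :=
      mul_le_mul (hC u hu) (hKb _ hu2) (abs_nonneg _) (by positivity)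
    have i2 : K * |u ^ 2| ^ 2 ≤ K * |u| ^ 3 := by
      rw [abs_pow, ← pow_mul]
      gcongr ?_ * ?_
      exact pow_le_pow_of_le_one (abs_nonneg _) hu1 (by norm_num)
    have i3 : 0 ≤ (H * K + L * K) * |u| ^ 3 := by positivity
    refine (abs_add_le _ _).trans ?_
    rw [abs_mul]
    linarith [hKe _ hu2]

/-! ### Moments of the filter transforms -/

section Filter

variable {ψ : ℝ → ℝ} {ψhat : ℝ → ℂ} {A : ℝ}

theorem IsBandLimitedFilter.integrable_mul_sq (hψ : IsBandLimitedFilter ψ ψhat A) {g : ℝ → ℝ}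
    (hg : Continuous g) : Integrable fun v => g v * ‖ψhat v‖ ^ 2 := by
  have h1 : IntegrableOn (fun v => ‖ψhat v‖ ^ 2) (Icc (-A) A) :=
    ((memLp_two_iff_integrable_sq_norm hψ.fourier.1.1).1 hψ.fourier.1).integrableOn
  refine (integrableOn_iff_integrable_of_support_subset fun v hv => ?_).1
    (h1.continuousOn_mul hg.continuousOn isCompact_Icc)
  refine hψ.support_subset fun h0 => hv ?_
  simp [h0]

/-- Weights positive off the origin have positive integrals against `|ψhat|²`, as `ψhat` is not almost
everywhere zero. -/
theorem IsBandLimitedFilter.integral_mul_sq_pos (hψ : IsBandLimitedFilter ψ ψhat A)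
    (hne : ¬ ψ =ᵐ[volume] 0) {g : ℝ → ℝ} (hg : Continuous g) (hg0 : ∀ v, v ≠ 0 → 0 < g v) :
    0 < ∫ v, g v * ‖ψhat v‖ ^ 2 := by
  have hae : ∀ᵐ v : ℝ, v ≠ 0 := by simp [ae_iff]
  have h0 : 0 ≤ᵐ[volume] fun v => g v * ‖ψhat v‖ ^ 2 := by
    filter_upwards [hae] with v hv
    exact mul_nonneg (hg0 v hv).le (by positivity)
  refine lt_of_le_of_ne (integral_nonneg_of_ae h0) fun h => ?_
  have h2 := (integral_eq_zero_iff_of_nonneg_ae h0 (hψ.integrable_mul_sq hg)).1 h.symm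
  refine fourierTransformL2_ne_zero hψ.memLp hψ.fourier hne ?_
  filter_upwards [hae, h2] with v hv hv2
  simpa [(hg0 v hv).ne'] using hv2

theorem IsBandLimitedFilter.c₂_pos (hψ : IsBandLimitedFilter ψ ψhat A)
    (hne : ¬ ψ =ᵐ[volume] 0) : 0 < c₂ ψhat := by
  simpa [c₂] using hψ.integral_mul_sq_pos hne (g := fun _ => 1) continuous_const
    fun _ _ => one_pos

theorem IsBandLimitedFilter.c₃_pos (hψ : IsBandLimitedFilter ψ ψhat A)
    (hne : ¬ ψ =ᵐ[volume] 0) : 0 < c₃ ψhat :=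
  mul_pos two_pos (hψ.integral_mul_sq_pos hne (g := fun v => v ^ 2) (by fun_prop)
    fun _ hv => by positivity)

/-- The common second moment of the filter transforms at scale `a`. -/
noncomputable def filterVariance (ψhat : ℝ → ℂ) (f : ℝ → ℝ) (a : ℝ) : ℝ :=
  ∫ v, ‖ψhat v‖ ^ 2 * f (v / a)

theorem div_mem_Icc_half {a v : ℝ} (hA : 0 < A) (ha : 2 * A < a) (hv : v ∈ Icc (-A) A) :
    v / a ∈ Icc (-(1 / 2) : ℝ) (1 / 2) := by
  have ha0 : 0 < a := by linarith
  constructor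
  · rw [le_div_iff₀ ha0]; linarith [hv.1]
  · rw [div_le_iff₀ ha0]; linarith [hv.2]

theorem aestronglyMeasurable_comp_div (hfi : AEStronglyMeasurable f volume) {a : ℝ} (ha : a ≠ 0) :
    AEStronglyMeasurable (fun v => f (v / a)) volume := by
  refine hfi.comp_quasiMeasurePreserving ⟨by fun_prop, ?_⟩
  simp only [div_eq_mul_inv]
  rw [Real.map_volume_mul_right (inv_ne_zero ha)]
  exact Measure.smul_absolutelyContinuous

/-- Expansion of the second moment as the scale goes to infinity. -/
theorem exists_filterVariance_expansion (hψ : IsBandLimitedFilter ψ ψhat A)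
    (hf : IsSeasonalSpectrum f h s₀ α) (hfi : Integrable f) : ∃ C, 0 ≤ C ∧ ∀ a, 2 * A < a →
      |filterVariance ψhat f a - c₂ ψhat * s₀ ^ (-4 * α)
        - c₃ ψhat * (α * s₀ ^ (-4 * α - 2)) * a ^ (-2 : ℤ)| ≤ C * a ^ (-3 : ℤ) := by
  obtain ⟨K, hK0, hKb, -, hKe⟩ := hf.exists_bounds
  refine ⟨K * ∫ v, |v| ^ 3 * ‖ψhat v‖ ^ 2, mul_nonneg hK0 (integral_nonneg fun v => by positivity),
    fun a ha => ?_⟩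
  have ha0 : 0 < a := by linarith [hψ.A_pos]
  have hz : ∀ v, v ∉ Icc (-A) A → ψhat v = 0 := fun v hv =>
    by_contra fun h0 => hv (hψ.support_subset h0)
  set U := s₀ ^ (-4 * α)
  set V := α * s₀ ^ (-4 * α - 2)
  have i0 : Integrable fun v => ‖ψhat v‖ ^ 2 * f (v / a) := by
    refine Integrable.mono' ((hψ.integrable_mul_sq (g := fun _ => K) continuous_const))
      ((hψ.fourier.1.1.norm.pow 2).mul (aestronglyMeasurable_comp_div hfi.1 ha0.ne'))
      (ae_of_all _ fun v => ?_)
    by_cases hv : v ∈ Icc (-A) A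
    · rw [norm_mul, Real.norm_of_nonneg (by positivity), mul_comm]
      exact mul_le_mul_of_nonneg_right (hKb _ (div_mem_Icc_half hψ.A_pos ha hv)) (by positivity)
    · simp [hz v hv]
  have i1 := hψ.integrable_mul_sq (g := fun _ => U) continuous_const
  have i2 := hψ.integrable_mul_sq (g := fun v => 2 * V * a ^ (-2 : ℤ) * v ^ 2) (by fun_prop)
  have i01 : Integrable fun v => ‖ψhat v‖ ^ 2 * f (v / a) - U * ‖ψhat v‖ ^ 2 := i0.sub i1
  have e : filterVariance ψhat f a - c₂ ψhat * U - c₃ ψhat * V * a ^ (-2 : ℤ)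
      = ∫ v, (‖ψhat v‖ ^ 2 * f (v / a) - U * ‖ψhat v‖ ^ 2
          - 2 * V * a ^ (-2 : ℤ) * v ^ 2 * ‖ψhat v‖ ^ 2) := by
    rw [integral_sub i01 i2, integral_sub i0 i1, filterVariance, c₂, c₃, integral_const_mul]
    simp only [mul_assoc (2 * V * a ^ (-2 : ℤ))]
    rw [integral_const_mul]
    ring
  rw [e, mul_right_comm K, ← integral_const_mul, ← Real.norm_eq_abs]
  refine norm_integral_le_of_norm_le
    ((hψ.integrable_mul_sq (g := fun v => |v| ^ 3) (by fun_prop)).const_mul _)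
    (ae_of_all _ fun v => ?_)
  by_cases hv : v ∈ Icc (-A) A
  · have h1 := hKe _ (div_mem_Icc_half hψ.A_pos ha hv)
    rw [show ‖ψhat v‖ ^ 2 * f (v / a) - U * ‖ψhat v‖ ^ 2
        - 2 * V * a ^ (-2 : ℤ) * v ^ 2 * ‖ψhat v‖ ^ 2
        = ‖ψhat v‖ ^ 2 * (f (v / a) - U - 2 * V * (v / a) ^ 2) by
      rw [zpow_neg, zpow_ofNat]; field_simp, norm_mul, Real.norm_of_nonneg (by positivity)]
    refine (mul_le_mul_of_nonneg_left h1 (by positivity)).trans (le_of_eq ?_)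
    rw [abs_div, abs_of_pos ha0, div_pow, zpow_neg, zpow_ofNat]
    field_simp
  · simp [hz v hv]

/-- Decay of the covariances of filter transforms at the same scale, uniformly in the scale. -/
theorem exists_abs_integral_cos_filter_le (hψ : IsBandLimitedFilter ψ ψhat A)
    (hf : IsSeasonalSpectrum f h s₀ α) (hfi : Integrable f) : ∃ C, 0 ≤ C ∧ ∀ a, 2 * A < a →
      ∀ x, x ≠ 0 → |∫ v, Real.cos (v * x) * (‖ψhat v‖ ^ 2 * f (v / a))| ≤ C / |x| := by
  obtain ⟨K, hK0, hKb, hKl, -⟩ := hf.exists_bounds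
  have hA := hψ.A_pos
  obtain ⟨C, hC0, hC⟩ := exists_abs_integral_cos_le hA.le hψ.fourier.1.1 hψ.boundedVariation
    hψ.support_subset hK0 (show 0 ≤ K / (2 * A) by positivity)
  refine ⟨C, hC0, fun a ha x hx => ?_⟩
  have ha0 : 0 < a := by linarith
  refine hC (fun v => f (v / a)) (aestronglyMeasurable_comp_div hfi.1 ha0.ne')
    (fun v hv => hKb _ (div_mem_Icc_half hA ha hv)) (fun v hv w hw => ?_) x hx
  refine (hKl _ (div_mem_Icc_half hA ha hv) _ (div_mem_Icc_half hA ha hw)).trans ?_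
  rw [← sub_div, abs_div, abs_of_pos ha0, mul_div_assoc', div_mul_eq_mul_div]
  gcongr

theorem exists_filterVariance_le (hψ : IsBandLimitedFilter ψ ψhat A)
    (hf : IsSeasonalSpectrum f h s₀ α) : ∃ C, 0 ≤ C ∧ ∀ a, 2 * A < a →
      |filterVariance ψhat f a| ≤ C := by
  obtain ⟨K, hK0, hKb, -, -⟩ := hf.exists_bounds
  refine ⟨∫ v, K * ‖ψhat v‖ ^ 2, integral_nonneg fun v => by positivity, fun a ha => ?_⟩
  rw [filterVariance, ← Real.norm_eq_abs]
  refine norm_integral_le_of_norm_le (hψ.integrable_mul_sq (g := fun _ => K) continuous_const)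
    (ae_of_all _ fun v => ?_)
  by_cases hv : v ∈ Icc (-A) A
  · rw [norm_mul, Real.norm_of_nonneg (by positivity), mul_comm]
    exact mul_le_mul_of_nonneg_right (hKb _ (div_mem_Icc_half hψ.A_pos ha hv)) (by positivity)
  · have : ψhat v = 0 := by_contra fun h0 => hv (hψ.support_subset h0)
    simp [this]

end Filter

/-! ### Fluctuations of the averaged squares -/

section Fluctuations

variable {Ω : Type*} [MeasurableSpace Ω] {P : Measure Ω} {X : ℝ → Ω → ℝ}
  {f h ψ : ℝ → ℝ} {ψhat : ℝ → ℂ} {s₀ α A : ℝ}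

theorem filterTransform_spec [IsProbabilityMeasure P] (hX : IsGaussianWithSpectralDensity P X f)
    (hψ : IsBandLimitedFilter ψ ψhat A) {M : ℝ} (hfM : ∀ u, |u| ≤ 1 / 2 → f u ≤ M) {a : ℝ}
    (ha : 2 * A < a) (b : ℝ) : IsFilterTransform P X ψ a b (filterTransform P X ψ a b) := by
  have hd := exists_isFilterTransform hX hψ hfM ha b
  rw [filterTransform, dif_pos hd]
  exact hd.choose_spec

theorem sum_one_div_int_sub_sq_le (s : Finset ℤ) (k : ℤ) :
    ∑ l ∈ s, 1 / ((k : ℝ) - l) ^ 2 ≤ ∑' n : ℤ, 1 / (n : ℝ) ^ 2 := by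
  have hs : Summable fun n : ℤ => 1 / (n : ℝ) ^ 2 :=
    Real.summable_one_div_int_pow.2 one_lt_two
  have hs' : Summable fun l : ℤ => 1 / ((k : ℝ) - l) ^ 2 := by
    simpa [Function.comp_def] using (Equiv.subLeft k).summable_iff.2 hs
  refine (hs'.sum_le_tsum s fun l _ => by positivity).trans_eq ?_
  simpa using (Equiv.subLeft k).tsum_eq fun n : ℤ => ((n : ℝ) ^ 2)⁻¹

/-- Variance bound for the first statistic: the squares decorrelate like `(a / (γ |k - l|))²`,
which is summable in `k - l`. -/
theorem exists_meanSquare_variance_le [IsProbabilityMeasure P]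
    (hX : IsGaussianWithSpectralDensity P X f) (hψ : IsBandLimitedFilter ψ ψhat A) (hf : IsSeasonalSpectrum f h s₀ α) :
    ∃ C, 0 ≤ C ∧ ∀ (a : ℕ → ℝ) (b : ℕ → ℤ → ℝ) (m : ℕ → ℕ) (j : ℕ) (γ : ℝ), 2 * A < a j →
      0 < m j → 0 < γ → (∀ k₁ k₂ : ℤ, |(k₁ : ℝ) - k₂| * γ ≤ |b j k₁ - b j k₂|) →
      Integrable (fun ω => (meanSquare P X ψ a b m j ω - filterVariance ψhat f (a j)) ^ 2) P ∧
      ∫ ω, (meanSquare P X ψ a b m j ω - filterVariance ψhat f (a j)) ^ 2 ∂P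
        ≤ C * (1 / m j + a j ^ 2 / (γ ^ 2 * m j)) := by
  obtain ⟨M, -, hM, -, -⟩ := hf.exists_bounds
  have hfM : ∀ u, |u| ≤ 1 / 2 → f u ≤ M := fun u hu => (le_abs_self _).trans (hM u (abs_le.1 hu))
  obtain ⟨C₁, hC₁, hv⟩ := exists_filterVariance_le hψ hf
  obtain ⟨C₂, hC₂, hc⟩ := exists_abs_integral_cos_filter_le hψ hf hX.density_integrable
  set T : ℝ := ∑' n : ℤ, 1 / (n : ℝ) ^ 2 with hT
  have hT0 : 0 ≤ T := tsum_nonneg fun n => by positivity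
  refine ⟨2 * C₁ ^ 2 + 2 * C₂ ^ 2 * T, by positivity, fun a b m j γ ha hm hγ hsep => ?_⟩
  have ha0 : 0 < a j := by linarith [hψ.A_pos]
  have hd := fun k => filterTransform_spec hX hψ hfM ha (b j k)
  set Z : ℤ → Lp ℝ 2 P := fun k => (hd k).2.1.toLp _ with hZ
  set S := Finset.Icc (1 : ℤ) (m j)
  have hm0 : (0 : ℝ) < m j := by exact_mod_cast hm
  have hcard : (S.card : ℝ) = m j := by simp [S]
  have hin : ∀ k l, inner ℝ (Z k) (Z l) = ∫ v, Real.cos (v * ((b j k - b j l) / a j))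
      * (‖ψhat v‖ ^ 2 * f (v / a j)) := fun k l => (hd k).inner_toLp hX hψ hfM ha (hd l)
  have hdiag : ∀ k, ‖Z k‖ ^ 2 = filterVariance ψhat f (a j) := fun k => by
    rw [← real_inner_self_eq_norm_sq, hin, filterVariance]
    simp
  -- the diagonal is bounded by the variance, off the diagonal the cosine transform decays
  have hpair : ∀ k l, 2 * inner ℝ (Z k) (Z l) ^ 2 ≤ (if k = l then 2 * C₁ ^ 2 else 0)
      + 2 * C₂ ^ 2 * (a j ^ 2 / γ ^ 2) * (1 / ((k : ℝ) - l) ^ 2) := fun k l => by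
    split_ifs with hkl
    · subst hkl
      rw [real_inner_self_eq_norm_sq, hdiag, ← sq_abs]
      have := pow_le_pow_left₀ (abs_nonneg _) (hv _ ha) 2
      have h2 : 0 ≤ 2 * C₂ ^ 2 * (a j ^ 2 / γ ^ 2) * (1 / ((k : ℝ) - k) ^ 2) := by positivity
      linarith
    · have hkl' : 0 < |(k : ℝ) - l| := abs_pos.2 (sub_ne_zero.2 (by exact_mod_cast hkl))
      have hb : 0 < |b j k - b j l| := (mul_pos hkl' hγ).trans_le (hsep k l)
      have h1 := hc _ ha ((b j k - b j l) / a j) (div_ne_zero (abs_pos.1 hb) ha0.ne')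
      rw [← hin, abs_div, abs_of_pos ha0] at h1
      have h2 : C₂ / (|b j k - b j l| / a j) ≤ C₂ / (|(k : ℝ) - l| * γ / a j) := by
        gcongr
        exact hsep k l
      have h3 := pow_le_pow_left₀ (abs_nonneg _) (h1.trans h2) 2
      rw [sq_abs, div_pow, div_pow, mul_pow, sq_abs] at h3
      rw [zero_add]
      refine (mul_le_mul_of_nonneg_left h3 zero_le_two).trans_eq ?_
      have : (k : ℝ) - l ≠ 0 := abs_pos.1 hkl'
      field_simp
  obtain ⟨hI, hE⟩ := integral_sum_sq_sub_sq_of_mem hX.gaussian hX.mean_zero hX.memLp_two S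
    (Z := Z) fun k _ => (hd k).toLp_mem hX hψ ha0
  have hae : (fun ω => (meanSquare P X ψ a b m j ω - filterVariance ψhat f (a j)) ^ 2)
      =ᵐ[P] fun ω => (1 / (m j : ℝ)) ^ 2 * (∑ k ∈ S, (Z k ω ^ 2 - ‖Z k‖ ^ 2)) ^ 2 := by
    have : ∀ᵐ ω ∂P, ∀ k, Z k ω = filterTransform P X ψ (a j) (b j k) ω :=
      ae_all_iff.2 fun k => (hd k).2.1.coeFn_toLp
    filter_upwards [this] with ω hω
    simp only [hω, hdiag, Finset.sum_sub_distrib, Finset.sum_const, nsmul_eq_mul, hcard,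
      meanSquare]
    rw [← mul_pow, mul_sub, ← mul_assoc _ (m j : ℝ), one_div_mul_cancel hm0.ne', one_mul]
  refine ⟨(hI.const_mul _).congr hae.symm, ?_⟩
  rw [integral_congr_ae hae, integral_const_mul, hE]
  have hrow : ∀ k ∈ S, ∑ l ∈ S, 2 * inner ℝ (Z k) (Z l) ^ 2
      ≤ 2 * C₁ ^ 2 + 2 * C₂ ^ 2 * (a j ^ 2 / γ ^ 2) * T := fun k hk => by
    refine (Finset.sum_le_sum fun l _ => hpair k l).trans ?_
    rw [Finset.sum_add_distrib, Finset.sum_ite_eq, if_pos hk, ← Finset.mul_sum]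
    gcongr
    exact sum_one_div_int_sub_sq_le S k
  refine (mul_le_mul_of_nonneg_left (Finset.sum_le_card_nsmul S _ _ hrow)
    (by positivity)).trans ?_
  rw [nsmul_eq_mul, hcard]
  have e : (1 / (m j : ℝ)) ^ 2 * (m j * (2 * C₁ ^ 2 + 2 * C₂ ^ 2 * (a j ^ 2 / γ ^ 2) * T))
      = 2 * C₁ ^ 2 * (1 / m j) + 2 * C₂ ^ 2 * T * (a j ^ 2 / (γ ^ 2 * m j)) := by
    field_simp
  rw [e, mul_add]
  have h1 : 0 ≤ 2 * C₂ ^ 2 * T := by positivity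
  gcongr
  · linarith
  · linarith [sq_nonneg C₁]

/-- If the normalised second moments are summable, the normalised sequence tends to zero almost
surely, since the sum of its squares is integrable. -/
theorem ae_tendsto_div_of_summable {Y : ℕ → Ω → ℝ} {v r : ℕ → ℝ} {J : ℕ}
    (hY : ∀ j ≥ J, Integrable (fun ω => Y j ω ^ 2) P ∧ ∫ ω, Y j ω ^ 2 ∂P ≤ v j)
    (hv : Summable fun j => v j / r j ^ 2) :
    ∀ᵐ ω ∂P, Tendsto (fun j => Y j ω / r j) atTop (𝓝 0) := by
  have hint : ∀ j, Integrable (fun ω => (Y (j + J) ω / r (j + J)) ^ 2) P := fun j => by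
    simp only [div_pow]
    exact (hY _ (Nat.le_add_left _ _)).1.div_const _
  have hfin : ∫⁻ ω, ∑' j, ENNReal.ofReal ((Y (j + J) ω / r (j + J)) ^ 2) ∂P ≠ ⊤ := by
    rw [lintegral_tsum fun j => (hint j).aemeasurable.ennreal_ofReal]
    refine ne_top_of_le_ne_top ((summable_nat_add_iff J).2 hv).tsum_ofReal_ne_top
      (ENNReal.tsum_le_tsum fun j => ?_)
    rw [← ofReal_integral_eq_lintegral_ofReal (hint j) (ae_of_all _ fun ω => sq_nonneg _)]
    simp only [div_pow]
    rw [integral_div]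
    gcongr
    exact (hY _ (Nat.le_add_left _ _)).2
  filter_upwards [ae_lt_top' (AEMeasurable.tsum
    fun j => (hint j).aemeasurable.ennreal_ofReal) hfin] with ω hω
  rw [← tendsto_add_atTop_iff_nat J]
  have h := ENNReal.tendsto_atTop_zero_of_tsum_ne_top hω.ne
  have h2 := (ENNReal.tendsto_toReal ENNReal.zero_ne_top).comp h
  simp only [Function.comp_def, ENNReal.toReal_ofReal (sq_nonneg _), ENNReal.toReal_zero] at h2
  have h3 := h2.sqrt
  simp only [Real.sqrt_sq_eq_abs, Real.sqrt_zero] at h3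
  exact tendsto_zero_iff_abs_tendsto_zero _ |>.2 h3

/-- An almost sure `O(ρ)` bound holds with a measurable random constant, uniformly in the index. -/
theorem exists_measurable_bound {s : ℕ → Ω → ℝ} (hs : ∀ j, AEMeasurable (s j) P) {L : ℝ}
    {ρ : ℕ → ℝ} (hρ : ∀ j, 0 < ρ j) (hO : ∀ᵐ ω ∂P, (fun j => s j ω - L) =O[atTop] ρ) :
    ∃ c : Ω → ℝ, Measurable c ∧ ∀ᵐ ω ∂P, ∀ j, |s j ω - L| ≤ c ω * ρ j := by
  refine ⟨fun ω => (⨆ j, ENNReal.ofReal (|(hs j).mk _ ω - L| / ρ j)).toReal, ?_, ?_⟩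
  · refine (Measurable.iSup fun j => ?_).ennreal_toReal
    have := (hs j).measurable_mk
    exact (((this.sub_const L).abs).div_const _).ennreal_ofReal
  filter_upwards [ae_all_iff.2 fun j => (hs j).ae_eq_mk, hO] with ω hω hb j
  obtain ⟨C, hC0, hC⟩ := Asymptotics.bound_of_isBigO_nat_atTop hb
  have hfin : (⨆ j, ENNReal.ofReal (|(hs j).mk _ ω - L| / ρ j)) ≠ ⊤ := by
    refine ne_top_of_le_ne_top (ENNReal.ofReal_ne_top (r := C)) (iSup_le fun i => ?_)
    have := hC (hρ i).ne'
    rw [Real.norm_eq_abs, Real.norm_of_nonneg (hρ i).le, hω i] at this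
    exact ENNReal.ofReal_le_ofReal ((div_le_iff₀ (hρ i)).2 this)
  rw [← div_le_iff₀ (hρ j), hω j]
  exact (ENNReal.ofReal_le_iff_le_toReal hfin).1
    (le_iSup (fun j => ENNReal.ofReal (|(hs j).mk _ ω - L| / ρ j)) j)

end Fluctuations

/-! ### Rates of the two statistics -/

section Rates

/-- An error `o(1) g + O(ρ')` with bounded `g` and `ρ' → 0` vanishes in the limit and is of order
`max g ρ'`. -/
theorem tendsto_and_isBigO_of_abs_sub_le {x g η ρ' : ℕ → ℝ} {L K C : ℝ} (hg : ∀ j, 0 ≤ g j)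
    (hgb : BddAbove (range g)) (hη : Tendsto η atTop (𝓝 0)) (hρ' : Tendsto ρ' atTop (𝓝 0))
    (hρ0 : ∀ j, 0 ≤ ρ' j)
    (hx : ∀ᶠ j in atTop, |x j - L| ≤ K * (|η j| * g j + C * ρ' j)) :
    Tendsto x atTop (𝓝 L) ∧
      (fun j => x j - L) =O[atTop] fun j => max (g j) (ρ' j) := by
  obtain ⟨M, hM⟩ := hgb
  have hM' : ∀ j, g j ≤ M := fun j => hM (mem_range_self j)
  constructor
  · rw [tendsto_iff_norm_sub_tendsto_zero]
    have h1 : Tendsto (fun j => |η j| * g j) atTop (𝓝 0) := by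
      refine squeeze_zero (fun j => mul_nonneg (abs_nonneg _) (hg j))
        (fun j => mul_le_mul_of_nonneg_left (hM' j) (abs_nonneg _)) ?_
      simpa using hη.abs.mul_const M
    have h2 := (h1.add (hρ'.const_mul C)).const_mul K
    simp only [mul_zero, add_zero] at h2
    exact squeeze_zero' (Eventually.of_forall fun j => norm_nonneg _) hx h2
  · refine Asymptotics.IsBigO.of_bound (|K| * (1 + |C|)) ?_
    filter_upwards [hx, hη.abs.eventually_le_const (by simp : |(0 : ℝ)| < 1)] with j hj h1
    rw [Real.norm_eq_abs, Real.norm_of_nonneg (le_max_of_le_left (hg j)), mul_assoc]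
    have hm0 : 0 ≤ max (g j) (ρ' j) := le_max_of_le_left (hg j)
    have e1 : |η j| * g j ≤ max (g j) (ρ' j) :=
      (mul_le_of_le_one_left (hg j) h1).trans (le_max_left _ _)
    have e2 : C * ρ' j ≤ |C| * max (g j) (ρ' j) :=
      mul_le_mul (le_abs_self C) (le_max_right _ _) (hρ0 j) (abs_nonneg C)
    have e3 : -(|C| * max (g j) (ρ' j)) ≤ C * ρ' j := by
      have := mul_le_mul (neg_abs_le C |> neg_le.1) (le_max_right (g j) (ρ' j)) (hρ0 j) (abs_nonneg C)
      linarith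
    refine hj.trans ((le_abs_self _).trans ?_)
    rw [abs_mul]
    refine mul_le_mul_of_nonneg_left (abs_le.2 ⟨?_, by linarith⟩) (abs_nonneg K)
    linarith [mul_nonneg (abs_nonneg (η j)) (hg j)]

/-- If the mean `v` of `d` expands as `p + q a⁻² + O(a⁻³)` along a geometrically growing
sequence `a` and the noise `d - v` is `o(r)`, then `d → p` and the normalised increments of `d` tend
to `q`, both with rate `max (a² r) a⁻¹`. -/
theorem tendsto_and_isBigO_of_expansion {a r d v : ℕ → ℝ} {p q C ε : ℝ} (ha_pos : ∀ j, 0 < a j)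
    (ha_mono : StrictMono a) (ha_top : Tendsto a atTop atTop) (hr : ∀ j, 0 < r j)
    (hr_anti : Antitone r) (hε : 0 < ε) (hgrow : ∀ᶠ j in atTop, (1 + ε) * a j ≤ a (j + 1))
    (hb : BddAbove (range fun j => a j ^ 2 * r j)) (hC : 0 ≤ C)
    (hv : ∀ᶠ j in atTop, |v j - p - q * a j ^ (-2 : ℤ)| ≤ C * a j ^ (-3 : ℤ))
    (hn : Tendsto (fun j => (d j - v j) / r j) atTop (𝓝 0)) :
    (Tendsto d atTop (𝓝 p) ∧
      (fun j => d j - p) =O[atTop] fun j => max (a j ^ 2 * r j) (a j)⁻¹) ∧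
    (Tendsto (fun j => (d j - d (j + 1)) / (a j ^ (-2 : ℤ) - a (j + 1) ^ (-2 : ℤ))) atTop (𝓝 q) ∧
      (fun j => (d j - d (j + 1)) / (a j ^ (-2 : ℤ) - a (j + 1) ^ (-2 : ℤ)) - q) =O[atTop]
        fun j => max (a j ^ 2 * r j) (a j)⁻¹) := by
  set η : ℕ → ℝ := fun j => (d j - v j) / r j with hη
  have hinv : Tendsto (fun j => (a j)⁻¹) atTop (𝓝 0) := tendsto_inv_atTop_zero.comp ha_top
  have hg0 : ∀ j, 0 ≤ a j ^ 2 * r j := fun j => by have := hr j; positivity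
  have hi0 : ∀ j, 0 ≤ (a j)⁻¹ := fun j => inv_nonneg.2 (ha_pos j).le
  -- the deviation of `d` from its two-term expansion
  have hdev : ∀ᶠ j in atTop, |d j - p - q * a j ^ (-2 : ℤ)| ≤ |η j| * r j + C * a j ^ (-3 : ℤ) := by
    filter_upwards [hv] with j hj
    have : d j - p - q * a j ^ (-2 : ℤ) = η j * r j + (v j - p - q * a j ^ (-2 : ℤ)) := by
      simp only [hη]; rw [div_mul_cancel₀ _ (hr j).ne']; ring
    rw [this]
    refine (abs_add_le _ _).trans (add_le_add ?_ hj)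
    rw [abs_mul, abs_of_pos (hr j)]
  have e3 : ∀ j, a j ^ (-3 : ℤ) = a j ^ (-2 : ℤ) * (a j)⁻¹ := fun j => by
    rw [← zpow_sub_one₀ (ha_pos j).ne']; norm_num
  have e2 : ∀ j, r j = a j ^ (-2 : ℤ) * (a j ^ 2 * r j) := fun j => by
    have := (ha_pos j).ne'
    rw [zpow_neg, zpow_ofNat]; field_simp
  have h2pos : ∀ j, 0 < a j ^ (-2 : ℤ) := fun j => zpow_pos (ha_pos j) _
  constructor
  · refine tendsto_and_isBigO_of_abs_sub_le (η := η) (K := 1) (C := C + |q|) hg0 hb hn hinv hi0 ?_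
    filter_upwards [hdev, ha_top.eventually_ge_atTop 1] with j hj h1
    have h1' : (a j)⁻¹ ≤ 1 := inv_le_one_of_one_le₀ h1
    have h2 : a j ^ (-2 : ℤ) = (a j)⁻¹ * (a j)⁻¹ := by
      rw [zpow_neg, zpow_ofNat, sq, mul_inv]
    have h2' : a j ^ (-2 : ℤ) ≤ (a j)⁻¹ := by
      rw [h2]; exact mul_le_of_le_one_left (hi0 j) h1'
    have h21 : a j ^ (-2 : ℤ) ≤ 1 := h2'.trans h1'
    have : d j - p = (d j - p - q * a j ^ (-2 : ℤ)) + q * a j ^ (-2 : ℤ) := by ring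
    rw [this]
    refine (abs_add_le _ _).trans ?_
    rw [abs_mul, abs_of_pos (h2pos j), one_mul]
    have k1 : r j ≤ a j ^ 2 * r j := le_mul_of_one_le_left (hr j).le (one_le_pow₀ h1)
    have k2 : a j ^ (-3 : ℤ) ≤ (a j)⁻¹ := by
      rw [e3]; exact mul_le_of_le_one_left (hi0 j) h21
    have k3 := mul_le_mul_of_nonneg_left k1 (abs_nonneg (η j))
    have k4 := mul_le_mul_of_nonneg_left k2 hC
    have k5 := mul_le_mul_of_nonneg_left h2' (abs_nonneg q)
    linarith
  -- geometric growth makes `a j ^ (-2) - a (j + 1) ^ (-2)` comparable to `a j ^ (-2)`, and the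
  -- deviations at `j` and `j + 1` are both `a j ^ (-2)` times the claimed rate
  · set κ : ℝ := 1 - (1 + ε) ^ (-2 : ℤ) with hκ
    have hκ0 : 0 < κ := by
      have : (1 + ε) ^ (-2 : ℤ) < 1 := by
        rw [zpow_neg, zpow_ofNat]
        exact inv_lt_one_of_one_lt₀ (one_lt_pow₀ (by linarith) two_ne_zero)
      linarith
    have hη' : Tendsto (fun j => |η j| + |η (j + 1)|) atTop (𝓝 0) := by
      simpa using hn.abs.add (hn.comp (tendsto_add_atTop_nat 1)).abs
    refine tendsto_and_isBigO_of_abs_sub_le (η := fun j => |η j| + |η (j + 1)|) (K := κ⁻¹)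
      (C := 2 * C) hg0 hb hη' hinv hi0 ?_
    filter_upwards [hdev, (tendsto_add_atTop_nat 1).eventually hdev, hgrow] with j hj hj1 hgr
    have hD : κ * a j ^ (-2 : ℤ) ≤ a j ^ (-2 : ℤ) - a (j + 1) ^ (-2 : ℤ) := by
      have : a (j + 1) ^ (-2 : ℤ) ≤ (1 + ε) ^ (-2 : ℤ) * a j ^ (-2 : ℤ) := by
        have h0 : 0 < (1 + ε) * a j := mul_pos (by linarith) (ha_pos j)
        rw [← mul_zpow]
        simp only [zpow_neg, zpow_ofNat]
        gcongr
      rw [hκ]; linarith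
    have hD0 : 0 < a j ^ (-2 : ℤ) - a (j + 1) ^ (-2 : ℤ) :=
      (mul_pos hκ0 (h2pos j)).trans_le hD
    have hlt : a (j + 1) ^ (-3 : ℤ) ≤ a j ^ (-3 : ℤ) := by
      simp only [zpow_neg, zpow_ofNat]
      have := ha_pos j
      gcongr
      exact ha_mono.monotone j.le_succ
    have hr1 : r (j + 1) ≤ r j := hr_anti j.le_succ
    rw [div_sub' hD0.ne', abs_div, abs_of_pos hD0, div_le_iff₀ hD0,
      abs_of_nonneg (add_nonneg (abs_nonneg (η j)) (abs_nonneg (η (j + 1))))]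
    have hnum : |d j - d (j + 1) - (a j ^ (-2 : ℤ) - a (j + 1) ^ (-2 : ℤ)) * q|
        ≤ a j ^ (-2 : ℤ) * ((|η j| + |η (j + 1)|) * (a j ^ 2 * r j) + 2 * C * (a j)⁻¹) := by
      have e : d j - d (j + 1) - (a j ^ (-2 : ℤ) - a (j + 1) ^ (-2 : ℤ)) * q
          = (d j - p - q * a j ^ (-2 : ℤ)) - (d (j + 1) - p - q * a (j + 1) ^ (-2 : ℤ)) := by ring
      rw [e]
      refine (abs_sub _ _).trans ((add_le_add hj hj1).trans ?_)
      have k1 := mul_le_mul_of_nonneg_left hr1 (abs_nonneg (η (j + 1)))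
      have k2 := mul_le_mul_of_nonneg_left hlt hC
      have k3 : a j ^ (-2 : ℤ) * ((|η j| + |η (j + 1)|) * (a j ^ 2 * r j) + 2 * C * (a j)⁻¹)
          = (|η j| + |η (j + 1)|) * r j + 2 * C * a j ^ (-3 : ℤ) := by
        rw [e3]
        nth_rw 2 [e2]
        ring
      rw [k3]
      linarith
    refine hnum.trans ?_
    have hS : 0 ≤ (|η j| + |η (j + 1)|) * (a j ^ 2 * r j) + 2 * C * (a j)⁻¹ :=
      add_nonneg (mul_nonneg (by positivity) (hg0 j)) (mul_nonneg (by positivity) (hi0 j))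
    rw [mul_comm]
    calc _ = κ⁻¹ * ((|η j| + |η (j + 1)|) * (a j ^ 2 * r j) + 2 * C * (a j)⁻¹)
          * (κ * a j ^ (-2 : ℤ)) := by field_simp
      _ ≤ _ := mul_le_mul_of_nonneg_left hD (mul_nonneg (inv_nonneg.2 hκ0.le) hS)

end Rates

/-! ### Consistency of the estimators -/

/-- The limit of the normalised statistics lies in the interior of the feasible region, so that the
adjustment is eventually void. -/
theorem IsSeasonalSpectrum.limit_mem_feasible {f h : ℝ → ℝ} {s₀ α : ℝ}
    (hf : IsSeasonalSpectrum f h s₀ α) :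
    0 < s₀ ^ (-4 * α) ∧ s₀ ^ (-4 * α) < 1 ∧ 0 < α * s₀ ^ (-4 * α - 2) ∧
      α * s₀ ^ (-4 * α - 2) < (s₀ ^ (-4 * α)) ^ 2 / 2 := by
  have h1 := hf.one_lt_s₀
  have hα := hf.α_pos
  have hα2 := hf.α_lt_half
  have h0 : 0 < s₀ := zero_lt_one.trans h1
  refine ⟨Real.rpow_pos_of_pos h0 _, Real.rpow_lt_one_of_one_lt_of_neg h1 (by linarith),
    mul_pos hα (Real.rpow_pos_of_pos h0 _), ?_⟩
  have h2 : s₀ ^ (-4 * α - 2) < (s₀ ^ (-4 * α)) ^ 2 := by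
    rw [← Real.rpow_natCast, ← Real.rpow_mul h0.le]
    exact Real.rpow_lt_rpow_of_exponent_lt h1 (by push_cast; linarith)
  have h3 : 0 < s₀ ^ (-4 * α - 2) := Real.rpow_pos_of_pos h0 _
  nlinarith

/-- Along a realisation where both statistics converge, the estimators converge at the rate of the
statistics. -/
theorem estimators_tendsto_and_isBigO {f h : ℝ → ℝ} {s₀ α : ℝ}
    (hf : IsSeasonalSpectrum f h s₀ α) {ψhat : ℝ → ℂ} (hc₂ : 0 < c₂ ψhat) (hc₃ : 0 < c₃ ψhat)
    {d D s β ρ : ℕ → ℝ} (hd : Tendsto d atTop (𝓝 (c₂ ψhat * s₀ ^ (-4 * α))))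
    (hD : Tendsto D atTop (𝓝 (c₃ ψhat * (α * s₀ ^ (-4 * α - 2)))))
    (hdO : (fun j => d j - c₂ ψhat * s₀ ^ (-4 * α)) =O[atTop] ρ)
    (hDO : (fun j => D j - c₃ ψhat * (α * s₀ ^ (-4 * α - 2))) =O[atTop] ρ)
    (hsol : ∀ j, (∃ s' α',
        SolvesSystem ψhat (c₂ ψhat * (adjust (d j / c₂ ψhat) (D j / c₃ ψhat)).1)
          (c₃ ψhat * (adjust (d j / c₂ ψhat) (D j / c₃ ψhat)).2) s' α') →
      SolvesSystem ψhat (c₂ ψhat * (adjust (d j / c₂ ψhat) (D j / c₃ ψhat)).1)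
          (c₃ ψhat * (adjust (d j / c₂ ψhat) (D j / c₃ ψhat)).2) (s j) (β j)) :
    Tendsto s atTop (𝓝 s₀) ∧ Tendsto β atTop (𝓝 α) ∧
      (fun j => s j - s₀) =O[atTop] ρ ∧ (fun j => β j - α) =O[atTop] ρ := by
  obtain ⟨hU0, hU1, hV0, hVU⟩ := hf.limit_mem_feasible
  have hu : Tendsto (fun j => d j / c₂ ψhat) atTop (𝓝 (s₀ ^ (-4 * α))) := by
    simpa [hc₂.ne'] using hd.div_const (c₂ ψhat)
  have hw : Tendsto (fun j => D j / c₃ ψhat) atTop (𝓝 (α * s₀ ^ (-4 * α - 2))) := by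
    simpa [hc₃.ne'] using hD.div_const (c₃ ψhat)
  have hev : ∀ᶠ j in atTop, 0 < s j ∧ 0 < β j ∧
      β j * s j ^ (-4 * β j - 2) = D j / c₃ ψhat ∧ s j ^ (-4 * β j) = d j / c₂ ψhat := by
    filter_upwards [hu.eventually_const_lt hU0, hu.eventually_lt_const hU1,
      hw.eventually_const_lt hV0, hw.eventually_lt ((hu.pow 2).div_const 2) hVU] with j h1 h2 h3 h4
    have hj := hsol j
    simp only [SolvesSystem, adjust_of_mem h2 h3 h4, mul_div_cancel_left₀ _ hc₂.ne',
      mul_div_cancel_left₀ _ hc₃.ne'] at hj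
    exact hj (exists_system_solution h1 h2 h3)
  obtain ⟨hs, hβ, hO⟩ := system_solutions_isBigO hf.one_lt_s₀ hf.α_pos rfl rfl hu hw hev
  refine ⟨hs, hβ, hO ρ ?_ ?_⟩
  · refine (hdO.const_mul_left (c₂ ψhat)⁻¹).congr_left fun j => ?_
    field_simp
  · refine (hDO.const_mul_left (c₃ ψhat)⁻¹).congr_left fun j => ?_
    field_simp

end SeasonalLongMemory

open SeasonalLongMemory in
theorem theorem1 {Ω : Type*} [MeasurableSpace Ω] (P : Measure Ω) [IsProbabilityMeasure P]
    (X : ℝ → Ω → ℝ) (f h : ℝ → ℝ) (s₀ α : ℝ) (ψ : ℝ → ℝ) (ψhat : ℝ → ℂ) (A : ℝ)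
    (hX : IsGaussianWithSpectralDensity P X f)
    (hf : IsSeasonalSpectrum f h s₀ α)
    (hψ : IsBandLimitedFilter ψ ψhat A)
    (hψ_ne : ¬ ψ =ᵐ[volume] 0)
    (hB : ImproperCovarianceIntegralExists P X ψ)
    (a : ℕ → ℝ) (b : ℕ → ℤ → ℝ) (m : ℕ → ℕ)
    (ha_pos : ∀ j, 0 < a j) (ha_mono : StrictMono a) (ha_top : Tendsto a atTop atTop)
    (hm : ∀ j, 0 < m j)
    (sHat αHat : ℕ → Ω → ℝ)
    (hs_meas : ∀ j, AEMeasurable (sHat j) P) (hα_meas : ∀ j, AEMeasurable (αHat j) P)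
    (hsol : ∀ j ω,
      (∃ s' α', SolvesSystem ψhat (adjMeanSquare P X ψ ψhat a b m j ω)
        (adjIncrMeanSquare P X ψ ψhat a b m j ω) s' α') →
      SolvesSystem ψhat (adjMeanSquare P X ψ ψhat a b m j ω)
        (adjIncrMeanSquare P X ψ ψhat a b m j ω) (sHat j ω) (αHat j ω)) :
    (∀ j ω,
      SolvesSystem ψhat (adjMeanSquare P X ψ ψhat a b m j ω)
        (adjIncrMeanSquare P X ψ ψhat a b m j ω) (sHat j ω) (αHat j ω) →
      ∀ d q : ℝ, d = adjMeanSquare P X ψ ψhat a b m j ω →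
      q = c₂ ψhat / c₃ ψhat * (adjIncrMeanSquare P X ψ ψhat a b m j ω / d) →
      sHat j ω = Real.exp (1 / 2 * lambertW (Real.log (c₂ ψhat / d) / (2 * q))) ∧
      αHat j ω = q * Real.exp (lambertW (Real.log (c₂ ψhat / d) / (2 * q)))) ∧
    (∀ γ r : ℕ → ℝ,
      (∀ j, 0 < γ j) →
      (∀ (j : ℕ) (k₁ k₂ : ℤ), |(k₁ : ℝ) - k₂| * γ j ≤ |b j k₁ - b j k₂|) →
      (∀ j, 0 < r j) → Antitone r → Tendsto r atTop (𝓝 0) →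
      Summable (fun j => 1 / (r j ^ 2 * m j)) →
      Summable (fun j => a j ^ 2 / (r j ^ 2 * γ j ^ 2 * m j)) →
      (∃ ε : ℝ, 0 < ε ∧ ∃ j₀ : ℕ, ∀ j ≥ j₀, (1 + ε) * a j ≤ a (j + 1)) →
      BddAbove (range fun j => a j ^ 2 * r j) →
      (∀ᵐ ω ∂P, Tendsto (fun j => sHat j ω) atTop (𝓝 s₀)) ∧
      (∀ᵐ ω ∂P, Tendsto (fun j => αHat j ω) atTop (𝓝 α)) ∧
      ∃ c₁₀ c₁₁ : Ω → ℝ, Measurable c₁₀ ∧ Measurable c₁₁ ∧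
        (∀ᵐ ω ∂P, ∀ j, |sHat j ω - s₀| ≤ c₁₀ ω * max (a j ^ 2 * r j) (a j)⁻¹) ∧
        (∀ᵐ ω ∂P, ∀ j, |αHat j ω - α| ≤ c₁₁ ω * max (a j ^ 2 * r j) (a j)⁻¹)) := by
  refine ⟨fun j ω hs d q hd hq => ?_, fun γ r hγ hsep hr hr_anti _ hsum₁ hsum₂ hgrow hbdd => ?_⟩
  · subst hq hd
    refine solution_eq_lambertW hs ?_
    -- for `c₂ = 0` the second equation would make a positive power vanish
    have hc : c₂ ψhat ≠ 0 := fun h0 => by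
      have h1 := hs.2.2.2
      rw [h0, div_zero] at h1
      exact (Real.rpow_pos_of_pos hs.1 _).ne' h1
    rw [adjMeanSquare, mul_div_cancel_left₀ _ hc]
    exact adjust_fst_le_one _ _
  have hc₂ := hψ.c₂_pos hψ_ne
  have hc₃ := hψ.c₃_pos hψ_ne
  obtain ⟨ε, hε, j₀, hj₀⟩ := hgrow
  obtain ⟨C, hC, hexp⟩ := exists_filterVariance_expansion hψ hf hX.density_integrable
  obtain ⟨K, -, hvar⟩ := exists_meanSquare_variance_le hX hψ hf
  obtain ⟨J, hJ⟩ := eventually_atTop.1 (ha_top.eventually_gt_atTop (2 * A))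
  have hnoise : ∀ᵐ ω ∂P, Tendsto (fun j =>
      (meanSquare P X ψ a b m j ω - filterVariance ψhat f (a j)) / r j) atTop (𝓝 0) := by
    refine ae_tendsto_div_of_summable
      (fun j hj => hvar a b m j (γ j) (hJ j hj) (hm j) (hγ j) (hsep j)) ?_
    refine ((hsum₁.add hsum₂).mul_left K).congr fun j => ?_
    have h1 := (hr j).ne'
    have h2 := (hγ j).ne'
    have h3 : (m j : ℝ) ≠ 0 := by exact_mod_cast (hm j).ne'
    field_simp
  have hω : ∀ᵐ ω ∂P, Tendsto (fun j => sHat j ω) atTop (𝓝 s₀) ∧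
      Tendsto (fun j => αHat j ω) atTop (𝓝 α) ∧
      ((fun j => sHat j ω - s₀) =O[atTop] fun j => max (a j ^ 2 * r j) (a j)⁻¹) ∧
      (fun j => αHat j ω - α) =O[atTop] fun j => max (a j ^ 2 * r j) (a j)⁻¹ := by
    filter_upwards [hnoise] with ω hω
    obtain ⟨⟨h1, h2⟩, h3, h4⟩ := tendsto_and_isBigO_of_expansion ha_pos ha_mono ha_top hr hr_anti hε
      (eventually_atTop.2 ⟨j₀, hj₀⟩) hbdd hC
      (eventually_atTop.2 ⟨J, fun j hj => hexp (a j) (hJ j hj)⟩) hω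
    exact estimators_tendsto_and_isBigO hf hc₂ hc₃ h1 h3 h2 h4 fun j => hsol j ω
  have hρ : ∀ j, 0 < max (a j ^ 2 * r j) (a j)⁻¹ := fun j =>
    lt_max_of_lt_right (inv_pos.2 (ha_pos j))
  obtain ⟨k₁, hk₁, hb₁⟩ := exists_measurable_bound hs_meas hρ (hω.mono fun ω h => h.2.2.1)
  obtain ⟨k₂, hk₂, hb₂⟩ := exists_measurable_bound hα_meas hρ (hω.mono fun ω h => h.2.2.2)
  exact ⟨hω.mono fun ω h => h.1, hω.mono fun ω h => h.2.1, k₁, k₂, hk₁, hk₂, hb₁, hb₂⟩
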